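/- **Setting.** Fix $\mu\in[0,1]$ and put $\vec m=(\mu-1,0,0)$, $\vec e=(\mu,0,0)$ (the primaries, of masses $\mu$ and $1-\mu$). On $\{(q,p)\in\mathbb R^3\times\mathbb R^3: q\ne\vec m,\vec e\}$ let $$H(q,p)=\tfrac12\|p\|^2-\frac{\mu}{\|q-\vec m\|}-\frac{1-\mu}{\|q-\vec e\|}+p_1q_2-p_2q_1 ,$$ let $L_1$ be a critical point of $H$ with the smallest critical value, and $L_2$ one with the second lowest critical value. Let $a=(a_1,0,0)$ be a primary, of mass $g>0$, and $a'$ the other one, of mass $g'=1-g$. *Moser regularization at $a$ for the energy $c$* uses $T^*S^3=\{(\xi,\eta)\in\mathbb R^4\times\mathbb R^4:\|\xi\|=1,\ \langle\xi,\eta\rangle=0\}$ with $\xi=(\xi_0,\vec\xi)$, $\eta=(\eta_0,\vec\eta)$ and the form $d\eta\wedge d\xi$, where $$q=a+\eta_0\vec\xi+(1-\xi_0)\vec\eta,\qquad p=-\frac{\vec\xi}{1-\xi_0},\qquad Q=\tfrac12 f^2\|\eta\|^2,$$ $$f=1+(1-\xi_0)\Bigl(-(c+\tfrac12)+\xi_2\eta_1-\xi_1\eta_2-\frac{g'}{\|q-a'\|}\Bigr)+a_1\xi_2,$$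 so that $\|\eta\|f-g=(H-c)\|q-a\|$ for $\xi_0\neq1$, $\eta\neq 0$. The regularized level set is $\{Q=g^2/2\}$; it contains the collision locus $\xi_0=1$, which lies over $q=a$; on the level set, away from collisions and where $f>0$, the Hamiltonian vector field $X_Q$ equals $g\,\|q-a\|X_H$. For $0<\mu<1$, the *doubly regularized* level set is obtained from the parts $\{Q=g^2/2,\ f>0\}$ of the level sets regularized at $\vec m$ and at $\vec e$ by identifying points with the same $(q,p)\in H^{-1}(c)$; a *regularized Hamiltonian vector field* on it is a smooth vector field that is a positive multiple of $X_Q$ in the regularized coordinates at each primary. Let $\Sigma$ be a manifold with a nowhere vanishing vector field $X$ with complete flow $\varphi_t$. A *global hypersurface of section* with boundary $B$ is a compact embedded hypersurface $P\subset\Sigma$ with boundary $\partial P=B$, oriented so that $X$ is positively transverse to $P\setminus B$, such that $B$ is $\varphi_t$-invariant and for every $x\in\Sigma\setminus B$ there are $\tau_+>0>\tau_-$ with $\varphi_{\tau_\pm}(x)\in P\setminus B$. By an *$S^1$-family of global hypersurfaces of section with boundary $B$* we mean the sets $P_\theta=\{x\in\Sigma:\Theta(x)\in\mathbb R_{\ge0}\,\theta\}$,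 $\theta\in S^1$, where $\Theta:\Sigma\to\mathbb C$ is smooth with regular zero set $\Theta^{-1}(0)=B$, $d(\arg\Theta)(X)>0$ on $\Sigma\setminus B$, and every $P_\theta$ is a global hypersurface of section with boundary $B$. **Theorem 1.2.** Let $c\in\mathbb R$. 1. Let $c<H(L_1)$, let $a$ be a primary of mass $g>0$, and let $\Sigma_c$ be a connected component of the level set $\{Q=g^2/2\}$, regularized at $a$, whose projection to the $q$-space contains $a$. Let $B=\Sigma_c\cap\{\xi_3=\eta_3=0\}$ (the planar problem). Then, for the flow of $X_Q$ on $\Sigma_c$, the set $\{\xi_3=0\}$ gives global hypersurfaces of section: each of its two halves $\Sigma_c\cap\{\xi_3=0,\ \eta_3\ge0\}$ and $\Sigma_c\cap\{\xi_3=0,\ \eta_3\le0\}$ is a global hypersurface of section with boundary $B$. Moreover, they are the members $P_1$ and $P_{-1}$ of an $S^1$-family of global hypersurfaces of section with boundary $B$. 2. Let $0<\mu<1$ and $c\in(H(L_1),H(L_2))$, let $\Sigma_c$ be a connected component of the doubly regularized level set whose projection to the $q$-space contains $\vec m$ or $\vec e$, and let $B\subset\Sigma_c$ be the planar problem $\{\xi_3=\eta_3=0\}$.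 Then $\Sigma_c$ admits an $S^1$-family of global hypersurfaces of section with boundary $B$ (in particular, it admits a global hypersurface of section). One function $\Theta$ serves for the flows of all regularized Hamiltonian vector fields on $\Sigma_c$. No contact condition on $\Sigma_c$ is assumed. -/

import Mathlib

open scoped ContDiff Topology

noncomputable section

namespace CR3BP

/-! ### The spatial circular restricted three-body problem -/

abbrev E3 := EuclideanSpace ℝ (Fin 3)
abbrev E4 := EuclideanSpace ℝ (Fin 4)

/-- `T^*ℝ⁴`; a point is written `z = (ξ, η)`, with `ξ = (ξ₀, ξ₁, ξ₂, ξ₃)` the base point and `η` the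
covector. -/
abbrev Phase := E4 × E4

/-- The two primaries. -/
inductive Primary
  | moon
  | earth

/-- The other primary. -/
def Primary.other : Primary → Primary
  | .moon => .earth
  | .earth => .moon

/-- The Moon has mass `μ`, the Earth has mass `1 - μ`. -/
def mass (μ : ℝ) : Primary → ℝ
  | .moon => μ
  | .earth => 1 - μ

/-- First coordinate of a primary in the rotating frame. -/
def coord (μ : ℝ) : Primary → ℝ
  | .moon => μ - 1
  | .earth => μ

/-- Position of a primary in the rotating frame. -/
def pos (μ : ℝ) (k : Primary) : E3 := !₂[coord μ k, 0, 0]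

/-- The Jacobi Hamiltonian at `x = (q, p)`, meaningful when `q` is not a primary. The paper's
`q₁, q₂, q₃` are `q 0, q 1, q 2`. -/
def H (μ : ℝ) (x : E3 × E3) : ℝ :=
  ‖x.2‖ ^ 2 / 2 - μ / ‖x.1 - pos μ .moon‖ - (1 - μ) / ‖x.1 - pos μ .earth‖
    + x.2 0 * x.1 1 - x.2 1 * x.1 0

/-- Critical points of the Jacobi Hamiltonian on `{(q, p) : q ≠ m, q ≠ e}`. -/
def IsLagrangePoint (μ : ℝ) (x : E3 × E3) : Prop :=
  x.1 ≠ pos μ .moon ∧ x.1 ≠ pos μ .earth ∧ HasFDerivAt (H μ) (0 : E3 × E3 →L[ℝ] ℝ) x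

/-- `x` is a critical point of `H` with the smallest critical value. -/
def IsFirstLagrangePoint (μ : ℝ) (x : E3 × E3) : Prop :=
  IsLagrangePoint μ x ∧ ∀ y, IsLagrangePoint μ y → H μ x ≤ H μ y

/-- `x` is a critical point of `H` with the second lowest critical value, where `x₁` is one with the
smallest critical value. -/
def IsSecondLagrangePoint (μ : ℝ) (x₁ x : E3 × E3) : Prop :=
  IsLagrangePoint μ x ∧ H μ x₁ < H μ x ∧
    ∀ y, IsLagrangePoint μ y → H μ x₁ < H μ y → H μ x ≤ H μ y

/-! ### Moser regularization at a primary -/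

/-- `ξ⃗ = (ξ₁, ξ₂, ξ₃)`. -/
def vec (ξ : E4) : E3 := !₂[ξ 1, ξ 2, ξ 3]

/-- `y⃗ = η₀ ξ⃗ + (1 - ξ₀) η⃗`, the position relative to the primary. -/
def relPos (z : Phase) : E3 := z.2 0 • vec z.1 + (1 - z.1 0) • vec z.2

/-- The position `q`, in regularized coordinates at the primary `k`. -/
def position (μ : ℝ) (k : Primary) (z : Phase) : E3 := pos μ k + relPos z

/-- The momentum `p = - ξ⃗ / (1 - ξ₀)`, meaningful away from the collision fibre `ξ₀ = 1`. -/
def momentum (z : Phase) : E3 := -((1 - z.1 0)⁻¹ • vec z.1)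

/-- The cotangent bundle `T^*S³ ⊆ T^*ℝ⁴`. -/
def TstarS3 : Set Phase := {z | ‖z.1‖ = 1 ∧ inner ℝ z.1 z.2 = 0}

/-- The function `f` for which `(H - c) |q - a| = ‖η‖ f - g`, where `a`, `g` are the position and the
mass of the primary `k`; see `moser_identity`. -/
def f (μ : ℝ) (k : Primary) (c : ℝ) (z : Phase) : ℝ :=
  1 + (1 - z.1 0) * (-(c + 1 / 2) + z.1 2 * z.2 1 - z.1 1 * z.2 2
      - mass μ k.other / ‖position μ k z - pos μ k.other‖)
    + coord μ k * z.1 2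

/-- The regularized Hamiltonian `Q = f² ‖η‖² / 2`. -/
def Q (μ : ℝ) (k : Primary) (c : ℝ) (z : Phase) : ℝ := f μ k c z ^ 2 * ‖z.2‖ ^ 2 / 2

/-- The regularized level set `Q = g² / 2` in `T^*S³`, off the fibres over the other primary (where
`Q` is singular). -/
def level (μ : ℝ) (k : Primary) (c : ℝ) : Set Phase :=
  {z | z ∈ TstarS3 ∧ position μ k z ≠ pos μ k.other ∧ Q μ k c z = mass μ k ^ 2 / 2}

/-- The canonical symplectic form `dη ∧ dξ`. -/
def omega (v w : Phase) : ℝ := inner ℝ v.2 w.1 - inner ℝ w.2 v.1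

/-- The tangent space of `T^*S³` at `z`. -/
def tangentTstarS3 (z : Phase) : Set Phase :=
  {v | inner ℝ z.1 v.1 = 0 ∧ inner ℝ v.1 z.2 + inner ℝ z.1 v.2 = 0}

/-- The Hamiltonian vector field on `T^*S³` of the restriction of a function `G` defined near `T^*S³`;
see `hamVec_mem` and `omega_hamVec`. -/
def hamVec (G : Phase → ℝ) (z : Phase) : Phase :=
  let Gξ : E4 := gradient (fun x : E4 => G (x, z.2)) z.1
  let Gη : E4 := gradient (fun y : E4 => G (z.1, y)) z.2
  (Gη - inner ℝ Gη z.1 • z.1,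
    -Gξ + inner ℝ Gη z.1 • z.2 + (inner ℝ Gξ z.1 - inner ℝ Gη z.2) • z.1)

/-- The tangent space at `z` of the level set of `Q` in `T^*S³`. -/
def tangentLevel (μ : ℝ) (k : Primary) (c : ℝ) (z : Phase) : Set Phase :=
  {v | v ∈ tangentTstarS3 z ∧ fderiv ℝ (Q μ k c) z v = 0}

lemma norm_relPos {z : Phase} (hz : z ∈ TstarS3) : ‖relPos z‖ = (1 - z.1 0) * ‖z.2‖ := by
  obtain ⟨h1, h2⟩ := hz
  have h1' : z.1 0 ^ 2 + z.1 1 ^ 2 + z.1 2 ^ 2 + z.1 3 ^ 2 = 1 := by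
    have := EuclideanSpace.real_norm_sq_eq z.1
    rw [h1, Fin.sum_univ_four] at this
    linarith
  have h2' : z.1 0 * z.2 0 + z.1 1 * z.2 1 + z.1 2 * z.2 2 + z.1 3 * z.2 3 = 0 := by
    rw [PiLp.inner_apply, Fin.sum_univ_four] at h2
    simp only [RCLike.inner_apply, conj_trivial] at h2
    linarith
  have hle : z.1 0 ≤ 1 := by
    nlinarith [sq_nonneg (z.1 1), sq_nonneg (z.1 2), sq_nonneg (z.1 3)]
  rw [← abs_of_nonneg (norm_nonneg (relPos z)),
    ← abs_of_nonneg (mul_nonneg (sub_nonneg.2 hle) (norm_nonneg z.2)), ← sq_eq_sq_iff_abs_eq_abs,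
    mul_pow, EuclideanSpace.real_norm_sq_eq, EuclideanSpace.real_norm_sq_eq, Fin.sum_univ_three,
    Fin.sum_univ_four]
  simp [relPos, vec]
  linear_combination (z.2 0 ^ 2) * h1' + 2 * z.2 0 * (1 - z.1 0) * h2'

/-- Away from collisions, `‖η‖ f - g` is the function `(H - c) |q - a|` in regularized coordinates. -/
lemma moser_identity (μ : ℝ) (k : Primary) (c : ℝ) {z : Phase} (hz : z ∈ TstarS3)
    (h0 : z.1 0 ≠ 1) (hη : z.2 ≠ 0) :
    (H μ (position μ k z, momentum z) - c) * ‖position μ k z - pos μ k‖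
      = ‖z.2‖ * f μ k c z - mass μ k := by
  have hn := norm_relPos hz
  obtain ⟨h1, -⟩ := hz
  have h1' : z.1 0 ^ 2 + z.1 1 ^ 2 + z.1 2 ^ 2 + z.1 3 ^ 2 = 1 := by
    have := EuclideanSpace.real_norm_sq_eq z.1
    rw [h1, Fin.sum_univ_four] at this
    linarith
  have ht : (1 - z.1 0) ≠ 0 := sub_ne_zero.2 (Ne.symm h0)
  have hN : ‖z.2‖ ≠ 0 := norm_ne_zero_iff.2 hη
  have hp : ‖momentum z‖ ^ 2 = (1 + z.1 0) / (1 - z.1 0) := by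
    rw [EuclideanSpace.real_norm_sq_eq, Fin.sum_univ_three]
    simp [momentum, vec]
    field_simp
    linear_combination h1'
  have hr : position μ k z - pos μ k = relPos z := by simp [position]
  have hL : momentum z 0 * position μ k z 1 - momentum z 1 * position μ k z 0
      = z.1 2 * z.2 1 - z.1 1 * z.2 2 + coord μ k * z.1 2 / (1 - z.1 0) := by
    simp [momentum, vec, position, pos, relPos]
    field_simp
    ring
  have hH : H μ (position μ k z, momentum z) = ((1 + z.1 0) / (1 - z.1 0)) / 2
      - mass μ k / ((1 - z.1 0) * ‖z.2‖) - mass μ k.other / ‖position μ k z - pos μ k.other‖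
      + (z.1 2 * z.2 1 - z.1 1 * z.2 2 + coord μ k * z.1 2 / (1 - z.1 0)) := by
    rw [← hL, ← hp, ← hn, ← hr]
    cases k <;> simp [H, mass, Primary.other] <;> ring
  rw [hH, hr, hn, f]
  generalize mass μ k.other / ‖position μ k z - pos μ k.other‖ = w
  field_simp
  ring

lemma hamVec_mem (G : Phase → ℝ) {z : Phase} (hz : z ∈ TstarS3) :
    hamVec G z ∈ tangentTstarS3 z := by
  obtain ⟨h1, h2⟩ := hz
  have h3 : inner ℝ z.1 z.1 = (1 : ℝ) := by rw [real_inner_self_eq_norm_sq, h1]; norm_num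
  refine ⟨?_, ?_⟩
  · simp only [hamVec, inner_sub_right, inner_smul_right, h3]
    rw [real_inner_comm]; ring
  · simp only [hamVec, inner_sub_left, inner_add_right, inner_neg_right, inner_smul_right,
      inner_smul_left, h3, h2, conj_trivial]
    rw [real_inner_comm z.1 (gradient (fun x : E4 => G (x, z.2)) z.1)]
    ring

/-- `ω(X_G, ·) = - dG` on `T^*S³`. -/
lemma omega_hamVec (G : Phase → ℝ) {z : Phase} (hG : DifferentiableAt ℝ G z) {v : Phase}
    (hv : v ∈ tangentTstarS3 z) : omega (hamVec G z) v = -fderiv ℝ G z v := by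
  obtain ⟨h1, h2⟩ := hv
  have hG' : HasFDerivAt G (fderiv ℝ G z) (z.1, z.2) := hG.hasFDerivAt
  have e1 : inner ℝ (gradient (fun x : E4 => G (x, z.2)) z.1) v.1 = fderiv ℝ G z (v.1, 0) := by
    have hd : HasFDerivAt (fun x : E4 => G (x, z.2)) _ z.1 :=
      hG'.comp z.1 (hasFDerivAt_prodMk_left z.1 z.2)
    rw [gradient, InnerProductSpace.toDual_symm_apply, hd.fderiv]
    simp
  have e2 : inner ℝ (gradient (fun y : E4 => G (z.1, y)) z.2) v.2 = fderiv ℝ G z (0, v.2) := by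
    have hd : HasFDerivAt (fun y : E4 => G (z.1, y)) _ z.2 :=
      hG'.comp z.2 (hasFDerivAt_prodMk_right z.1 z.2)
    rw [gradient, InnerProductSpace.toDual_symm_apply, hd.fderiv]
    simp
  have e3 : fderiv ℝ G z v = fderiv ℝ G z (v.1, 0) + fderiv ℝ G z (0, v.2) := by
    rw [← map_add]; simp
  rw [e3, ← e1, ← e2]
  simp only [omega, hamVec, inner_sub_right, inner_add_left, inner_neg_left, inner_smul_right,
    inner_smul_left, h1, conj_trivial]
  rw [real_inner_comm v.1 z.2, real_inner_comm z.1 v.2] at *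
  rw [real_inner_comm v.2 (gradient (fun y : E4 => G (z.1, y)) z.2)] at *
  linear_combination (inner ℝ (gradient (fun y : E4 => G (z.1, y)) z.2) z.1) * h2

/-! ### Spaces glued from patches, and global hypersurfaces of section -/

/-- A space covered by patches, each of which is a subset of `T^*ℝ⁴` with given tangent spaces. Only
the two instances `singlyRegularized` and `doublyRegularized` below are used. -/
structure PatchedSpace where
  carrier : Type
  [top : TopologicalSpace carrier]
  index : Type
  patch : index → Set Phase
  incl : (i : index) → patch i → carrier
  tangent : index → Phase → Set Phase

attribute [instance] PatchedSpace.top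

/-- `u` is smooth on a neighbourhood of `z`. -/
def SmoothNear {W : Type} [NormedAddCommGroup W] [NormedSpace ℝ W] (u : Phase → W) (z : Phase) :
    Prop :=
  ∃ U ∈ 𝓝 z, ContDiffOn ℝ ∞ u U

/-- `γ` is an integral curve, defined for all times, of the vector field given by `X i` in the
patch `i`. -/
def IsIntegralLine (F : PatchedSpace) (X : F.index → Phase → Phase) (γ : ℝ → F.carrier) : Prop :=
  ∀ t, ∃ (i : F.index) (ζ : ℝ → F.patch i), (∀ᶠ s in 𝓝 t, γ s = F.incl i (ζ s)) ∧
    HasDerivAt (fun s => (ζ s : Phase)) (X i (ζ t)) t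

/-- `P`, with boundary `B`, is a global hypersurface of section in `S` (a union of components of the
space) for the flow of the vector field given by `X i` in the patch `i`. The orientation of `P` is the
one for which the flow is positively transverse to `P \ B`; the interior of `P` is `P \ B`. -/
structure IsGlobalHypersurfaceOfSection (F : PatchedSpace) (X : F.index → Phase → Phase)
    (S P B : Set F.carrier) : Prop where
  /-- the vector field is nowhere vanishing on `S` -/
  nonvanishing : ∀ (i : F.index) (z : F.patch i), F.incl i z ∈ S → X i z ≠ 0
  /-- its flow on `S` is defined for all times -/
  complete : ∀ x ∈ S, ∃ γ, IsIntegralLine F X γ ∧ γ 0 = x ∧ ∀ t, γ t ∈ S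
  subset : P ⊆ S
  boundary_subset : B ⊆ P
  isCompact : IsCompact P
  /-- near a point of `B`, `P = {u = 0, v ≥ 0}` and `B = {u = v = 0}` with `du`, `dv` linearly
  independent on the tangent space -/
  boundary_chart : ∀ (i : F.index) (z : F.patch i), F.incl i z ∈ B →
    ∃ u v : Phase → ℝ, SmoothNear u z ∧ SmoothNear v z ∧
      (∀ a b : ℝ, ∃ w ∈ F.tangent i z, fderiv ℝ u z w = a ∧ fderiv ℝ v z w = b) ∧
      ∀ᶠ w : F.patch i in 𝓝 z, (F.incl i w ∈ P ↔ u w = 0 ∧ 0 ≤ v w) ∧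
        (F.incl i w ∈ B ↔ u w = 0 ∧ v w = 0)
  /-- near a point of `P \ B`, `P = {u = 0}` with `du(X) > 0` -/
  interior_chart : ∀ (i : F.index) (z : F.patch i), F.incl i z ∈ P \ B →
    ∃ u : Phase → ℝ, SmoothNear u z ∧ 0 < fderiv ℝ u z (X i z) ∧
      ∀ᶠ w : F.patch i in 𝓝 z, (F.incl i w ∈ P ↔ u w = 0)
  invariant : ∀ γ, IsIntegralLine F X γ → γ 0 ∈ B → ∀ t, γ t ∈ B
  returns : ∀ γ, IsIntegralLine F X γ → γ 0 ∈ S \ B →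
    (∃ τ, 0 < τ ∧ γ τ ∈ P \ B) ∧ ∃ τ, τ < 0 ∧ γ τ ∈ P \ B

/-- The page `{x ∈ S : Θ x ∈ ℝ_{≥ 0} · θ}` of a function `Θ : S → ℂ`. -/
def page {T : Type} (S : Set T) (Θ : T → ℂ) (θ : Circle) : Set T :=
  {x | x ∈ S ∧ Θ x = (‖Θ x‖ : ℂ) * (θ : ℂ)}

/-- `Θ` is a smooth function on `S` with regular zero set `B` whose argument `S \ B → S¹` increases
strictly along the vector field and all of whose pages are global hypersurfaces of section with
boundary `B`: an `S¹`-family of such hypersurfaces, which are the pages of an open book with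
binding `B`. -/
structure IsCircleFamily (F : PatchedSpace) (X : F.index → Phase → Phase) (S B : Set F.carrier)
    (Θ : F.carrier → ℂ) : Prop where
  zero_iff : ∀ x ∈ S, Θ x = 0 ↔ x ∈ B
  smooth : ∀ (i : F.index) (z : F.patch i), F.incl i z ∈ S → ∃ Ψ : Phase → ℂ, SmoothNear Ψ z ∧
    (∀ᶠ w : F.patch i in 𝓝 z, Θ (F.incl i w) = Ψ w) ∧
    (Ψ z = 0 → ∀ a : ℂ, ∃ w ∈ F.tangent i z, fderiv ℝ Ψ z w = a) ∧
    (Ψ z ≠ 0 → 0 < (star (Ψ z) * fderiv ℝ Ψ z (X i z)).im)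
  pages : ∀ θ : Circle, IsGlobalHypersurfaceOfSection F X S (page S Θ θ) B

/-! ### The regularized energy hypersurfaces -/

/-- The level set regularized at the primary `k`, as a subset of `T^*S³`. -/
def singlyRegularized (μ : ℝ) (k : Primary) (c : ℝ) : PatchedSpace where
  carrier := level μ k c
  index := Unit
  patch := fun _ => level μ k c
  incl := fun _ z => z
  tangent := fun _ => tangentLevel μ k c

/-- The part of the level set `Q = g² / 2` that lies over `H = c`. (As `f ‖η‖ = ± g` on the level set,
it is a union of components. The points with `f < 0` lie over `H = c - 2 g / |q - a|`.) -/
def sheet (μ : ℝ) (c : ℝ) (k : Primary) : Set Phase := {z | z ∈ level μ k c ∧ 0 < f μ k c z}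

/-- Two points, each in regularized coordinates at one of the primaries, are identified when they have
the same `ξ`, the same position `q` and, at a collision, the same `η`. Away from collisions this means
that they have the same `(q, p)`; at a collision, that they are equal. -/
def gluing (μ c : ℝ) : Setoid (Σ k : Primary, sheet μ c k) where
  r a b := (a.2 : Phase).1 = (b.2 : Phase).1 ∧
    position μ a.1 (a.2 : Phase) = position μ b.1 (b.2 : Phase) ∧
    ((a.2 : Phase).1 0 = 1 → (a.2 : Phase).2 = (b.2 : Phase).2)
  iseqv := ⟨fun _ => ⟨rfl, rfl, fun _ => rfl⟩,
    fun h => ⟨h.1.symm, h.2.1.symm, fun h0 => (h.2.2 (by rw [h.1]; exact h0)).symm⟩,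
    fun h h' => ⟨h.1.trans h'.1, h.2.1.trans h'.2.1,
      fun h0 => (h.2.2 h0).trans (h'.2.2 (by rw [← h.1]; exact h0))⟩⟩

/-- The level set regularized at both primaries: the two regularized level sets, glued along
`H⁻¹(c)`, with the quotient topology. -/
def doublyRegularized (μ c : ℝ) : PatchedSpace where
  carrier := Quotient (gluing μ c)
  index := Primary
  patch := sheet μ c
  incl := fun k z => Quotient.mk (gluing μ c) ⟨k, z⟩
  tangent := fun k => tangentLevel μ k c

/-- `X` (given by `X k` in the regularized coordinates at `k`) is a smooth vector field on the doubly
regularized level set which is a positive multiple of the Hamiltonian vector field of `Q` in the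
regularized coordinates at each of the primaries. As the Hamiltonian vector field of `Q` is
`g |q - a| X_H` away from collisions, the last condition says that the two local expressions are the
same multiple of `X_H`. -/
def IsRegularizedField (μ c : ℝ) (X : Primary → Phase → Phase) : Prop :=
  ∃ l : Primary → Phase → ℝ,
    (∀ k, ∀ z ∈ sheet μ c k, SmoothNear (l k) z ∧ 0 < l k z ∧
      X k z = l k z • hamVec (Q μ k c) z) ∧
    ∀ (z : sheet μ c .moon) (w : sheet μ c .earth), gluing μ c ⟨.moon, z⟩ ⟨.earth, w⟩ →
      l .moon z * (mass μ .moon * ‖position μ .moon z - pos μ .moon‖)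
        = l .earth w * (mass μ .earth * ‖position μ .earth w - pos μ .earth‖)

lemma contDiff_position (μ : ℝ) (k : Primary) : ContDiff ℝ ∞ (position μ k) := by
  have hc : ∀ i : Fin 4, ContDiff ℝ ∞ (fun x : E4 => x i) := fun i =>
    contDiff_euclidean.1 contDiff_id i
  have hv : ContDiff ℝ ∞ vec := by
    rw [contDiff_euclidean]
    intro i
    fin_cases i
    · exact hc 1
    · exact hc 2
    · exact hc 3
  have h1 : ContDiff ℝ ∞ (fun z : Phase => z.2 0 • vec z.1) :=
    ((hc 0).comp contDiff_snd).smul (hv.comp contDiff_fst)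
  have h2 : ContDiff ℝ ∞ (fun z : Phase => (1 - z.1 0) • vec z.2) :=
    (contDiff_const.sub ((hc 0).comp contDiff_fst)).smul (hv.comp contDiff_snd)
  exact contDiff_const.add (h1.add h2)

/-- Such a field exists: the one that is `|q - m| |q - e| X_H` away from collisions. -/
lemma exists_isRegularizedField {μ : ℝ} (h0 : 0 < μ) (h1 : μ < 1) (c : ℝ) :
    ∃ X, IsRegularizedField μ c X := by
  have hm : ∀ k, 0 < mass μ k := by rintro (_ | _) <;> simp [mass, h0, h1]
  refine ⟨fun k z => (‖position μ k z - pos μ k.other‖ / mass μ k) • hamVec (Q μ k c) z,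
    fun k z => ‖position μ k z - pos μ k.other‖ / mass μ k, ?_, ?_⟩
  · rintro k z ⟨⟨-, hz, -⟩, -⟩
    refine ⟨⟨{w | position μ k w ≠ pos μ k.other}, ?_, ?_⟩,
      div_pos (norm_pos_iff.2 (sub_ne_zero.2 hz)) (hm k), rfl⟩
    · exact (isOpen_ne_fun (contDiff_position μ k).continuous continuous_const).mem_nhds hz
    · refine ContDiffOn.div_const (ContDiffOn.norm ℝ
        ((contDiff_position μ k).sub contDiff_const).contDiffOn ?_) _
      exact fun w hw => sub_ne_zero.2 hw
  · rintro z w ⟨-, h, -⟩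
    have hp : position μ .moon z = position μ .earth w := h
    have := (hm .moon).ne'
    have := (hm .earth).ne'
    simp only [hp, Primary.other]
    field_simp

/-- The planar problem `ξ₃ = η₃ = 0` in a union `S` of components of a regularized level set. -/
def planar (F : PatchedSpace) (S : Set F.carrier) : Set F.carrier :=
  {x | x ∈ S ∧ ∃ (i : F.index) (z : F.patch i), F.incl i z = x ∧
    (z : Phase).1 3 = 0 ∧ (z : Phase).2 3 = 0}

end CR3BP

end

open CR3BP

open scoped ContDiff Topology

noncomputable section

namespace CR3BP

open Set Filter Topology

open Set Filter

/-! ### Ordinary differential equations and angles -/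

/-! Away from collisions the vertical motion is an oscillator: `q₃' = p₃` and `p₃' = -(g/|q-a|³ +
g'/|q-a'|³) q₃`. Hence `q₃ - i p₃` turns counterclockwise, and it vanishes exactly on the planar
problem. Its multiple `(1 - ξ₀) q₃ + i ξ₃` is smooth across collisions, but there its real part
vanishes to second order in `1 - ξ₀`, so both transversality along `B` and the rotation degenerate.
The function `bookMap` adds `ε (weight η₃ + shear ξ₃)`. Over a collision the linear equations for
`(η₃, ξ₃)` are `ξ₃' = η₃`, `η₃' = -κ (1/2 - c - g') ξ₃` with `κ = |η|²`, a rotation in the same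
direction because `c + g' < 1/2`. The factors `weight` and `shear` are arranged so that the
expressions at the two primaries agree (`bookMap_switch`).

The third components of `X_Q` are linear in `(η₃, ξ₃)` with continuous coefficients (`field_three`).
So the rotation of `bookMap` is a quadratic form `rotForm + ε twistForm` in `(η₃, ξ₃)`
(`im_bookMap`). The first summand is nonnegative and degenerates only over collisions, where the
second is positive (`twistForm_pos`). Over a compact part of the sheet a small `ε` therefore gives
`δ |Θ|² ≤ Im (conj Θ · Θ')` and `|Θ'| ≤ C |Θ|` (`exists_bookMap_estimates`).

These two estimates give the open book (`isCircleFamily_of_estimates`). By the linear bound a zero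
of `Θ` along an orbit propagates, so `B` is invariant. By the other one `arg Θ` grows at least at
rate `δ` off `B`, so every orbit there meets every ray in both time directions. No return time is
computed and no contact form enters.

Compactness comes from Hill's region. Below the first critical value a sphere around the primary,
through a critical point between the primaries (or of radius just below 1 if the other mass is
zero), is never crossed (`exists_sphere_barrier`). Between the first two critical values the same
holds for a Cartesian oval through the two outer collinear points (`exists_outer_barrier`,
`barrier_ne`). The fibre coordinate is bounded by `norm_snd_le`. Compactness also gives complete
flows, and since `c` is not a critical value, `X_Q` has no zeros on the sheet (`field_ne_zero`), so
components are open. -/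

/-- A curve with `‖h'‖ ≤ C ‖h‖` which vanishes once vanishes identically. -/
lemma eq_zero_of_norm_deriv_le {E : Type*} [NormedAddCommGroup E] [NormedSpace ℝ E]
    {h h' : ℝ → E} {C a b t₀ : ℝ} (hd : ∀ t ∈ Ioo a b, HasDerivAt h (h' t) t)
    (hC : ∀ t ∈ Ioo a b, ‖h' t‖ ≤ C * ‖h t‖) (ht₀ : t₀ ∈ Ioo a b) (h0 : h t₀ = 0) :
    ∀ t ∈ Ioo a b, h t = 0 := by
  intro t ht
  rcases le_total t₀ t with hle | hle
  · have hsub : Icc t₀ t ⊆ Ioo a b := fun s hs => ⟨ht₀.1.trans_le hs.1, hs.2.trans_lt ht.2⟩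
    exact eq_zero_of_abs_deriv_le_mul_abs_self_of_eq_zero_right (f' := h')
      (fun s hs => (hd s (hsub hs)).continuousAt.continuousWithinAt)
      (fun s hs => (hd s (hsub (Ico_subset_Icc_self hs))).hasDerivWithinAt) h0
      (fun s hs => hC s (hsub (Ico_subset_Icc_self hs))) t ⟨hle, le_rfl⟩
  · have hsub : ∀ s ∈ Icc (-t₀) (-t), -s ∈ Ioo a b := fun s hs =>
      ⟨by linarith [hs.2, ht.1], by linarith [hs.1, ht₀.2]⟩
    have hd' : ∀ s ∈ Icc (-t₀) (-t), HasDerivAt (fun s => h (-s)) (-h' (-s)) s := fun s hs => by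
      have := (hd (-s) (hsub s hs)).scomp s (hasDerivAt_neg s)
      simpa [Function.comp_def] using this
    have := eq_zero_of_abs_deriv_le_mul_abs_self_of_eq_zero_right (f := fun s => h (-s))
      (f' := fun s => -h' (-s)) (K := C)
      (fun s hs => (hd' s hs).continuousAt.continuousWithinAt)
      (fun s hs => (hd' s (Ico_subset_Icc_self hs)).hasDerivWithinAt) (by simpa using h0)
      (fun s hs => by simpa using hC (-s) (hsub s (Ico_subset_Icc_self hs))) (-t)
      ⟨by linarith, le_rfl⟩
    simpa using this

/-- A `C¹` vector field has a local flow which stays in a given neighbourhood. -/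
lemma exists_local_flow {E : Type*} [NormedAddCommGroup E] [NormedSpace ℝ E] [CompleteSpace E]
    {f : E → E} {x₀ : E} (hf : ContDiffAt ℝ 1 f x₀) {U : Set E} (hU : U ∈ 𝓝 x₀) :
    ∃ ε > (0 : ℝ), ∀ᶠ x in 𝓝 x₀, ∃ α : ℝ → E, α 0 = x ∧
      ∀ t ∈ Ioo (-ε) ε, α t ∈ U ∧ HasDerivAt α (f (α t)) t := by
  obtain ⟨ε, hε, a, r, L, K, hr, hpl⟩ := IsPicardLindelof.of_contDiffAt_one hf
  obtain ⟨α, hα, hc⟩ := (hpl 0).exists_forall_mem_closedBall_eq_hasDerivWithinAt_continuousOn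
  have hI : Icc (0 - ε) (0 + ε) ∈ 𝓝 (0 : ℝ) := Icc_mem_nhds (by linarith) (by linarith)
  have hB : Metric.closedBall x₀ (r : ℝ) ∈ 𝓝 x₀ := Metric.closedBall_mem_nhds x₀ (by exact_mod_cast hr)
  have hcont : ContinuousAt α (x₀, 0) := hc.continuousAt (prod_mem_nhds hB hI)
  have h0 : α (x₀, 0) = x₀ := (hα x₀ (Metric.mem_closedBall_self (by positivity))).1
  have hev : ∀ᶠ p in 𝓝 (x₀, (0 : ℝ)), α p ∈ U := hcont (by rw [h0]; exact hU)
  rw [nhds_prod_eq, eventually_prod_iff] at hev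
  obtain ⟨pa, hpa, pb, hpb, hab⟩ := hev
  obtain ⟨ε', hε', hball⟩ := Metric.eventually_nhds_iff_ball.1 hpb
  refine ⟨min ε ε', lt_min hε hε', ?_⟩
  filter_upwards [hpa, hB] with x hx hxB
  refine ⟨fun t => α (x, t), (hα x hxB).1, fun t ht => ⟨hab hx (hball t ?_), ?_⟩⟩
  · rw [Metric.mem_ball, Real.dist_eq, sub_zero, abs_lt]
    exact ⟨by linarith [ht.1, min_le_right ε ε'], by linarith [ht.2, min_le_right ε ε']⟩
  · have h1 : 0 - ε < t := by linarith [ht.1, min_le_left ε ε']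
    have h2 : t < 0 + ε := by linarith [ht.2, min_le_left ε ε']
    exact ((hα x hxB).2 t ⟨h1.le, h2.le⟩).hasDerivAt (Icc_mem_nhds h1 h2)

/-- A differentiable curve in `ℂ \ {0}` has a differentiable logarithm. -/
lemma exists_hasDerivAt_log {h h' : ℝ → ℂ} (hd : ∀ t, HasDerivAt h (h' t) t) (h0 : ∀ t, h t ≠ 0) :
    ∃ L : ℝ → ℂ, (∀ t, Complex.exp (L t) = h t) ∧ ∀ t, HasDerivAt L (h' t / h t) t := by
  have hsc : IsSimplyConnected (univ : Set ℝ) := by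
    have : ContractibleSpace (univ : Set ℝ) := convex_univ.contractibleSpace ⟨0, mem_univ 0⟩
    exact SimplyConnectedSpace.ofContractible _
  obtain ⟨L, hL, hexp⟩ := Complex.exists_continuousOn_eqOn_exp_comp hsc isOpen_univ
    (g := h) (fun t _ => (hd t).continuousAt.continuousWithinAt) (by rintro ⟨t, -, ht⟩; exact h0 t ht)
  rw [continuousOn_univ] at hL
  have hexp' : ∀ t, Complex.exp (L t) = h t := fun t => hexp (mem_univ t)
  refine ⟨L, hexp', fun t₀ => ?_⟩
  have hev : ∀ᶠ t in 𝓝 t₀, |(L t - L t₀).im| < Real.pi := by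
    have hc : ContinuousAt (fun t => |(L t - L t₀).im|) t₀ :=
      (Complex.continuous_im.comp (hL.sub continuous_const)).abs.continuousAt
    exact hc.eventually (gt_mem_nhds (by simp [Real.pi_pos]))
  -- As `h t / h t₀` is close to `1`, the principal branch is available and differs from the
  -- continuous logarithm by a constant.
  have heq : L =ᶠ[𝓝 t₀] fun t => L t₀ + Complex.log (h t / h t₀) := by
    filter_upwards [hev] with t ht
    rw [← hexp' t, ← hexp' t₀, ← Complex.exp_sub, Complex.log_exp (abs_lt.1 ht).1 (abs_lt.1 ht).2.le]
    ring
  have h1 : HasDerivAt (fun t => h t / h t₀) (h' t₀ / h t₀) t₀ := (hd t₀).div_const _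
  have h2 := (h1.clog_real (by simp [div_self (h0 t₀)])).const_add (L t₀)
  rw [div_self (h0 t₀), div_one] at h2
  exact h2.congr_of_eventuallyEq heq

/-- If the argument of a curve in `ℂ \ {0}` grows at a definite rate, the curve meets every ray. -/
lemma exists_mem_ray {h h' : ℝ → ℂ} {δ : ℝ} (hδ : 0 < δ) (hd : ∀ t, HasDerivAt h (h' t) t)
    (h0 : ∀ t, h t ≠ 0) (hδh : ∀ t, δ * ‖h t‖ ^ 2 ≤ (star (h t) * h' t).im) (θ : Circle) :
    (∃ τ, 0 < τ ∧ h τ = (‖h τ‖ : ℂ) * θ) ∧ ∃ τ, τ < 0 ∧ h τ = (‖h τ‖ : ℂ) * θ := by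
  obtain ⟨L, hexp, hL⟩ := exists_hasDerivAt_log hd h0
  have hA : ∀ t, HasDerivAt (fun t => (L t).im) (h' t / h t).im t := fun t =>
    (hasFDerivAt_iff_hasDerivAt.1
      ((Complex.imCLM.hasFDerivAt (x := L t)).comp t (hL t).hasFDerivAt)).congr_deriv (by simp)
  have hrate : ∀ t, δ ≤ (h' t / h t).im := fun t => by
    have hn : 0 < ‖h t‖ ^ 2 := by have := norm_pos_iff.2 (h0 t); positivity
    have e : (h' t / h t).im = (star (h t) * h' t).im / ‖h t‖ ^ 2 := by
      rw [Complex.div_im, ← Complex.normSq_eq_norm_sq]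
      simp only [Complex.star_def, Complex.mul_im, Complex.conj_re, Complex.conj_im]
      ring
    rw [e, le_div_iff₀ hn]
    exact hδh t
  have hcont : Continuous fun t => (L t).im :=
    continuous_iff_continuousAt.2 fun t => (hA t).continuousAt
  have hgrow : ∀ s t, s ≤ t → δ * (t - s) ≤ (L t).im - (L s).im := fun s t hst =>
    mul_sub_le_image_sub_of_le_deriv (fun t => (hA t).differentiableAt)
      (fun t => by rw [(hA t).deriv]; exact hrate t) hst
  obtain ⟨θ₀, rfl⟩ : ∃ θ₀ : ℝ, Circle.exp θ₀ = θ := ⟨_, Circle.exp_arg θ⟩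
  have key : ∀ (τ : ℝ) (n : ℤ), (L τ).im = θ₀ + n * (2 * Real.pi) →
      h τ = (‖h τ‖ : ℂ) * (Circle.exp θ₀ : ℂ) := by
    intro τ n hτ
    rw [Circle.coe_exp, ← hexp τ, Complex.norm_exp, Complex.ofReal_exp, ← Complex.exp_add,
      Complex.exp_eq_exp_iff_exists_int]
    refine ⟨n, ?_⟩
    apply Complex.ext <;> simp [hτ]
  constructor
  · obtain ⟨n, hn⟩ := exists_int_gt (((L 0).im - θ₀) / (2 * Real.pi))
    rw [div_lt_iff₀ (by positivity)] at hn
    -- By this time growth at the minimal rate `δ` has carried the argument to `θ₀ + 2πn`, and the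
    -- intermediate value theorem applies.
    set T := (θ₀ + n * (2 * Real.pi) - (L 0).im) / δ with hT
    have hTpos : 0 < T := div_pos (by linarith) hδ
    have h1 := hgrow 0 T hTpos.le
    have h2 : δ * (T - 0) = θ₀ + n * (2 * Real.pi) - (L 0).im := by rw [hT]; field_simp; ring
    obtain ⟨τ, hτ, hτ'⟩ := intermediate_value_Icc hTpos.le hcont.continuousOn
      (show θ₀ + n * (2 * Real.pi) ∈ Icc (L 0).im (L T).im from ⟨by linarith, by linarith⟩)
    refine ⟨τ, lt_of_le_of_ne hτ.1 ?_, key τ n hτ'⟩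
    rintro rfl
    simp only at hτ'
    linarith
  · obtain ⟨n, hn⟩ := exists_int_lt (((L 0).im - θ₀) / (2 * Real.pi))
    rw [lt_div_iff₀ (by positivity)] at hn
    set T := (θ₀ + n * (2 * Real.pi) - (L 0).im) / δ with hT
    have hTneg : T < 0 := div_neg_of_neg_of_pos (by linarith) hδ
    have h1 := hgrow T 0 hTneg.le
    have h2 : δ * (0 - T) = -(θ₀ + n * (2 * Real.pi) - (L 0).im) := by rw [hT]; field_simp; ring
    obtain ⟨τ, hτ, hτ'⟩ := intermediate_value_Icc hTneg.le hcont.continuousOn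
      (show θ₀ + n * (2 * Real.pi) ∈ Icc (L T).im (L 0).im from ⟨by linarith, by linarith⟩)
    refine ⟨τ, lt_of_le_of_ne hτ.2 ?_, key τ n hτ'⟩
    rintro rfl
    simp only at hτ'
    linarith

/-! ### Integral lines in patched spaces -/

/-- `γ` is, near `t`, a curve in one of the patches which solves the equation at `t`. -/
def IntegralAt (F : PatchedSpace) (X : F.index → Phase → Phase) (γ : ℝ → F.carrier) (t : ℝ) : Prop :=
  ∃ (i : F.index) (ζ : ℝ → F.patch i), (∀ᶠ s in 𝓝 t, γ s = F.incl i (ζ s)) ∧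
    HasDerivAt (fun s => (ζ s : Phase)) (X i (ζ t)) t

section Abstract

variable {F : PatchedSpace} {X : F.index → Phase → Phase} {S : Set F.carrier}

lemma IntegralAt.congr {γ γ' : ℝ → F.carrier} {t : ℝ} (h : IntegralAt F X γ t)
    (he : γ' =ᶠ[𝓝 t] γ) : IntegralAt F X γ' t := by
  obtain ⟨i, ζ, h1, h2⟩ := h
  exact ⟨i, ζ, by filter_upwards [h1, he] with s hs hs'; rw [hs', hs], h2⟩

lemma IntegralAt.shift {γ : ℝ → F.carrier} {t a : ℝ} (h : IntegralAt F X γ (t + a)) :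
    IntegralAt F X (fun s => γ (s + a)) t := by
  obtain ⟨i, ζ, h1, h2⟩ := h
  refine ⟨i, fun s => ζ (s + a), ?_, h2.comp_add_const t a⟩
  exact (continuous_add_const a).continuousAt.eventually h1

lemma IntegralAt.continuousAt (hcont : ∀ i, Continuous (F.incl i)) {γ : ℝ → F.carrier} {t : ℝ}
    (h : IntegralAt F X γ t) : ContinuousAt γ t := by
  obtain ⟨i, ζ, h1, h2⟩ := h
  have : ContinuousAt ζ t :=
    IsInducing.subtypeVal.continuousAt_iff.2 h2.continuousAt
  exact ((hcont i).continuousAt.comp this).congr (h1.mono fun _ => Eq.symm)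

/-- Integral curves stay in a connected component. -/
lemma IntegralAt.mem_connectedComponent (hcont : ∀ i, Continuous (F.incl i)) {x₀ : F.carrier}
    {γ : ℝ → F.carrier} {a b t₀ : ℝ} (h : ∀ t ∈ Ioo a b, IntegralAt F X γ t) (ht₀ : t₀ ∈ Ioo a b)
    (h₀ : γ t₀ ∈ connectedComponent x₀) : ∀ t ∈ Ioo a b, γ t ∈ connectedComponent x₀ := by
  intro t ht
  have hpre : IsPreconnected (γ '' Ioo a b) := isPreconnected_Ioo.image γ fun s hs =>
    ((h s hs).continuousAt hcont).continuousWithinAt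
  rw [connectedComponent_eq h₀]
  exact hpre.subset_connectedComponent (mem_image_of_mem γ ht₀) (mem_image_of_mem γ ht)

lemma IsIntegralLine.mem_connectedComponent (hcont : ∀ i, Continuous (F.incl i)) {x₀ : F.carrier}
    {γ : ℝ → F.carrier} (h : IsIntegralLine F X γ) {t₀ : ℝ} (h₀ : γ t₀ ∈ connectedComponent x₀)
    (t : ℝ) : γ t ∈ connectedComponent x₀ :=
  IntegralAt.mem_connectedComponent hcont (a := min t t₀ - 1) (b := max t t₀ + 1)
    (fun s _ => h s) ⟨by linarith [min_le_right t t₀], by linarith [le_max_right t t₀]⟩ h₀ t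
    ⟨by linarith [min_le_left t t₀], by linarith [le_max_left t t₀]⟩

/-- The vector field does not depend on the patch: curves which solve the equation at a point can be
transferred to any patch around it. -/
def ChartChange (F : PatchedSpace) (X : F.index → Phase → Phase) : Prop :=
  ∀ (i j : F.index) (w : F.patch j) (ζ : ℝ → F.patch i) (t : ℝ), F.incl i (ζ t) = F.incl j w →
    HasDerivAt (fun s => (ζ s : Phase)) (X i (ζ t)) t →
    ∃ ζ' : ℝ → F.patch j, (∀ᶠ s in 𝓝 t, F.incl i (ζ s) = F.incl j (ζ' s)) ∧
      HasDerivAt (fun s => (ζ' s : Phase)) (X j w) t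

/-- The two halves may live in different patches. `hchange` moves the second into the patch of the
first, where the left and right derivatives at `t` are values of the same vector field at the same
point. -/
lemma IntegralAt.join (hinj : ∀ i, Function.Injective (F.incl i)) (hchange : ChartChange F X)
    {γ₁ γ₂ : ℝ → F.carrier} {t : ℝ} (h₁ : IntegralAt F X γ₁ t) (h₂ : IntegralAt F X γ₂ t)
    (h : γ₁ t = γ₂ t) : IntegralAt F X (fun s => if s < t then γ₁ s else γ₂ s) t := by
  obtain ⟨i, ζ₁, e₁, d₁⟩ := h₁
  obtain ⟨j, ζ₂, e₂, d₂⟩ := h₂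
  have h12 : F.incl j (ζ₂ t) = F.incl i (ζ₁ t) := by rw [← e₁.self_of_nhds, ← e₂.self_of_nhds, h]
  obtain ⟨ζ, e, d⟩ := hchange j i (ζ₁ t) ζ₂ t h12 d₂
  have hz : ζ t = ζ₁ t := hinj i (by rw [← e.self_of_nhds, h12])
  refine ⟨i, fun s => if s < t then ζ₁ s else ζ s, ?_, ?_⟩
  · filter_upwards [e₁, e₂, e] with s h1 h2 h3
    by_cases hs : s < t
    · simp [hs, h1]
    · simp [hs, h2, h3]
  · have hval : (if t < t then ζ₁ t else ζ t) = ζ₁ t := by simp [hz]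
    simp only [hval]
    rw [← hasDerivWithinAt_univ, ← Iic_union_Ici (a := t)]
    refine HasDerivWithinAt.union ?_ ?_
    · refine d₁.hasDerivWithinAt.congr (fun s hs => ?_) (by rw [hval])
      rcases lt_or_eq_of_le (mem_Iic.1 hs) with hlt | rfl
      · simp [hlt]
      · simp [hz]
    · refine d.hasDerivWithinAt.congr (fun s hs => ?_) (by simp)
      simp [not_lt.2 (mem_Ici.1 hs)]

/-- If every point of `S` has an integral curve on a time interval of fixed length, all integral
curves in `S` are defined for all times. -/
lemma exists_isIntegralLine (hinj : ∀ i, Function.Injective (F.incl i)) (hchange : ChartChange F X)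
    {ε : ℝ} (hε : 0 < ε)
    (hloc : ∀ x ∈ S, ∃ γ : ℝ → F.carrier, γ 0 = x ∧ ∀ t ∈ Ioo (-ε) ε, IntegralAt F X γ t ∧ γ t ∈ S) :
    ∀ x ∈ S, ∃ γ, IsIntegralLine F X γ ∧ γ 0 = x ∧ ∀ t, γ t ∈ S := by
  intro x hx
  choose c hc0 hc using fun p : S => hloc p p.2
  -- Steps of half the existence time keep each closed step inside the open interval on which its
  -- curve solves the equation.
  set τ := ε / 2 with hτdef
  have hτ : 0 < τ := by positivity
  have hτ1 : τ ∈ Ioo (-ε) ε := ⟨by linarith, by linarith⟩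
  have hτ2 : -τ ∈ Ioo (-ε) ε := ⟨by linarith, by linarith⟩
  let up : S → S := fun p => ⟨c p τ, (hc p τ hτ1).2⟩
  let dn : S → S := fun p => ⟨c p (-τ), (hc p (-τ) hτ2).2⟩
  let xs : ℕ → S := fun n => up^[n] ⟨x, hx⟩
  let ys : ℕ → S := fun n => dn^[n] ⟨x, hx⟩
  have hxs : ∀ n, (xs (n + 1) : F.carrier) = c (xs n) τ := fun n => by
    simp only [xs, Function.iterate_succ_apply']; rfl
  have hys : ∀ n, (ys (n + 1) : F.carrier) = c (ys n) (-τ) := fun n => by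
    simp only [ys, Function.iterate_succ_apply']; rfl
  -- Piece `n` is used on `[nτ, (n+1)τ]`. For `n ≥ 0` it starts at the left end, at `xs n`. For `n =
  -- -(m+1)` it is run backwards from the right end `-mτ`, where it is at `ys m`.
  let d : ℤ → ℝ → F.carrier := fun n t => match n with
    | Int.ofNat n => c (xs n) (t + -(n * τ))
    | Int.negSucc m => c (ys m) (t + m * τ)
  have hd : ∀ (n : ℤ), ∀ t ∈ Icc (n * τ) ((n + 1) * τ), IntegralAt F X (d n) t ∧ d n t ∈ S := by
    rintro (n | m) t ht
    · have hmem : t + -(n * τ) ∈ Ioo (-ε) ε := by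
        simp only [Int.ofNat_eq_natCast, Int.cast_natCast] at ht
        exact ⟨by linarith [ht.1], by linarith [ht.2]⟩
      exact ⟨IntegralAt.shift (hc _ _ hmem).1, (hc _ _ hmem).2⟩
    · have hmem : t + m * τ ∈ Ioo (-ε) ε := by
        simp only [Int.cast_negSucc, Nat.cast_add, Nat.cast_one] at ht
        exact ⟨by linarith [ht.1], by linarith [ht.2]⟩
      exact ⟨IntegralAt.shift (hc _ _ hmem).1, (hc _ _ hmem).2⟩
  have hjoin : ∀ n : ℤ, d n ((n + 1) * τ) = d (n + 1) ((n + 1) * τ) := by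
    rintro (n | m)
    · have e : (Int.ofNat n : ℤ) + 1 = Int.ofNat (n + 1) := rfl
      rw [e]
      simp only [d, Int.ofNat_eq_natCast, Int.cast_natCast]
      have e1 : ((n : ℝ) + 1) * τ + -(n * τ) = τ := by ring
      have e2 : ((n : ℝ) + 1) * τ + -(((n + 1 : ℕ) : ℝ) * τ) = 0 := by push_cast; ring
      rw [e1, e2, hc0, hxs]
    · rcases m with _ | m
      · have e : (Int.negSucc 0 : ℤ) + 1 = Int.ofNat 0 := rfl
        simp only [d, e]
        simp [hc0, xs, ys]
      · have e : (Int.negSucc (m + 1) : ℤ) + 1 = Int.negSucc m := rfl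
        simp only [d, e, Int.cast_negSucc]
        have e1 : (-(((m + 1 + 1 : ℕ)) : ℝ) + 1) * τ + ((m + 1 : ℕ) : ℝ) * τ = 0 := by
          push_cast; ring
        have e2 : (-(((m + 1 + 1 : ℕ)) : ℝ) + 1) * τ + (m : ℝ) * τ = -τ := by push_cast; ring
        rw [e1, e2, hc0, hys]
  have hfl : ∀ (t : ℝ) (n : ℤ), t ∈ Ico (n * τ) ((n + 1) * τ) → ⌊t / τ⌋ = n := fun t n ht => by
    rw [Int.floor_eq_iff, le_div_iff₀ hτ, div_lt_iff₀ hτ]; exact ht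
  have hfl' : ∀ t : ℝ, t ∈ Ico (⌊t / τ⌋ * τ) ((⌊t / τ⌋ + 1) * τ) := fun t =>
    ⟨(le_div_iff₀ hτ).1 (Int.floor_le _), (div_lt_iff₀ hτ).1 (Int.lt_floor_add_one _)⟩
  refine ⟨fun t => d ⌊t / τ⌋ t, fun t => ?_, ?_, fun t => ?_⟩
  · change IntegralAt F X _ t
    obtain ⟨h1, h2⟩ := hfl' t
    set n := ⌊t / τ⌋ with hn
    rcases lt_or_eq_of_le h1 with h1 | h1
    · refine (hd n t ⟨h1.le, h2.le⟩).1.congr ?_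
      filter_upwards [Ioo_mem_nhds h1 h2] with s hs
      rw [hfl s n ⟨hs.1.le, hs.2⟩]
    -- At a grid point the pieces `m` and `m + 1` meet; inside a step only one piece is seen.
    · obtain ⟨m, hm⟩ : ∃ m : ℤ, n = m + 1 := ⟨n - 1, by ring⟩
      have hnm : (n : ℝ) = m + 1 := by rw [hm]; push_cast; ring
      have ht : t = (m + 1) * τ := by rw [← h1, hnm]
      have hj := hjoin m
      rw [← hm, ← ht] at hj
      refine (IntegralAt.join hinj hchange (hd m t ⟨by rw [ht]; nlinarith, ht.le⟩).1
        (hd n t ⟨h1.le, h2.le⟩).1 hj).congr ?_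
      have hlt : m * τ < t := by rw [ht]; nlinarith
      filter_upwards [Ioo_mem_nhds hlt h2] with s hs
      by_cases hst : s < t
      · rw [if_pos hst, hfl s m ⟨hs.1.le, by rw [← ht]; exact hst⟩]
      · rw [if_neg hst, hfl s n ⟨by rw [h1]; exact not_lt.1 hst, hs.2⟩]
  · simp only [zero_div, Int.floor_zero]
    change c (xs 0) _ = x
    simp [xs, hc0]
  · have h := hfl' t
    exact (hd _ t ⟨h.1, h.2.le⟩).2

/-- Uniform times of existence, from compact cores of the patches. -/
lemma exists_isIntegralLine_of_cores (hcont : ∀ i, Continuous (F.incl i))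
    (hinj : ∀ i, Function.Injective (F.incl i)) (hchange : ChartChange F X) [Finite F.index]
    {x₀ : F.carrier} (K : (i : F.index) → Set (F.patch i)) (hK : ∀ i, IsCompact (K i))
    (hcover : connectedComponent x₀ ⊆ ⋃ i, F.incl i '' K i)
    (hloc : ∀ i, ∀ z : F.patch i, ∃ ε > (0 : ℝ), ∀ᶠ w in 𝓝 z, ∃ ζ : ℝ → F.patch i, ζ 0 = w ∧
      ∀ t ∈ Ioo (-ε) ε, HasDerivAt (fun s => (ζ s : Phase)) (X i (ζ t)) t) :
    ∀ x ∈ connectedComponent x₀, ∃ γ, IsIntegralLine F X γ ∧ γ 0 = x ∧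
      ∀ t, γ t ∈ connectedComponent x₀ := by
  have hunif : ∀ i, ∃ ε > (0 : ℝ), ∀ w ∈ K i, ∃ ζ : ℝ → F.patch i, ζ 0 = w ∧
      ∀ t ∈ Ioo (-ε) ε, HasDerivAt (fun s => (ζ s : Phase)) (X i (ζ t)) t := by
    intro i
    -- Compactness turns the locally uniform existence time into one valid on the whole core.
    refine (hK i).induction_on (p := fun A => ∃ ε > (0 : ℝ), ∀ w ∈ A, ∃ ζ : ℝ → F.patch i, ζ 0 = w ∧
      ∀ t ∈ Ioo (-ε) ε, HasDerivAt (fun s => (ζ s : Phase)) (X i (ζ t)) t) ?_ ?_ ?_ ?_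
    · exact ⟨1, one_pos, by simp⟩
    · rintro s t hst ⟨ε, hε, h⟩
      exact ⟨ε, hε, fun w hw => h w (hst hw)⟩
    · rintro s t ⟨ε, hε, h⟩ ⟨ε', hε', h'⟩
      refine ⟨min ε ε', lt_min hε hε', ?_⟩
      rintro w (hw | hw)
      · obtain ⟨ζ, h0, h1⟩ := h w hw
        exact ⟨ζ, h0, fun u hu => h1 u ⟨by linarith [hu.1, min_le_left ε ε'],
          by linarith [hu.2, min_le_left ε ε']⟩⟩
      · obtain ⟨ζ, h0, h1⟩ := h' w hw
        exact ⟨ζ, h0, fun u hu => h1 u ⟨by linarith [hu.1, min_le_right ε ε'],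
          by linarith [hu.2, min_le_right ε ε']⟩⟩
    · intro z _
      obtain ⟨ε, hε, h⟩ := hloc i z
      exact ⟨_, mem_nhdsWithin_of_mem_nhds h, ε, hε, fun w hw => hw⟩
  choose ε hε hflow using hunif
  obtain ⟨ε₀, hε₀, hle⟩ : ∃ ε₀ > (0 : ℝ), ∀ i, ε₀ ≤ ε i := by
    have := Fintype.ofFinite F.index
    rcases isEmpty_or_nonempty F.index with hemp | hne
    · exact ⟨1, one_pos, fun i => hemp.elim i⟩
    · obtain ⟨i, -, hi⟩ := Finset.exists_min_image Finset.univ ε Finset.univ_nonempty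
      exact ⟨ε i, hε i, fun j => hi j (Finset.mem_univ j)⟩
  refine exists_isIntegralLine hinj hchange hε₀ fun x hx => ?_
  obtain ⟨i, z, hz, rfl⟩ := mem_iUnion.1 (hcover hx)
  obtain ⟨ζ, h0, h1⟩ := hflow i z hz
  have hint : ∀ t ∈ Ioo (-ε₀) ε₀, IntegralAt F X (fun s => F.incl i (ζ s)) t := fun t ht =>
    ⟨i, ζ, Eventually.of_forall fun _ => rfl, h1 t ⟨by linarith [ht.1, hle i], by linarith [ht.2, hle i]⟩⟩
  refine ⟨fun t => F.incl i (ζ t), by simp [h0], fun t ht => ⟨hint t ht, ?_⟩⟩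
  exact IntegralAt.mem_connectedComponent hcont hint (t₀ := 0) ⟨by linarith, hε₀⟩
    (by simpa [h0] using hx) t ht

/-- A function whose argument grows along the flow at a definite rate defines a circle family of
global hypersurfaces of section. -/
theorem isCircleFamily_of_estimates (hcont : ∀ i, Continuous (F.incl i)) {x₀ : F.carrier}
    {B : Set F.carrier} {Θ : F.carrier → ℂ} {Ψ : F.index → Phase → ℂ}
    (hS : S = connectedComponent x₀) (hΘ : Continuous Θ)
    (hΨ : ∀ i (z : F.patch i), Θ (F.incl i z) = Ψ i z) (hsm : ∀ i, ContDiff ℝ ∞ (Ψ i))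
    (hcomp : IsCompact S)
    (hopen : ∀ i (z : F.patch i), F.incl i z ∈ S → ∀ᶠ w in 𝓝 z, F.incl i w ∈ S)
    (hzero : ∀ x ∈ S, Θ x = 0 ↔ x ∈ B) (hBS : B ⊆ S)
    (hsurj : ∀ i (z : F.patch i), F.incl i z ∈ S → Ψ i z = 0 → ∀ a : ℂ, ∃ w ∈ F.tangent i z,
      fderiv ℝ (Ψ i) z w = a)
    {C δ : ℝ} (hδ : 0 < δ)
    (hC : ∀ i (z : F.patch i), F.incl i z ∈ S → ‖fderiv ℝ (Ψ i) z (X i z)‖ ≤ C * ‖Ψ i z‖)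
    (hpos : ∀ i (z : F.patch i), F.incl i z ∈ S →
      δ * ‖Ψ i z‖ ^ 2 ≤ (star (Ψ i z) * fderiv ℝ (Ψ i) z (X i z)).im)
    (hne : ∀ i (z : F.patch i), F.incl i z ∈ S → X i z ≠ 0)
    (hcomplete : ∀ x ∈ S, ∃ γ, IsIntegralLine F X γ ∧ γ 0 = x ∧ ∀ t, γ t ∈ S) :
    IsCircleFamily F X S B Θ := by
  have hsn : ∀ i z, SmoothNear (Ψ i) z := fun i z => ⟨univ, univ_mem, (hsm i).contDiffOn⟩
  have hder : ∀ γ, IsIntegralLine F X γ → γ 0 ∈ S → ∃ h' : ℝ → ℂ, ∀ t,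
      HasDerivAt (fun s => Θ (γ s)) (h' t) t ∧ ‖h' t‖ ≤ C * ‖Θ (γ t)‖ ∧
        δ * ‖Θ (γ t)‖ ^ 2 ≤ (star (Θ (γ t)) * h' t).im := by
    intro γ hγ h0
    have hS' : ∀ t, γ t ∈ S := by rw [hS] at h0 ⊢; exact hγ.mem_connectedComponent hcont h0
    have : ∀ t, ∃ h' : ℂ, HasDerivAt (fun s => Θ (γ s)) h' t ∧ ‖h'‖ ≤ C * ‖Θ (γ t)‖ ∧
        δ * ‖Θ (γ t)‖ ^ 2 ≤ (star (Θ (γ t)) * h').im := by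
      intro t
      obtain ⟨i, ζ, he, hd⟩ := hγ t
      have hmem : F.incl i (ζ t) ∈ S := by rw [← he.self_of_nhds]; exact hS' t
      refine ⟨fderiv ℝ (Ψ i) (ζ t) (X i (ζ t)), ?_, ?_, ?_⟩
      · have h1 : HasFDerivAt (Ψ i) (fderiv ℝ (Ψ i) (ζ t)) (ζ t : Phase) :=
          ((hsm i).differentiable (by simp) _).hasFDerivAt
        refine (h1.comp_hasDerivAt t hd).congr_of_eventuallyEq ?_
        filter_upwards [he] with s hs
        rw [hs, hΨ]; rfl
      · rw [he.self_of_nhds, hΨ]; exact hC i _ hmem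
      · rw [he.self_of_nhds, hΨ]; exact hpos i _ hmem
    choose h' hh' using this
    exact ⟨h', hh'⟩
  -- By Grönwall, an orbit on which `Θ` vanishes once stays in the zero set, in both time
  -- directions.
  have hstay : ∀ γ, IsIntegralLine F X γ → γ 0 ∈ S → ∀ t₀, Θ (γ t₀) = 0 → ∀ t, Θ (γ t) = 0 := by
    intro γ hγ h0 t₀ ht₀ t
    obtain ⟨h', hh'⟩ := hder γ hγ h0
    exact eq_zero_of_norm_deriv_le (a := min t t₀ - 1) (b := max t t₀ + 1) (t₀ := t₀)
      (fun s _ => (hh' s).1) (fun s _ => (hh' s).2.1)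
      ⟨by linarith [min_le_right t t₀], by linarith [le_max_right t t₀]⟩ ht₀ t
      ⟨by linarith [min_le_left t t₀], by linarith [le_max_left t t₀]⟩
  have hray : ∀ (θ : Circle) (w : ℂ), w = (‖w‖ : ℂ) * θ ↔
      (star (θ : ℂ) * w).im = 0 ∧ 0 ≤ (star (θ : ℂ) * w).re := by
    intro θ w
    have hθ : star (θ : ℂ) * θ = 1 := by
      rw [Complex.star_def, ← Complex.normSq_eq_conj_mul_self]; simp
    constructor
    · intro h
      have : star (θ : ℂ) * w = (‖w‖ : ℂ) := by
        rw [h]; simp only [norm_mul, Complex.norm_real, norm_norm, Circle.norm_coe, mul_one]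
        linear_combination (‖w‖ : ℂ) * hθ
      rw [this]
      simp
    · rintro ⟨h1, h2⟩
      have e1 : star (θ : ℂ) * w = ((star (θ : ℂ) * w).re : ℂ) := by
        apply Complex.ext
        · simp
        · rw [h1, Complex.ofReal_im]
      have e2 : ‖w‖ = (star (θ : ℂ) * w).re := by
        have := congrArg norm e1
        rw [norm_mul, norm_star, Circle.norm_coe, one_mul, Complex.norm_real, Real.norm_eq_abs,
          abs_of_nonneg h2] at this
        exact this
      have e3 : (θ : ℂ) * (star (θ : ℂ) * w) = w := by
        linear_combination w * hθ
      rw [e2, ← e1, mul_comm, e3]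
  have hpage : ∀ (θ : Circle) i (z : F.patch i), F.incl i z ∈ S → (F.incl i z ∈ page S Θ θ ↔
      (star (θ : ℂ) * Ψ i z).im = 0 ∧ 0 ≤ (star (θ : ℂ) * Ψ i z).re) := by
    intro θ i z hz
    rw [← hray, ← hΨ]
    exact ⟨fun h => h.2, fun h => ⟨hz, h⟩⟩
  have hclm : ∀ (θ : Circle) (L : ℂ →L[ℝ] ℝ) i z v,
      fderiv ℝ (fun w => L (star (θ : ℂ) * Ψ i w)) z v = L (star (θ : ℂ) * fderiv ℝ (Ψ i) z v) := by
    intro θ L i z v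
    have h1 : HasFDerivAt (Ψ i) (fderiv ℝ (Ψ i) z) z :=
      ((hsm i).differentiable (by simp) _).hasFDerivAt
    have h2 := L.hasFDerivAt.comp z (h1.const_mul (star (θ : ℂ)))
    have h3 : HasFDerivAt (fun w => L (star (θ : ℂ) * Ψ i w)) _ z := h2
    rw [h3.fderiv]
    simp
  have hLsm : ∀ (θ : Circle) (L : ℂ →L[ℝ] ℝ) i z,
      SmoothNear (fun w => L (star (θ : ℂ) * Ψ i w)) z := fun θ L i z =>
    ⟨univ, univ_mem, (L.contDiff.comp (contDiff_const.mul (hsm i))).contDiffOn⟩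
  refine ⟨hzero, fun i z hz => ⟨Ψ i, hsn i z, Eventually.of_forall (hΨ i), hsurj i z hz, fun h => ?_⟩,
    fun θ => ?_⟩
  · refine lt_of_lt_of_le ?_ (hpos i z hz)
    have := norm_pos_iff.2 h
    positivity
  have hθ0 : (θ : ℂ) ≠ 0 := Circle.coe_ne_zero θ
  refine ⟨hne, hcomplete, fun x hx => hx.1, fun x hx => ⟨hBS hx, ?_⟩, ?_, ?_, ?_, ?_, ?_⟩
  · rw [(hzero x (hBS hx)).2 hx]; simp
  · have hcl : IsClosed {x : F.carrier | Θ x = (‖Θ x‖ : ℂ) * (θ : ℂ)} :=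
      isClosed_eq hΘ ((Complex.continuous_ofReal.comp hΘ.norm).mul continuous_const)
    exact hcomp.inter_right hcl
  · intro i z hz
    have hzS := hBS hz
    have hz0 : Ψ i z = 0 := by rw [← hΨ]; exact (hzero _ hzS).2 hz
    -- Rotating by `θ̄` turns the page into `{Im = 0, Re ≥ 0}` and the binding into `{Im = Re = 0}`.
    refine ⟨fun w => Complex.imCLM (star (θ : ℂ) * Ψ i w),
      fun w => Complex.reCLM (star (θ : ℂ) * Ψ i w), hLsm θ _ i z, hLsm θ _ i z, fun a b => ?_, ?_⟩
    · obtain ⟨w, hw, hw'⟩ := hsurj i z hzS hz0 ((θ : ℂ) * (b + a * Complex.I))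
      refine ⟨w, hw, ?_, ?_⟩
      all_goals
        rw [hclm, hw', ← mul_assoc, Complex.star_def, ← Complex.normSq_eq_conj_mul_self]
        simp
    · filter_upwards [hopen i z hzS] with w hw
      refine ⟨hpage θ i w hw, ?_⟩
      rw [← hzero _ hw, hΨ]
      have h1 : Ψ i w = 0 ↔ star (θ : ℂ) * Ψ i w = 0 := by simp [hθ0]
      rw [h1, Complex.ext_iff, and_comm]
      rfl
  · intro i z ⟨hz, hzB⟩
    have hzS := hz.1
    have hz0 : Ψ i z ≠ 0 := by rw [← hΨ]; exact fun h => hzB ((hzero _ hzS).1 h)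
    obtain ⟨him, hre⟩ := (hpage θ i z hzS).1 hz
    have hwne : star (θ : ℂ) * Ψ i z ≠ 0 := by simp [hθ0, hz0]
    have hrepos : 0 < (star (θ : ℂ) * Ψ i z).re :=
      lt_of_le_of_ne hre fun h => hwne (Complex.ext h.symm him)
    refine ⟨fun w => Complex.imCLM (star (θ : ℂ) * Ψ i w), hLsm θ _ i z, ?_, ?_⟩
    · rw [hclm]
      have h1 := hpos i z hzS
      have h2 : 0 < δ * ‖Ψ i z‖ ^ 2 := by have := norm_pos_iff.2 hz0; positivity
      have h3 : Ψ i z = (‖Ψ i z‖ : ℂ) * θ := (hray θ _).2 ⟨him, hre⟩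
      have h4 : star (Ψ i z) * fderiv ℝ (Ψ i) z (X i z)
          = (‖Ψ i z‖ : ℂ) * (star (θ : ℂ) * fderiv ℝ (Ψ i) z (X i z)) := by
        conv_lhs => rw [h3]
        simp only [star_mul', Complex.star_def, Complex.conj_ofReal]
        ring
      rw [h4, Complex.im_ofReal_mul] at h1
      exact pos_of_mul_pos_right (lt_of_lt_of_le h2 h1) (norm_nonneg _)
    -- Near an interior point of the page the real part stays positive, so the inequality in the
    -- description of the page can be dropped.
    · have hc : ContinuousAt (fun w : F.patch i => (star (θ : ℂ) * Ψ i w).re) z :=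
        (Complex.continuous_re.comp (continuous_const.mul
          ((hsm i).continuous.comp continuous_subtype_val))).continuousAt
      filter_upwards [hopen i z hzS, hc.eventually (lt_mem_nhds hrepos)] with w hw hw'
      rw [hpage θ i w hw]
      exact ⟨fun h => h.1, fun h => ⟨h, hw'.le⟩⟩
  · intro γ hγ h0 t
    have h0S := hBS h0
    have htS : γ t ∈ S := by rw [hS] at h0S ⊢; exact hγ.mem_connectedComponent hcont h0S t
    rw [← hzero _ htS]
    exact hstay γ hγ h0S 0 ((hzero _ h0S).2 h0) t
  · intro γ hγ ⟨h0S, h0B⟩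
    have htS : ∀ t, γ t ∈ S := by rw [hS] at h0S ⊢; exact hγ.mem_connectedComponent hcont h0S
    have hnz : ∀ t, Θ (γ t) ≠ 0 := fun t ht =>
      h0B ((hzero _ h0S).1 (hstay γ hγ h0S t ht 0))
    obtain ⟨h', hh'⟩ := hder γ hγ h0S
    obtain ⟨⟨τ, hτ, hτ'⟩, σ, hσ, hσ'⟩ := exists_mem_ray hδ (fun t => (hh' t).1) hnz
      (fun t => (hh' t).2.2) θ
    exact ⟨⟨τ, hτ, ⟨htS τ, hτ'⟩, fun h => hnz τ ((hzero _ (htS τ)).2 h)⟩,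
      σ, hσ, ⟨htS σ, hσ'⟩, fun h => hnz σ ((hzero _ (htS σ)).2 h)⟩

end Abstract

/-! ### The Hamiltonian vector field of `Q` in coordinates -/

lemma inner_E4 (x y : E4) : inner ℝ x y = x 0 * y 0 + x 1 * y 1 + x 2 * y 2 + x 3 * y 3 := by
  rw [PiLp.inner_apply, Fin.sum_univ_four]
  simp only [RCLike.inner_apply, conj_trivial]
  ring

lemma inner_E3 (x y : E3) : inner ℝ x y = x 0 * y 0 + x 1 * y 1 + x 2 * y 2 := by
  rw [PiLp.inner_apply, Fin.sum_univ_three]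
  simp only [RCLike.inner_apply, conj_trivial]
  ring

lemma normSq_E4 (x : E4) : ‖x‖ ^ 2 = x 0 ^ 2 + x 1 ^ 2 + x 2 ^ 2 + x 3 ^ 2 := by
  rw [EuclideanSpace.real_norm_sq_eq, Fin.sum_univ_four]

lemma normSq_E3 (x : E3) : ‖x‖ ^ 2 = x 0 ^ 2 + x 1 ^ 2 + x 2 ^ 2 := by
  rw [EuclideanSpace.real_norm_sq_eq, Fin.sum_univ_three]

/-- The functional `v ↦ ⟨A, v.1⟩ + ⟨B, v.2⟩`. -/
def pairing (A B : E4) : Phase →L[ℝ] ℝ :=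
  (innerSL ℝ A).comp (ContinuousLinearMap.fst ℝ E4 E4) +
    (innerSL ℝ B).comp (ContinuousLinearMap.snd ℝ E4 E4)

@[simp] lemma pairing_apply (A B : E4) (v : Phase) :
    pairing A B v = inner ℝ A v.1 + inner ℝ B v.2 := rfl

lemma hamVec_eq {G : Phase → ℝ} {z : Phase} {A B : E4} (h : HasFDerivAt G (pairing A B) z) :
    hamVec G z = (B - inner ℝ B z.1 • z.1,
      -A + inner ℝ B z.1 • z.2 + (inner ℝ A z.1 - inner ℝ B z.2) • z.1) := by
  have h' : HasFDerivAt G (pairing A B) (z.1, z.2) := h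
  have e1 : gradient (fun x : E4 => G (x, z.2)) z.1 = A := by
    refine HasGradientAt.gradient ?_
    rw [hasGradientAt_iff_hasFDerivAt]
    refine (h'.comp z.1 (hasFDerivAt_prodMk_left z.1 z.2)).congr_fderiv ?_
    ext v; simp
  have e2 : gradient (fun y : E4 => G (z.1, y)) z.2 = B := by
    refine HasGradientAt.gradient ?_
    rw [hasGradientAt_iff_hasFDerivAt]
    refine (h'.comp z.2 (hasFDerivAt_prodMk_right z.1 z.2)).congr_fderiv ?_
    ext v; simp
  simp only [hamVec, e1, e2]

/-- `vec` as a continuous linear map. -/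
def vecL : E4 →L[ℝ] E3 :=
  LinearMap.toContinuousLinearMap
    { toFun := vec
      map_add' := fun x y => by ext i; fin_cases i <;> simp [vec]
      map_smul' := fun a x => by ext i; fin_cases i <;> simp [vec] }

@[simp] lemma vecL_apply (x : E4) : vecL x = vec x := rfl

/-- The derivative of `relPos`. -/
def relPosDeriv (z v : Phase) : E3 :=
  v.2 0 • vec z.1 + z.2 0 • vec v.1 - v.1 0 • vec z.2 + (1 - z.1 0) • vec v.2

lemma hasFDerivAt_coord₁ (i : Fin 4) (z : Phase) : HasFDerivAt (fun w : Phase => w.1 i)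
    ((EuclideanSpace.proj i).comp (ContinuousLinearMap.fst ℝ E4 E4)) z :=
  ((EuclideanSpace.proj i : E4 →L[ℝ] ℝ).comp (ContinuousLinearMap.fst ℝ E4 E4)).hasFDerivAt

lemma hasFDerivAt_coord₂ (i : Fin 4) (z : Phase) : HasFDerivAt (fun w : Phase => w.2 i)
    ((EuclideanSpace.proj i).comp (ContinuousLinearMap.snd ℝ E4 E4)) z :=
  ((EuclideanSpace.proj i : E4 →L[ℝ] ℝ).comp (ContinuousLinearMap.snd ℝ E4 E4)).hasFDerivAt

lemma exists_hasFDerivAt_relPos (z : Phase) :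
    ∃ L : Phase →L[ℝ] E3, HasFDerivAt relPos L z ∧ ∀ v, L v = relPosDeriv z v := by
  have h1 : HasFDerivAt (fun w : Phase => vec w.1)
      (vecL.comp (ContinuousLinearMap.fst ℝ E4 E4)) z :=
    (vecL.comp (ContinuousLinearMap.fst ℝ E4 E4)).hasFDerivAt
  have h2 : HasFDerivAt (fun w : Phase => vec w.2)
      (vecL.comp (ContinuousLinearMap.snd ℝ E4 E4)) z :=
    (vecL.comp (ContinuousLinearMap.snd ℝ E4 E4)).hasFDerivAt
  refine ⟨_, ((hasFDerivAt_coord₂ 0 z).smul h1).add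
    (((hasFDerivAt_coord₁ 0 z).const_sub 1).smul h2), fun v => ?_⟩
  simp [relPosDeriv]
  abel

/-- The position relative to the other primary. -/
def offset (μ : ℝ) (k : Primary) (z : Phase) : E3 := position μ k z - pos μ k.other

lemma offset_ne_zero {μ : ℝ} {k : Primary} {z : Phase} :
    offset μ k z ≠ 0 ↔ position μ k z ≠ pos μ k.other := sub_ne_zero

@[simp] lemma relPos_zero (z : Phase) : relPos z 0 = z.2 0 * z.1 1 + (1 - z.1 0) * z.2 1 := by
  simp [relPos, vec]
@[simp] lemma relPos_one (z : Phase) : relPos z 1 = z.2 0 * z.1 2 + (1 - z.1 0) * z.2 2 := by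
  simp [relPos, vec]
@[simp] lemma relPos_two (z : Phase) : relPos z 2 = z.2 0 * z.1 3 + (1 - z.1 0) * z.2 3 := by
  simp [relPos, vec]
@[simp] lemma position_zero (μ : ℝ) (k : Primary) (z : Phase) :
    position μ k z 0 = coord μ k + relPos z 0 := by simp [position, pos]
@[simp] lemma position_one (μ : ℝ) (k : Primary) (z : Phase) :
    position μ k z 1 = relPos z 1 := by simp [position, pos]
@[simp] lemma position_two (μ : ℝ) (k : Primary) (z : Phase) :
    position μ k z 2 = relPos z 2 := by simp [position, pos]
@[simp] lemma offset_zero (μ : ℝ) (k : Primary) (z : Phase) :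
    offset μ k z 0 = coord μ k - coord μ k.other + relPos z 0 := by simp [offset, pos]; ring
@[simp] lemma offset_one (μ : ℝ) (k : Primary) (z : Phase) :
    offset μ k z 1 = relPos z 1 := by simp [offset, pos]
@[simp] lemma offset_two (μ : ℝ) (k : Primary) (z : Phase) :
    offset μ k z 2 = relPos z 2 := by simp [offset, pos]

lemma hasFDerivAt_div_norm {E : Type*} [NormedAddCommGroup E] [NormedSpace ℝ E] {u : E → E3}
    {u' : E →L[ℝ] E3} {z : E} (m : ℝ) (hu : HasFDerivAt u u' z) (h0 : u z ≠ 0) :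
    HasFDerivAt (fun w => m / ‖u w‖) (-(m / ‖u z‖ ^ 3) • (innerSL ℝ (u z)).comp u') z := by
  have hn : 0 < ‖u z‖ := norm_pos_iff.2 h0
  have h1 := hu.norm_sq
  have h2 : HasDerivAt (fun x => m / √x) (-(m / (2 * ‖u z‖ ^ 3))) (‖u z‖ ^ 2) := by
    have h3 := (Real.hasDerivAt_sqrt (x := ‖u z‖ ^ 2) (by positivity))
    have h4 := (hasDerivAt_const (‖u z‖ ^ 2) m).div h3 (by positivity)
    refine h4.congr_deriv ?_
    rw [Real.sqrt_sq hn.le]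
    field_simp
    ring
  have h5 := h2.comp_hasFDerivAt z h1
  have e : (fun w => m / ‖u w‖) = (fun x => m / √x) ∘ fun w => ‖u w‖ ^ 2 := by
    funext w; simp [Real.sqrt_sq (norm_nonneg (u w))]
  rw [e]
  refine h5.congr_fderiv ?_
  ext v
  simp
  ring

/-- The strength `g' / |q - a'| ^ 3` of the attraction by the other primary. -/
def pull (μ : ℝ) (k : Primary) (z : Phase) : ℝ := mass μ k.other / ‖offset μ k z‖ ^ 3

/-- The function with `f = 1 + (1 - ξ₀) bracket + a₁ ξ₂`. -/
def bracket (μ : ℝ) (k : Primary) (c : ℝ) (z : Phase) : ℝ :=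
  -(c + 1 / 2) + z.1 2 * z.2 1 - z.1 1 * z.2 2 - mass μ k.other / ‖offset μ k z‖

lemma f_eq (μ : ℝ) (k : Primary) (c : ℝ) (z : Phase) :
    f μ k c z = 1 + (1 - z.1 0) * bracket μ k c z + coord μ k * z.1 2 := rfl

/-- `∂f / ∂ξ`. -/
def gradFst (μ : ℝ) (k : Primary) (c : ℝ) (z : Phase) : E4 :=
  !₂[-bracket μ k c z - (1 - z.1 0) * pull μ k z * inner ℝ (offset μ k z) (vec z.2),
    (1 - z.1 0) * (-z.2 2 + pull μ k z * z.2 0 * offset μ k z 0),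
    (1 - z.1 0) * (z.2 1 + pull μ k z * z.2 0 * offset μ k z 1) + coord μ k,
    (1 - z.1 0) * pull μ k z * z.2 0 * offset μ k z 2]

/-- `∂f / ∂η`. -/
def gradSnd (μ : ℝ) (k : Primary) (z : Phase) : E4 :=
  !₂[(1 - z.1 0) * pull μ k z * inner ℝ (offset μ k z) (vec z.1),
    (1 - z.1 0) * (z.1 2 + (1 - z.1 0) * pull μ k z * offset μ k z 0),
    (1 - z.1 0) * (-z.1 1 + (1 - z.1 0) * pull μ k z * offset μ k z 1),
    (1 - z.1 0) ^ 2 * pull μ k z * offset μ k z 2]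

lemma hasFDerivAt_f {μ : ℝ} {k : Primary} (c : ℝ) {z : Phase}
    (hz : position μ k z ≠ pos μ k.other) :
    HasFDerivAt (f μ k c) (pairing (gradFst μ k c z) (gradSnd μ k z)) z := by
  obtain ⟨L, hL, hLv⟩ := exists_hasFDerivAt_relPos z
  have hoff : HasFDerivAt (offset μ k) L z := (hL.const_add (pos μ k)).sub_const _
  have hdiv := hasFDerivAt_div_norm (mass μ k.other) hoff (offset_ne_zero.2 hz)
  have X := fun i => hasFDerivAt_coord₁ i z
  have Y := fun i => hasFDerivAt_coord₂ i z
  have hbr : HasFDerivAt (bracket μ k c) _ z :=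
    ((((X 2).mul (Y 1)).const_add (-(c + 1 / 2))).sub ((X 1).mul (Y 2))).sub hdiv
  have hf : HasFDerivAt (f μ k c) _ z :=
    ((((X 0).const_sub 1).mul hbr).const_add 1).add ((X 2).const_mul (coord μ k))
  refine hf.congr_fderiv ?_
  refine ContinuousLinearMap.ext fun v => ?_
  have hp : mass μ k.other / ‖offset μ k z‖ ^ 3 = pull μ k z := rfl
  simp only [hp, pairing_apply, inner_E4, gradFst, gradSnd, inner_E3, _root_.add_apply,
    _root_.sub_apply, _root_.smul_apply, _root_.neg_apply,
    ContinuousLinearMap.comp_apply, innerSL_apply_apply, hLv, relPosDeriv]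
  generalize pull μ k z = G
  generalize bracket μ k c z = K
  simp [vec]
  ring

/-- `|η|² f`. -/
def kap (μ : ℝ) (k : Primary) (c : ℝ) (z : Phase) : ℝ := ‖z.2‖ ^ 2 * f μ k c z

lemma hasFDerivAt_Q {μ : ℝ} {k : Primary} (c : ℝ) {z : Phase}
    (hz : position μ k z ≠ pos μ k.other) :
    HasFDerivAt (Q μ k c) (pairing (kap μ k c z • gradFst μ k c z)
      (f μ k c z ^ 2 • z.2 + kap μ k c z • gradSnd μ k z)) z := by
  have h1 := hasFDerivAt_f c hz
  have h2 : HasFDerivAt (fun w : Phase => w.2) (ContinuousLinearMap.snd ℝ E4 E4) z :=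
    hasFDerivAt_snd
  have h3 : HasFDerivAt (Q μ k c) _ z := ((h1.pow 2).mul h2.norm_sq).mul_const (1 / 2) |>.congr_of_eventuallyEq
    (Eventually.of_forall fun w => by simp [Q]; ring)
  refine h3.congr_fderiv ?_
  refine ContinuousLinearMap.ext fun v => ?_
  simp [kap, inner_add_left, inner_smul_left]
  ring

/-- The Hamiltonian vector field of `Q`, in coordinates. -/
def field (μ : ℝ) (k : Primary) (c : ℝ) (z : Phase) : Phase :=
  let A := kap μ k c z • gradFst μ k c z
  let B := f μ k c z ^ 2 • z.2 + kap μ k c z • gradSnd μ k z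
  (B - inner ℝ B z.1 • z.1, -A + inner ℝ B z.1 • z.2 + (inner ℝ A z.1 - inner ℝ B z.2) • z.1)

/-- All later estimates and smoothness statements use the closed formula `field`, which involves no
derivatives of `Q`. -/
lemma hamVec_Q {μ : ℝ} {k : Primary} (c : ℝ) {z : Phase} (hz : position μ k z ≠ pos μ k.other) :
    hamVec (Q μ k c) z = field μ k c z := hamVec_eq (hasFDerivAt_Q c hz)

/-- The infinitesimal rotation of the rotating frame. -/
def rot (x : E3) : E3 := !₂[x 1, -x 0, 0]

lemma inner_TstarS3 {z : Phase} (hz : z ∈ TstarS3) :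
    z.1 0 * z.2 0 + z.1 1 * z.2 1 + z.1 2 * z.2 2 + z.1 3 * z.2 3 = 0 := by
  rw [← inner_E4]; exact hz.2

lemma normSq_TstarS3 {z : Phase} (hz : z ∈ TstarS3) :
    z.1 0 ^ 2 + z.1 1 ^ 2 + z.1 2 ^ 2 + z.1 3 ^ 2 = 1 := by
  rw [← normSq_E4, hz.1]; norm_num

/-- `- (1 - ξ₀)² p'` along the Hamiltonian vector field of `Q`. -/
lemma field_momentum (μ : ℝ) (k : Primary) (c : ℝ) {z : Phase} (hz : z ∈ TstarS3) :
    (1 - z.1 0) • vec (field μ k c z).1 + (field μ k c z).1 0 • vec z.1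
      = f μ k c z ^ 2 • relPos z + kap μ k c z • ((1 - z.1 0) ^ 2 • rot (vec z.1)
        + ((1 - z.1 0) ^ 3 * pull μ k z) • offset μ k z) := by
  have hb : inner ℝ (gradSnd μ k z) z.1
      = (1 - z.1 0) * pull μ k z * inner ℝ (offset μ k z) (vec z.1) := by
    rw [inner_E4, inner_E3]; simp [gradSnd, inner_E3, vec]; ring
  have hb' : inner ℝ z.2 z.1 = (0 : ℝ) := by rw [real_inner_comm]; exact hz.2
  simp only [field, inner_add_left, inner_smul_left, hb, hb', conj_trivial]
  generalize kap μ k c z = κ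
  generalize f μ k c z = φ
  ext i
  fin_cases i <;> simp [vec, rot, gradSnd] <;> ring

/-- `q'` along the Hamiltonian vector field of `Q`. -/
lemma field_position (μ : ℝ) (k : Primary) (c : ℝ) {z : Phase} (hz : z ∈ TstarS3) :
    relPosDeriv z (field μ k c z)
      = kap μ k c z • (-vec z.1 + (1 - z.1 0) • rot (position μ k z)) := by
  have hb : inner ℝ (gradSnd μ k z) z.1
      = (1 - z.1 0) * pull μ k z * inner ℝ (offset μ k z) (vec z.1) := by
    rw [inner_E4, inner_E3]; simp [gradSnd, inner_E3, vec]; ring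
  have hb' : inner ℝ z.2 z.1 = (0 : ℝ) := by rw [real_inner_comm]; exact hz.2
  have he : kap μ k c z * inner ℝ (gradFst μ k c z) z.1 - (f μ k c z ^ 2 * inner ℝ z.2 z.2
        + kap μ k c z * inner ℝ (gradSnd μ k z) z.2)
      = -kap μ k c z * (bracket μ k c z + 1
        + (1 - z.1 0) * pull μ k z * inner ℝ (offset μ k z) (vec z.2)) := by
    have e1 : f μ k c z ^ 2 * inner ℝ z.2 z.2 = kap μ k c z * f μ k c z := by
      rw [real_inner_self_eq_norm_sq, kap]; ring
    rw [e1, f_eq]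
    simp only [inner_E4, inner_E3, gradFst, gradSnd]
    generalize kap μ k c z = κ
    generalize pull μ k z = G
    generalize bracket μ k c z = K
    simp [vec]
    ring
  simp only [field, inner_add_left, inner_smul_left, hb, hb', conj_trivial, he, relPosDeriv]
  generalize kap μ k c z = κ
  generalize f μ k c z = φ
  ext i
  fin_cases i <;> simp [vec, rot, gradSnd, gradFst, inner_E3] <;> ring

/-! ### Energy, collisions and critical points -/

lemma H_eq (μ : ℝ) (k : Primary) (x : E3 × E3) :
    H μ x = ‖x.2‖ ^ 2 / 2 - mass μ k / ‖x.1 - pos μ k‖ - mass μ k.other / ‖x.1 - pos μ k.other‖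
      + x.2 0 * x.1 1 - x.2 1 * x.1 0 := by
  cases k
  · simp [H, mass, Primary.other]
  · simp [H, mass, Primary.other]; ring

/-- Zeros of the gradient of the Jacobi Hamiltonian are Lagrange points. -/
lemma isLagrangePoint_of_grad {μ : ℝ} (k : Primary) {q p : E3} (h1 : q ≠ pos μ k)
    (h2 : q ≠ pos μ k.other) (hp : p + rot q = 0)
    (hq : (mass μ k / ‖q - pos μ k‖ ^ 3) • (q - pos μ k)
      + (mass μ k.other / ‖q - pos μ k.other‖ ^ 3) • (q - pos μ k.other) - rot p = 0) :
    IsLagrangePoint μ (q, p) := by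
  have hd : HasFDerivAt (H μ) (0 : E3 × E3 →L[ℝ] ℝ) (q, p) := by
    have f1 : HasFDerivAt (fun x : E3 × E3 => x.1) (ContinuousLinearMap.fst ℝ E3 E3) (q, p) :=
      hasFDerivAt_fst
    have f2 : HasFDerivAt (fun x : E3 × E3 => x.2) (ContinuousLinearMap.snd ℝ E3 E3) (q, p) :=
      hasFDerivAt_snd
    have d1 := hasFDerivAt_div_norm (mass μ k) (f1.sub_const (pos μ k)) (sub_ne_zero.2 h1)
    have d2 := hasFDerivAt_div_norm (mass μ k.other) (f1.sub_const (pos μ k.other))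
      (sub_ne_zero.2 h2)
    have X : ∀ i : Fin 3, HasFDerivAt (fun x : E3 × E3 => x.1 i)
        ((EuclideanSpace.proj i).comp (ContinuousLinearMap.fst ℝ E3 E3)) (q, p) := fun i =>
      ((EuclideanSpace.proj i : E3 →L[ℝ] ℝ).comp (ContinuousLinearMap.fst ℝ E3 E3)).hasFDerivAt
    have Y : ∀ i : Fin 3, HasFDerivAt (fun x : E3 × E3 => x.2 i)
        ((EuclideanSpace.proj i).comp (ContinuousLinearMap.snd ℝ E3 E3)) (q, p) := fun i =>
      ((EuclideanSpace.proj i : E3 →L[ℝ] ℝ).comp (ContinuousLinearMap.snd ℝ E3 E3)).hasFDerivAt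
    have hH := ((((f2.norm_sq.mul_const (1 / 2)).sub d1).sub d2).add ((Y 0).mul (X 1))).sub
      ((Y 1).mul (X 0))
    refine (hH.congr_of_eventuallyEq (Eventually.of_forall fun x => ?_)).congr_fderiv ?_
    · rw [H_eq μ k]
      simp only [Pi.mul_apply, Pi.add_apply, Pi.sub_apply]
      ring
    · refine ContinuousLinearMap.ext fun v => ?_
      have e1 : inner ℝ (p + rot q) v.2 = (0 : ℝ) := by rw [hp, inner_zero_left]
      have e2 := congrArg (fun w => inner ℝ w v.1) hq
      simp only [inner_sub_left, inner_add_left, inner_smul_left, inner_zero_left,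
        conj_trivial] at e1 e2
      rw [inner_E3 (rot q), inner_E3] at e1
      rw [inner_E3 (rot p)] at e2
      simp [rot] at e1 e2 ⊢
      rw [inner_E3 p]
      linear_combination e1 + e2
  exact ⟨by cases k; exacts [h1, h2], by cases k; exacts [h2, h1], hd⟩

lemma one_sub_nonneg {z : Phase} (hz : z ∈ TstarS3) : 0 ≤ 1 - z.1 0 := by
  have := normSq_TstarS3 hz
  nlinarith [sq_nonneg (z.1 1), sq_nonneg (z.1 2), sq_nonneg (z.1 3)]

lemma one_sub_pos {z : Phase} (hz : z ∈ TstarS3) (h : z.1 0 ≠ 1) : 0 < 1 - z.1 0 :=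
  lt_of_le_of_ne (one_sub_nonneg hz) fun h' => h (by linarith)

lemma one_sub_le_two {z : Phase} (hz : z ∈ TstarS3) : 1 - z.1 0 ≤ 2 := by
  have := normSq_TstarS3 hz
  nlinarith [sq_nonneg (z.1 1), sq_nonneg (z.1 2), sq_nonneg (z.1 3)]

lemma collision_coords {z : Phase} (hz : z ∈ TstarS3) (h : z.1 0 = 1) :
    z.1 1 = 0 ∧ z.1 2 = 0 ∧ z.1 3 = 0 ∧ z.2 0 = 0 := by
  have h1 := normSq_TstarS3 hz
  have h2 := inner_TstarS3 hz
  rw [h] at h1 h2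
  have a1 : z.1 1 = 0 := by nlinarith [sq_nonneg (z.1 1), sq_nonneg (z.1 2), sq_nonneg (z.1 3)]
  have a2 : z.1 2 = 0 := by nlinarith [sq_nonneg (z.1 1), sq_nonneg (z.1 2), sq_nonneg (z.1 3)]
  have a3 : z.1 3 = 0 := by nlinarith [sq_nonneg (z.1 1), sq_nonneg (z.1 2), sq_nonneg (z.1 3)]
  refine ⟨a1, a2, a3, ?_⟩
  rw [a1, a2, a3] at h2
  linarith

lemma f_collision {μ : ℝ} {k : Primary} {c : ℝ} {z : Phase} (hz : z ∈ TstarS3) (h : z.1 0 = 1) :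
    f μ k c z = 1 := by
  rw [f_eq, h, (collision_coords hz h).2.1]; ring

lemma field_collision {μ : ℝ} {k : Primary} {c : ℝ} {z : Phase} (hz : z ∈ TstarS3)
    (h : z.1 0 = 1) : (field μ k c z).1 = z.2 := by
  have h2 : inner ℝ z.2 z.1 = (0 : ℝ) := by rw [real_inner_comm]; exact hz.2
  have hg : gradSnd μ k z = 0 := by
    ext i; fin_cases i <;> simp [gradSnd, h]
  simp [field, hg, f_collision hz h, h2]

/-! ### The sheet lying over `H = c` -/

section Sheet

variable {μ : ℝ} {k : Primary} {c : ℝ} {z : Phase}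

lemma norm_mul_f (hg : 0 < mass μ k) (hz : z ∈ sheet μ c k) : ‖z.2‖ * f μ k c z = mass μ k := by
  obtain ⟨⟨-, -, hQ⟩, hf⟩ := hz
  have h1 : (‖z.2‖ * f μ k c z) ^ 2 = mass μ k ^ 2 := by rw [Q] at hQ; linear_combination 2 * hQ
  exact (pow_left_inj₀ (by positivity) hg.le two_ne_zero).1 h1

lemma norm_snd_pos (hg : 0 < mass μ k) (hz : z ∈ sheet μ c k) : 0 < ‖z.2‖ := by
  have := norm_mul_f hg hz
  exact pos_of_mul_pos_left (this ▸ hg) hz.2.le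

lemma kap_pos (hg : 0 < mass μ k) (hz : z ∈ sheet μ c k) : 0 < kap μ k c z :=
  mul_pos (pow_pos (norm_snd_pos hg hz) 2) hz.2

lemma kap_eq (hg : 0 < mass μ k) (hz : z ∈ sheet μ c k) : kap μ k c z = mass μ k * ‖z.2‖ := by
  rw [← norm_mul_f hg hz, kap]; ring

lemma norm_relPos_pos (hg : 0 < mass μ k) (hz : z ∈ sheet μ c k) (h0 : z.1 0 ≠ 1) :
    0 < ‖relPos z‖ := by
  rw [norm_relPos hz.1.1]
  exact mul_pos (one_sub_pos hz.1.1 h0) (norm_snd_pos hg hz)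

lemma position_sub_pos (μ : ℝ) (k : Primary) (z : Phase) : position μ k z - pos μ k = relPos z := by
  simp [position]

lemma H_eq_energy (hg : 0 < mass μ k) (hz : z ∈ sheet μ c k) (h0 : z.1 0 ≠ 1) :
    H μ (position μ k z, momentum z) = c := by
  have h := moser_identity μ k c hz.1.1 h0 (norm_pos_iff.1 (norm_snd_pos hg hz))
  rw [norm_mul_f hg hz, sub_self, position_sub_pos] at h
  have := norm_relPos_pos hg hz h0
  rcases mul_eq_zero.1 h with h | h
  · linarith
  · linarith

/-- Points of `H⁻¹(c)` lie on the sheet. -/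
lemma mem_sheet_of_energy (hg : 0 < mass μ k) (hz : z ∈ TstarS3) (h0 : z.1 0 ≠ 1) (hη : z.2 ≠ 0)
    (hpos : position μ k z ≠ pos μ k.other) (hH : H μ (position μ k z, momentum z) = c) :
    z ∈ sheet μ c k := by
  have h := moser_identity μ k c hz h0 hη
  rw [hH, sub_self, zero_mul] at h
  have h' : ‖z.2‖ * f μ k c z = mass μ k := by linarith
  refine ⟨⟨hz, hpos, ?_⟩, pos_of_mul_pos_right (h' ▸ hg) (norm_nonneg _)⟩
  rw [Q, ← h']; ring

/-- The Hamiltonian vector field vanishes only at Lagrange points. -/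
lemma field_ne_zero (hg : 0 < mass μ k) (hz : z ∈ sheet μ c k)
    (hcrit : ∀ y, IsLagrangePoint μ y → H μ y ≠ c) : field μ k c z ≠ 0 := by
  intro hV
  have hη := norm_snd_pos hg hz
  by_cases h0 : z.1 0 = 1
  · have := field_collision (μ := μ) (k := k) (c := c) hz.1.1 h0
    rw [hV] at this
    rw [← this] at hη
    simp at hη
  · refine hcrit _ (isLagrangePoint_of_grad k ?_ hz.1.2.1 ?_ ?_) (H_eq_energy hg hz h0)
    · rw [← sub_ne_zero, position_sub_pos, ← norm_pos_iff]
      exact norm_relPos_pos hg hz h0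
    · have hs := one_sub_pos hz.1.1 h0
      have h := field_position μ k c hz.1.1
      rw [hV] at h
      have h' : -vec z.1 + (1 - z.1 0) • rot (position μ k z) = 0 := by
        rcases smul_eq_zero.1 (h.symm.trans (show relPosDeriv z 0 = 0 by
          ext i; fin_cases i <;> simp [relPosDeriv, vec])) with h | h
        · exact absurd h (kap_pos hg hz).ne'
        · exact h
      have h'' := congrArg ((1 - z.1 0)⁻¹ • ·) h'
      simp only [smul_add, smul_neg, smul_smul, inv_mul_cancel₀ hs.ne', one_smul, smul_zero] at h''
      exact h''
    · have hs := one_sub_pos hz.1.1 h0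
      have h := field_momentum μ k c hz.1.1
      rw [hV, kap_eq hg hz, show f μ k c z = mass μ k / ‖z.2‖ by
        rw [eq_div_iff hη.ne', mul_comm]; exact norm_mul_f hg hz] at h
      rw [position_sub_pos, norm_relPos hz.1.1]
      -- After division by `g |η| (1 - ξ₀)³`, the equation for the momentum becomes the vanishing of
      -- the `q`-gradient of `H`.
      have e : ∀ i, ((mass μ k / ((1 - z.1 0) * ‖z.2‖) ^ 3) • relPos z
          + (mass μ k.other / ‖position μ k z - pos μ k.other‖ ^ 3) •
            (position μ k z - pos μ k.other) - rot (momentum z)) i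
          = (mass μ k * ‖z.2‖ * (1 - z.1 0) ^ 3)⁻¹ * ((mass μ k / ‖z.2‖) ^ 2 • relPos z
            + (mass μ k * ‖z.2‖) • ((1 - z.1 0) ^ 2 • rot (vec z.1)
              + ((1 - z.1 0) ^ 3 * pull μ k z) • offset μ k z)) i := by
        intro i
        have hG : mass μ k.other / ‖position μ k z - pos μ k.other‖ ^ 3 = pull μ k z := rfl
        have hO : position μ k z - pos μ k.other = offset μ k z := rfl
        rw [hG, hO]
        have hr : rot (momentum z) i = -(1 - z.1 0)⁻¹ * rot (vec z.1) i := by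
          fin_cases i <;> simp [rot, momentum]
        simp only [PiLp.add_apply, PiLp.sub_apply, PiLp.smul_apply, smul_eq_mul, hr]
        field_simp
        ring
      ext i
      rw [e, ← h]
      simp [vec]
      fin_cases i <;> simp

end Sheet

/-! ### Tangent vectors -/

/-- A vector tangent to `T^*S³` is determined by its `ξ`-part and its `q`-part. -/
lemma eq_zero_of_relPosDeriv {z v : Phase} (hz : z ∈ TstarS3) (h0 : z.1 0 ≠ 1)
    (hv : inner ℝ z.1 v.2 = (0 : ℝ)) (h1 : v.1 = 0) (h2 : relPosDeriv z v = 0) : v = 0 := by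
  have hs := (one_sub_pos hz h0).ne'
  rw [inner_E4] at hv
  have n := normSq_TstarS3 hz
  have r : ∀ i, v.2 0 * vec z.1 i + (1 - z.1 0) * vec v.2 i = 0 := fun i => by
    have := congrArg (fun w : E3 => w i) h2
    fin_cases i <;> simpa [relPosDeriv, h1, vec] using this
  have r0 := r 0
  have r1 := r 1
  have r2 := r 2
  simp [vec] at r0 r1 r2
  have hv0 : v.2 0 = 0 := by
    have : (1 - z.1 0) * v.2 0 = 0 := by
      -- Contracting the position equations with `ξ⃗` and using `|ξ| = 1` and `⟨ξ, v.2⟩ = 0` leaves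
      -- `(1 - ξ₀) v₀ = 0`.
      linear_combination z.1 1 * r0 + z.1 2 * r1 + z.1 3 * r2 - v.2 0 * n - (1 - z.1 0) * hv
    exact (mul_eq_zero.1 this).resolve_left hs
  rw [hv0] at r0 r1 r2
  simp [hs] at r0 r1 r2
  refine Prod.ext h1 ?_
  ext i
  fin_cases i
  exacts [hv0, r0, r1, r2]

lemma field_mem_tangent (μ : ℝ) (k : Primary) (c : ℝ) {z : Phase}
    (hpos : position μ k z ≠ pos μ k.other) (hz : z ∈ TstarS3) :
    field μ k c z ∈ tangentTstarS3 z := by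
  rw [← hamVec_Q c hpos]; exact hamVec_mem _ hz

lemma fderiv_Q_field (μ : ℝ) (k : Primary) (c : ℝ) {z : Phase}
    (hpos : position μ k z ≠ pos μ k.other) (hz : z ∈ TstarS3) :
    fderiv ℝ (Q μ k c) z (field μ k c z) = 0 := by
  have h := omega_hamVec (Q μ k c) (hasFDerivAt_Q c hpos).differentiableAt
    (hamVec_mem (Q μ k c) hz)
  rw [hamVec_Q c hpos] at h
  simp [omega] at h
  linarith

/-- Where the Hamiltonian vector field does not vanish, `Q` has no critical point on `T^*S³`. -/
lemma exists_tangent_fderiv_Q_ne_zero {μ : ℝ} {k : Primary} {c : ℝ} {z : Phase}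
    (hpos : position μ k z ≠ pos μ k.other) (hz : z ∈ TstarS3) (hV : field μ k c z ≠ 0) :
    ∃ v ∈ tangentTstarS3 z, fderiv ℝ (Q μ k c) z v ≠ 0 := by
  set V := field μ k c z with hVdef
  have hVt := field_mem_tangent μ k c hpos hz
  rw [← hVdef] at hVt
  obtain ⟨t1, t2⟩ := hVt
  have h3 : inner ℝ z.1 z.1 = (1 : ℝ) := by rw [real_inner_self_eq_norm_sq, hz.1]; norm_num
  -- This is `V` turned by the standard complex structure and corrected to be tangent to `T^*S³`.
  -- Pairing it with `V` gives `|V₁|² + |V₂|² - ⟨ξ, V₂⟩²`, which vanishes only for `V = 0`.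
  have hv : ((V.2 - inner ℝ z.1 V.2 • z.1, -V.1 - inner ℝ z.2 V.2 • z.1) : Phase)
      ∈ tangentTstarS3 z := by
    refine ⟨?_, ?_⟩
    · simp only [inner_sub_right, inner_smul_right, h3]; ring
    · simp only [inner_sub_left, inner_sub_right, inner_smul_left, inner_smul_right, inner_neg_right,
        h3, t1, hz.2, conj_trivial]
      rw [real_inner_comm]; ring
  refine ⟨_, hv, fun h => hV ?_⟩
  have ho := omega_hamVec (Q μ k c) (hasFDerivAt_Q c hpos).differentiableAt hv
  rw [hamVec_Q c hpos, h, ← hVdef] at ho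
  simp only [omega, inner_sub_right, inner_sub_left, inner_neg_left, inner_smul_right,
    inner_smul_left, t1, conj_trivial, real_inner_comm z.1 V.2, real_inner_self_eq_norm_sq] at ho
  have hcs : inner ℝ z.1 V.2 ^ 2 ≤ ‖V.2‖ ^ 2 := by
    have := abs_real_inner_le_norm z.1 V.2
    rw [hz.1, one_mul] at this
    exact sq_le_sq' (by linarith [neg_abs_le (inner ℝ z.1 V.2 : ℝ)]) (by linarith [le_abs_self (inner ℝ z.1 V.2 : ℝ)])
  have hV1 : V.1 = 0 := by
    rw [← norm_eq_zero, ← sq_eq_zero_iff]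
    nlinarith [sq_nonneg ‖V.1‖]
  have hV2 : V.2 = 0 := by
    rw [hV1, inner_zero_left, zero_add] at t2
    rw [hV1, t2] at ho
    rw [← norm_eq_zero, ← sq_eq_zero_iff]
    simp at ho
    simp [ho]
  exact Prod.ext hV1 hV2

/-! ### Smoothness and the local flow -/

lemma contDiff_coord₁ (i : Fin 4) : ContDiff ℝ ∞ (fun z : Phase => z.1 i) :=
  ((EuclideanSpace.proj i : E4 →L[ℝ] ℝ).comp (ContinuousLinearMap.fst ℝ E4 E4)).contDiff

lemma contDiff_coord₂ (i : Fin 4) : ContDiff ℝ ∞ (fun z : Phase => z.2 i) :=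
  ((EuclideanSpace.proj i : E4 →L[ℝ] ℝ).comp (ContinuousLinearMap.snd ℝ E4 E4)).contDiff

lemma contDiff_vec : ContDiff ℝ ∞ vec := vecL.contDiff

lemma contDiff_offset (μ : ℝ) (k : Primary) : ContDiff ℝ ∞ (offset μ k) :=
  (contDiff_position μ k).sub contDiff_const

lemma contDiff_relPos : ContDiff ℝ ∞ relPos := by
  have : relPos = fun z => position 0 .moon z - pos 0 .moon := by
    funext z; simp [position]
  rw [this]
  exact (contDiff_position 0 .moon).sub contDiff_const

section Smooth

variable {μ : ℝ} {k : Primary} {c : ℝ} {z : Phase}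

lemma contDiffAt_pull (hz : position μ k z ≠ pos μ k.other) : ContDiffAt ℝ ∞ (pull μ k) z :=
  contDiffAt_const.div (((contDiff_offset μ k).contDiffAt.norm ℝ (offset_ne_zero.2 hz)).pow 3)
    (pow_ne_zero _ (norm_ne_zero_iff.2 (offset_ne_zero.2 hz)))

lemma contDiffAt_bracket (hz : position μ k z ≠ pos μ k.other) :
    ContDiffAt ℝ ∞ (bracket μ k c) z := by
  have h1 : ContDiffAt ℝ ∞ (fun z => mass μ k.other / ‖offset μ k z‖) z :=
    contDiffAt_const.div ((contDiff_offset μ k).contDiffAt.norm ℝ (offset_ne_zero.2 hz))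
      (norm_ne_zero_iff.2 (offset_ne_zero.2 hz))
  exact (((contDiffAt_const (c := -(c + 1 / 2))).add
    ((contDiff_coord₁ 2).contDiffAt.mul (contDiff_coord₂ 1).contDiffAt)).sub
    ((contDiff_coord₁ 1).contDiffAt.mul (contDiff_coord₂ 2).contDiffAt)).sub h1

lemma contDiffAt_f (hz : position μ k z ≠ pos μ k.other) : ContDiffAt ℝ ∞ (f μ k c) z :=
  ((contDiffAt_const (c := (1 : ℝ))).add
    ((contDiffAt_const.sub (contDiff_coord₁ 0).contDiffAt).mul (contDiffAt_bracket hz))).add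
    (contDiffAt_const.mul (contDiff_coord₁ 2).contDiffAt)

lemma contDiffAt_kap (hz : position μ k z ≠ pos μ k.other) : ContDiffAt ℝ ∞ (kap μ k c) z :=
  (contDiff_snd.norm_sq ℝ).contDiffAt.mul (contDiffAt_f hz)

lemma contDiffAt_Q (hz : position μ k z ≠ pos μ k.other) : ContDiffAt ℝ ∞ (Q μ k c) z :=
  (((contDiffAt_f hz).pow 2).mul (contDiff_snd.norm_sq ℝ).contDiffAt).div_const 2

lemma contDiffAt_gradFst (hz : position μ k z ≠ pos μ k.other) :
    ContDiffAt ℝ ∞ (gradFst μ k c) z := by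
  have hs : ContDiffAt ℝ ∞ (fun z : Phase => 1 - z.1 0) z :=
    contDiffAt_const.sub (contDiff_coord₁ 0).contDiffAt
  have hp := contDiffAt_pull hz
  have hb := contDiffAt_bracket (c := c) hz
  have ho : ∀ i, ContDiffAt ℝ ∞ (fun z => offset μ k z i) z := fun i =>
    (contDiff_euclidean.1 (contDiff_offset μ k) i).contDiffAt
  have y : ∀ i, ContDiffAt ℝ ∞ (fun z : Phase => z.2 i) z := fun i => (contDiff_coord₂ i).contDiffAt
  have hi : ContDiffAt ℝ ∞ (fun z : Phase => inner ℝ (offset μ k z) (vec z.2)) z :=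
    ((contDiff_offset μ k).inner ℝ (contDiff_vec.comp contDiff_snd)).contDiffAt
  rw [contDiffAt_euclidean]
  intro i
  fin_cases i
  · exact hb.neg.sub ((hs.mul hp).mul hi)
  · exact hs.mul ((y 2).neg.add ((hp.mul (y 0)).mul (ho 0)))
  · exact (hs.mul ((y 1).add ((hp.mul (y 0)).mul (ho 1)))).add contDiffAt_const
  · exact ((hs.mul hp).mul (y 0)).mul (ho 2)

lemma contDiffAt_gradSnd (hz : position μ k z ≠ pos μ k.other) :
    ContDiffAt ℝ ∞ (gradSnd μ k) z := by
  have hs : ContDiffAt ℝ ∞ (fun z : Phase => 1 - z.1 0) z :=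
    contDiffAt_const.sub (contDiff_coord₁ 0).contDiffAt
  have hp := contDiffAt_pull hz
  have ho : ∀ i, ContDiffAt ℝ ∞ (fun z => offset μ k z i) z := fun i =>
    (contDiff_euclidean.1 (contDiff_offset μ k) i).contDiffAt
  have x : ∀ i, ContDiffAt ℝ ∞ (fun z : Phase => z.1 i) z := fun i => (contDiff_coord₁ i).contDiffAt
  have hi : ContDiffAt ℝ ∞ (fun z : Phase => inner ℝ (offset μ k z) (vec z.1)) z :=
    ((contDiff_offset μ k).inner ℝ (contDiff_vec.comp contDiff_fst)).contDiffAt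
  rw [contDiffAt_euclidean]
  intro i
  fin_cases i
  · exact (hs.mul hp).mul hi
  · exact hs.mul ((x 2).add ((hs.mul hp).mul (ho 0)))
  · exact hs.mul ((x 1).neg.add ((hs.mul hp).mul (ho 1)))
  · exact ((hs.pow 2).mul hp).mul (ho 2)

lemma contDiffAt_field (hz : position μ k z ≠ pos μ k.other) :
    ContDiffAt ℝ ∞ (field μ k c) z := by
  have hA := (contDiffAt_kap (c := c) hz).smul (contDiffAt_gradFst (c := c) hz)
  have hB := (((contDiffAt_f (c := c) hz).pow 2).smul
    (contDiff_snd (E := E4) (F := E4)).contDiffAt).add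
    ((contDiffAt_kap (c := c) hz).smul (contDiffAt_gradSnd hz))
  have x : ContDiffAt ℝ ∞ (fun z : Phase => z.1) z := contDiff_fst.contDiffAt
  have y : ContDiffAt ℝ ∞ (fun z : Phase => z.2) z := contDiff_snd.contDiffAt
  exact (hB.sub ((hB.inner ℝ x).smul x)).prodMk
    ((hA.neg.add ((hB.inner ℝ x).smul y)).add (((hA.inner ℝ x).sub (hB.inner ℝ y)).smul x))

/-- The flow of a multiple of the Hamiltonian vector field preserves the level set. -/
lemma exists_local_flow_level {l : Phase → ℝ} (hz : z ∈ level μ k c) (hl : ContDiffAt ℝ 1 l z)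
    {U : Set Phase} (hU : U ∈ 𝓝 z) :
    ∃ ε > (0 : ℝ), ∀ᶠ w in 𝓝 z, w ∈ level μ k c → ∃ α : ℝ → Phase, α 0 = w ∧
      ∀ t ∈ Ioo (-ε) ε, (α t ∈ U ∧ α t ∈ level μ k c) ∧
        HasDerivAt α (l (α t) • field μ k c (α t)) t := by
  have hz' := hz.2.1
  have hX : ContDiffAt ℝ 1 (fun w => l w • field μ k c w) z :=
    hl.smul ((contDiffAt_field hz').of_le (by simp))
  have hpos : {w | position μ k w ≠ pos μ k.other} ∈ 𝓝 z :=
    (isOpen_ne_fun (contDiff_position μ k).continuous continuous_const).mem_nhds hz'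
  -- The formula for `field` is tangent to `T^*S³` only on `T^*S³` itself, while the local flow is
  -- constructed in `ℝ⁸`. Along it `u = |ξ|² - 1` satisfies `u' = -2 b u`, so the local bound on `b`
  -- keeps the flow on `|ξ| = 1`. The constraints `⟨ξ, η⟩ = 0` and `Q = g²/2` are then preserved in
  -- turn.
  let b : Phase → ℝ := fun w => l w *
    inner ℝ (f μ k c w ^ 2 • w.2 + kap μ k c w • gradSnd μ k w) w.1
  have hb : ContinuousAt b z := by
    have hB := (((contDiffAt_f (c := c) hz').pow 2).smul
      (contDiff_snd (E := E4) (F := E4)).contDiffAt).add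
      ((contDiffAt_kap (c := c) hz').smul (contDiffAt_gradSnd hz'))
    exact hl.continuousAt.mul (hB.inner ℝ contDiff_fst.contDiffAt).continuousAt
  have hbU : {w | |b w| < |b z| + 1} ∈ 𝓝 z := hb.abs.eventually (gt_mem_nhds (by linarith))
  obtain ⟨ε, hε, hflow⟩ := exists_local_flow hX (inter_mem (inter_mem hU hpos) hbU)
  refine ⟨ε, hε, ?_⟩
  filter_upwards [hflow] with w hw hwl
  obtain ⟨α, h0, hα⟩ := hw
  refine ⟨α, h0, ?_⟩
  obtain ⟨⟨hw1, hw2⟩, -, hwQ⟩ := hwl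
  have hmem0 : (0 : ℝ) ∈ Ioo (-ε) ε := ⟨by linarith, hε⟩
  have hd1 : ∀ t ∈ Ioo (-ε) ε, HasDerivAt (fun t => (α t).1) (l (α t) • field μ k c (α t)).1 t :=
    fun t ht => (hasFDerivAt_fst (p := α t)).comp_hasDerivAt t (hα t ht).2
  have hd2 : ∀ t ∈ Ioo (-ε) ε, HasDerivAt (fun t => (α t).2) (l (α t) • field μ k c (α t)).2 t :=
    fun t ht => (hasFDerivAt_snd (p := α t)).comp_hasDerivAt t (hα t ht).2
  have hn : ∀ t ∈ Ioo (-ε) ε, ‖(α t).1‖ ^ 2 - 1 = 0 := by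
    refine eq_zero_of_norm_deriv_le (h' := fun t => -2 * b (α t) * (‖(α t).1‖ ^ 2 - 1))
      (C := 2 * (|b z| + 1)) (fun t ht => ?_) (fun t ht => ?_) hmem0 (by rw [h0, hw1]; norm_num)
    · refine ((hd1 t ht).norm_sq.sub_const 1).congr_deriv ?_
      simp only [field, Prod.smul_fst, inner_smul_right, inner_sub_right,
        real_inner_self_eq_norm_sq, b]
      rw [real_inner_comm]
      ring
    · rw [norm_mul, Real.norm_eq_abs, abs_mul, abs_neg, abs_two]
      have hlt : |b (α t)| < |b z| + 1 := (hα t ht).1.2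
      exact mul_le_mul_of_nonneg_right (by linarith) (norm_nonneg _)
  have hn' : ∀ t ∈ Ioo (-ε) ε, ‖(α t).1‖ = 1 := fun t ht =>
    (pow_left_inj₀ (norm_nonneg _) zero_le_one two_ne_zero).1 (by linarith [hn t ht])
  have hm : ∀ t ∈ Ioo (-ε) ε, inner ℝ (α t).1 (α t).2 = (0 : ℝ) := by
    refine eq_zero_of_norm_deriv_le (h := fun t => (inner ℝ (α t).1 (α t).2 : ℝ))
      (h' := fun _ => 0) (C := 0) (fun t ht => ?_) (fun t ht => by simp) hmem0 (by rw [h0, hw2])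
    refine ((hd1 t ht).inner ℝ (hd2 t ht)).congr_deriv ?_
    have h3 : inner ℝ (α t).1 (α t).1 = (1 : ℝ) := by
      rw [real_inner_self_eq_norm_sq, hn' t ht]; norm_num
    simp only [field, Prod.smul_fst, Prod.smul_snd, inner_smul_right, inner_smul_left,
      inner_sub_left, inner_add_right, inner_neg_right, h3, conj_trivial]
    rw [real_inner_comm (α t).1 (gradFst μ k c (α t))]
    ring
  have hT : ∀ t ∈ Ioo (-ε) ε, α t ∈ TstarS3 := fun t ht => ⟨hn' t ht, hm t ht⟩
  have hQ : ∀ t ∈ Ioo (-ε) ε, Q μ k c (α t) - mass μ k ^ 2 / 2 = 0 := by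
    refine eq_zero_of_norm_deriv_le (h := fun t => Q μ k c (α t) - mass μ k ^ 2 / 2)
      (h' := fun _ => 0) (C := 0) (fun t ht => ?_) (fun t ht => by simp) hmem0 (by rw [h0, hwQ, sub_self])
    have hp := (hα t ht).1.1.2
    refine (((hasFDerivAt_Q c hp).differentiableAt.hasFDerivAt.comp_hasDerivAt t
      (hα t ht).2).sub_const _).congr_deriv ?_
    rw [map_smul, fderiv_Q_field μ k c hp (hT t ht), smul_zero]
  exact fun t ht => ⟨⟨(hα t ht).1.1.1, hT t ht, (hα t ht).1.1.2, by linarith [hQ t ht]⟩,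
    (hα t ht).2⟩

end Smooth

/-! ### Regular level sets are locally connected -/

/-- The implicit function theorem straightens the fibre to a piece of `ker g'`; the image of a small
ball there is connected and contains all nearby points of the fibre. -/
lemma exists_isPreconnected_fiber {E G : Type*} [NormedAddCommGroup E] [NormedSpace ℝ E]
    [CompleteSpace E] [NormedAddCommGroup G] [NormedSpace ℝ G] [FiniteDimensional ℝ G] {g : E → G}
    {g' : E →L[ℝ] G} {a : E} (hg : HasStrictFDerivAt g g' a) (hsurj : g'.range = ⊤) {U : Set E}
    (hU : U ∈ 𝓝 a) :
    ∃ N ⊆ U, a ∈ N ∧ IsPreconnected N ∧ (∀ x ∈ N, g x = g a) ∧ ∀ᶠ x in 𝓝 a, g x = g a → x ∈ N := by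
  set e := hg.implicitToOpenPartialHomeomorph g g' hsurj
  have ha : a ∈ e.source := hg.mem_implicitToOpenPartialHomeomorph_source hsurj
  have hea : e a = (g a, 0) := hg.implicitToOpenPartialHomeomorph_self hsurj
  have hfst : ∀ x, (e x).1 = g x := fun x => rfl
  have htar : e.target ∩ e.symm ⁻¹' U ∈ 𝓝 (e a) := by
    refine inter_mem (e.open_target.mem_nhds (e.map_source ha)) ?_
    exact (e.continuousAt_symm (e.map_source ha)).preimage_mem_nhds (by rw [e.left_inv ha]; exact hU)
  rw [hea, nhds_prod_eq, mem_prod_iff] at htar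
  obtain ⟨s, hs, t, ht, hst⟩ := htar
  obtain ⟨r, hr, hrt⟩ := Metric.mem_nhds_iff.1 ht
  have hsub : ∀ y ∈ Metric.ball (0 : g'.ker) r, (g a, y) ∈ e.target ∧ e.symm (g a, y) ∈ U :=
    fun y hy => hst ⟨mem_of_mem_nhds hs, hrt hy⟩
  refine ⟨(fun y => e.symm (g a, y)) '' Metric.ball 0 r, ?_, ?_, ?_, ?_, ?_⟩
  · rintro _ ⟨y, hy, rfl⟩
    exact (hsub y hy).2
  · exact ⟨0, Metric.mem_ball_self hr, by simp only [← hea]; exact e.left_inv ha⟩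
  · refine (convex_ball (0 : g'.ker) r).isPreconnected.image _ ?_
    exact e.continuousOn_symm.comp (by fun_prop) fun y hy => (hsub y hy).1
  · rintro _ ⟨y, hy, rfl⟩
    rw [← hfst, e.right_inv (hsub y hy).1]
  · have hc : ContinuousAt (fun x => (e x).2) a := (e.continuousAt ha).snd
    have h2 : ∀ᶠ x in 𝓝 a, (e x).2 ∈ Metric.ball (0 : g'.ker) r :=
      hc.preimage_mem_nhds (by rw [hea]; exact Metric.ball_mem_nhds _ hr)
    filter_upwards [e.open_source.mem_nhds ha, h2] with x hx hx2 hgx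
    refine ⟨(e x).2, hx2, ?_⟩
    have : (g a, (e x).2) = e x := by rw [← hgx, ← hfst]
    simp only [this]
    exact e.left_inv hx

/-- The level set is the common fibre of `|ξ|²`, `⟨ξ, η⟩` and `Q`, which are independent where the
Hamiltonian vector field does not vanish. Connected neighbourhoods make the components of the
regularized spaces open. -/
lemma exists_isPreconnected_level {μ : ℝ} {k : Primary} {c : ℝ} {z : Phase}
    (hz : z ∈ level μ k c) (hV : field μ k c z ≠ 0) {U : Set Phase} (hU : U ∈ 𝓝 z) :
    ∃ N ⊆ U ∩ level μ k c, z ∈ N ∧ IsPreconnected N ∧ ∀ᶠ w in 𝓝 z, w ∈ level μ k c → w ∈ N := by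
  obtain ⟨hT, hpos, hQ⟩ := hz
  have x : HasStrictFDerivAt (fun z : Phase => z.1) (ContinuousLinearMap.fst ℝ E4 E4) z :=
    hasStrictFDerivAt_fst
  have y : HasStrictFDerivAt (fun z : Phase => z.2) (ContinuousLinearMap.snd ℝ E4 E4) z :=
    hasStrictFDerivAt_snd
  have hd1 := x.inner ℝ x
  have hd2 := x.inner ℝ y
  have hd3 : HasStrictFDerivAt (Q μ k c) _ z := (contDiffAt_Q hpos).hasStrictFDerivAt (by simp)
  obtain ⟨v₀, ⟨hv1, hv2⟩, hv3⟩ := exists_tangent_fderiv_Q_ne_zero hpos hT hV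
  have h3 : inner ℝ z.1 z.1 = (1 : ℝ) := by rw [real_inner_self_eq_norm_sq, hT.1]; norm_num
  have hnhds : {w | position μ k w ≠ pos μ k.other} ∈ 𝓝 z :=
    (isOpen_ne_fun (contDiff_position μ k).continuous continuous_const).mem_nhds hpos
  obtain ⟨N, hNU, hzN, hN, hN1, hN2⟩ := exists_isPreconnected_fiber
    (hd1.prodMk (hd2.prodMk hd3)) (by
      rw [LinearMap.range_eq_top]
      rintro ⟨a, b, e⟩
      -- The multiples of `ξ` prescribe the first two derivatives; the vector `v₀`, invisible to
      -- them, corrects the derivative of `Q`.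
      let u : Phase := ((a / 2) • z.1, b • z.1)
      refine ⟨u + ((e - fderiv ℝ (Q μ k c) z u) / fderiv ℝ (Q μ k c) z v₀) • v₀, ?_⟩
      have h4 : inner ℝ z.1 v₀.2 = -(inner ℝ v₀.1 z.2 : ℝ) := by linarith
      refine Prod.ext ?_ (Prod.ext ?_ ?_)
      · have h5 : inner ℝ v₀.1 z.1 = (0 : ℝ) := by rw [real_inner_comm]; exact hv1
        simp [fderivInnerCLM_apply, inner_add_right, inner_smul_right, inner_add_left,
          inner_smul_left, u, hv1, h5, hT.1]
      · have h5 : inner ℝ z.1 z.2 = (0 : ℝ) := hT.2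
        simp [fderivInnerCLM_apply, inner_add_right, inner_smul_right, inner_add_left,
          inner_smul_left, u, h4, h5, hT.1]
      · change fderiv ℝ (Q μ k c) z (u + ((e - fderiv ℝ (Q μ k c) z u)
          / fderiv ℝ (Q μ k c) z v₀) • v₀) = e
        rw [map_add, map_smul, smul_eq_mul, div_mul_cancel₀ _ hv3]
        ring) (inter_mem hU hnhds)
  have hiff : ∀ w, position μ k w ≠ pos μ k.other →
      (((inner ℝ w.1 w.1 : ℝ), (inner ℝ w.1 w.2 : ℝ), Q μ k c w)
        = ((inner ℝ z.1 z.1 : ℝ), (inner ℝ z.1 z.2 : ℝ), Q μ k c z)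
        ↔ w ∈ level μ k c) := by
    intro w hw
    rw [hT.2, hQ, Prod.ext_iff, Prod.ext_iff, real_inner_self_eq_norm_sq,
      real_inner_self_eq_norm_sq, hT.1]
    constructor
    · rintro ⟨h1, h2, h3⟩
      exact ⟨⟨(pow_left_inj₀ (norm_nonneg _) zero_le_one two_ne_zero).1 h1, h2⟩, hw, h3⟩
    · rintro ⟨⟨h1, h2⟩, -, h3⟩
      exact ⟨by simp [h1], h2, h3⟩
  refine ⟨N, fun w hw => ⟨(hNU hw).1, (hiff w (hNU hw).2).1 (hN1 w hw)⟩, hzN, hN, ?_⟩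
  filter_upwards [hN2] with w hw hwl
  exact hw ((hiff w hwl.2.1).2 hwl)

/-! ### Compactness -/

/-- Points of the sheet over a bounded region away from the other primary. -/
def core (μ c : ℝ) (k : Primary) (R w₀ : ℝ) : Set Phase :=
  {z | z ∈ sheet μ c k ∧ ‖relPos z‖ ≤ R ∧ w₀ ≤ ‖offset μ k z‖}

/-- In `g = |η| f` the only terms not controlled by `(1 - ξ₀)|η| = |q - a| ≤ R` are the rotational
ones. Near a collision `|ξ⃗|² ≤ 2(1 - ξ₀)`, so these are `O(√|η|)` and are absorbed into `|η|/2`. -/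
lemma norm_snd_le {μ : ℝ} {k : Primary} {c R w₀ : ℝ} (hg : 0 < mass μ k)
    (hg' : 0 ≤ mass μ k.other) (hw₀ : 0 < w₀) (hR : 0 < R) {z : Phase}
    (hz : z ∈ core μ c k R w₀) :
    ‖z.2‖ ≤ 2 * (mass μ k + R * (|c + 1 / 2| + mass μ k.other / w₀) + (2 * R + |coord μ k|) ^ 2 * R) := by
  obtain ⟨hs, hr, hw⟩ := hz
  have hT := hs.1.1
  have hN := norm_snd_pos hg hs
  have hfN := norm_mul_f hg hs
  have h0 := one_sub_nonneg hT
  have h2 := one_sub_le_two hT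
  rw [norm_relPos hT] at hr
  rw [f_eq] at hfN
  have hq0 : 0 ≤ mass μ k.other / ‖offset μ k z‖ := by positivity
  have hq1 : mass μ k.other / ‖offset μ k z‖ ≤ mass μ k.other / w₀ :=
    div_le_div_of_nonneg_left hg' hw₀ hw
  unfold bracket at hfN
  set N := ‖z.2‖
  set s := 1 - z.1 0 with hsdef
  set m := mass μ k.other / ‖offset μ k z‖
  set m₀ := mass μ k.other / w₀
  have hxy : |z.1 2 * z.2 1 - z.1 1 * z.2 2| ≤ √(2 * s) * N := by
    rw [← Real.sqrt_sq hN.le, ← Real.sqrt_mul (by linarith)]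
    refine Real.abs_le_sqrt ?_
    have e1 := normSq_TstarS3 hT
    have e2 : N ^ 2 = _ := normSq_E4 z.2
    have e3 : z.1 1 ^ 2 + z.1 2 ^ 2 ≤ 2 * s := by nlinarith [sq_nonneg (z.1 3), sq_nonneg s]
    have e4 : z.2 1 ^ 2 + z.2 2 ^ 2 ≤ N ^ 2 := by nlinarith [sq_nonneg (z.2 3), sq_nonneg (z.2 0)]
    nlinarith [sq_nonneg (z.1 2 * z.2 2 + z.1 1 * z.2 1), sq_nonneg (z.2 1), sq_nonneg (z.2 2)]
  have hx : |z.1 2| ≤ √(2 * s) := by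
    refine Real.abs_le_sqrt ?_
    nlinarith [normSq_TstarS3 hT, sq_nonneg (z.1 3), sq_nonneg (z.1 1), sq_nonneg s]
  set S := √(2 * s)
  have hS0 : 0 ≤ S := Real.sqrt_nonneg _
  have hS2 : S ^ 2 = 2 * s := Real.sq_sqrt (by linarith)
  have hX2 : (S * N) ^ 2 ≤ 2 * R * N := by rw [mul_pow, hS2]; nlinarith
  -- Young's inequality for `S N`, whose square is at most `2 R N`.
  have hA : (2 * R + |coord μ k|) * (S * N) ≤ (2 * R + |coord μ k|) ^ 2 * R + N / 2 := by
    have h : 0 ≤ (2 * R * (2 * R + |coord μ k|) - S * N) ^ 2 := sq_nonneg _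
    have h' : 4 * R * ((2 * R + |coord μ k|) * (S * N))
        ≤ 4 * R * ((2 * R + |coord μ k|) ^ 2 * R + N / 2) := by nlinarith
    exact le_of_mul_le_mul_left h' (by positivity)
  have b1 : s * N * (c + 1 / 2) ≤ R * |c + 1 / 2| :=
    (mul_le_mul_of_nonneg_left (le_abs_self _) (by positivity)).trans
      (mul_le_mul_of_nonneg_right hr (abs_nonneg _))
  have b2 : s * N * m ≤ R * m₀ := mul_le_mul hr hq1 hq0 hR.le
  have b3 : -(s * N * (z.1 2 * z.2 1 - z.1 1 * z.2 2)) ≤ R * (S * N) := by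
    rw [← mul_neg]
    exact (mul_le_mul_of_nonneg_left ((neg_le_abs _).trans hxy) (by positivity)).trans
      (mul_le_mul_of_nonneg_right hr (by positivity))
  have b4 : -(coord μ k * z.1 2 * N) ≤ |coord μ k| * (S * N) := by
    rw [← mul_assoc, ← neg_mul]
    refine mul_le_mul_of_nonneg_right ((neg_le_abs _).trans ?_) hN.le
    rw [abs_mul]
    exact mul_le_mul_of_nonneg_left hx (abs_nonneg _)
  have b5 := mul_nonneg hR.le (mul_nonneg hS0 hN.le)
  have e1 : N = mass μ k + s * N * (c + 1 / 2) + -(s * N * (z.1 2 * z.2 1 - z.1 1 * z.2 2))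
      + s * N * m + -(coord μ k * z.1 2 * N) := by rw [← hfN]; ring
  rw [add_mul] at hA
  rw [mul_add]
  linarith

/-- On the level set `f` cannot vanish, because `Q = g²/2 > 0`; so `f > 0` may be replaced by the
closed condition `f ≥ 0`. The bound `w₀` keeps `f` and `Q` continuous. -/
lemma isCompact_core {μ : ℝ} {k : Primary} {c R w₀ : ℝ} (hg : 0 < mass μ k)
    (hg' : 0 ≤ mass μ k.other) (hw₀ : 0 < w₀) (hR : 0 < R) : IsCompact (core μ c k R w₀) := by
  refine Metric.isCompact_of_isClosed_isBounded ?_ ?_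
  · let T : Set Phase := {z | w₀ ≤ ‖offset μ k z‖}
    have hTc : IsClosed T := isClosed_le continuous_const (contDiff_offset μ k).continuous.norm
    have hTpos : ∀ z ∈ T, position μ k z ≠ pos μ k.other := fun z hz =>
      offset_ne_zero.1 (norm_pos_iff.1 (hw₀.trans_le hz))
    have hf : IsClosed (T ∩ f μ k c ⁻¹' Ici 0) := ContinuousOn.preimage_isClosed_of_isClosed
      (fun z hz => (contDiffAt_f (hTpos z hz)).continuousAt.continuousWithinAt) hTc isClosed_Ici
    have hQ : IsClosed (T ∩ Q μ k c ⁻¹' {mass μ k ^ 2 / 2}) :=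
      ContinuousOn.preimage_isClosed_of_isClosed
      (fun z hz => (contDiffAt_Q (hTpos z hz)).continuousAt.continuousWithinAt) hTc isClosed_singleton
    have h1 : IsClosed {z : Phase | ‖z.1‖ = 1} := isClosed_eq continuous_fst.norm continuous_const
    have h2 : IsClosed {z : Phase | inner ℝ z.1 z.2 = (0 : ℝ)} :=
      isClosed_eq (continuous_fst.inner continuous_snd) continuous_const
    have h3 : IsClosed {z : Phase | ‖relPos z‖ ≤ R} :=
      isClosed_le contDiff_relPos.continuous.norm continuous_const
    refine cast (congrArg IsClosed (Set.ext fun z => ?_).symm)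
      (((hf.inter hQ).inter (h1.inter h2)).inter h3)
    constructor
    · rintro ⟨⟨⟨⟨a1, a2⟩, a3, a4⟩, a5⟩, a6, a7⟩
      exact ⟨⟨⟨⟨a7, a5.le⟩, a7, a4⟩, a1, a2⟩, a6⟩
    · rintro ⟨⟨⟨⟨a7, a5⟩, -, a4⟩, a1, a2⟩, a6⟩
      refine ⟨⟨⟨⟨a1, a2⟩, hTpos z a7, a4⟩, lt_of_le_of_ne a5 fun h => ?_⟩, a6, a7⟩
      have h4 : Q μ k c z = mass μ k ^ 2 / 2 := a4
      rw [Q, ← h] at h4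
      have : 0 < mass μ k ^ 2 := by positivity
      norm_num at h4
      linarith
  · refine (Metric.isBounded_closedBall (x := (0 : Phase)) (r := max 1 (2 * (mass μ k
      + R * (|c + 1 / 2| + mass μ k.other / w₀) + (2 * R + |coord μ k|) ^ 2 * R)))).subset ?_
    intro z hz
    rw [mem_closedBall_zero_iff, Prod.norm_def]
    exact max_le_max hz.1.1.1.1.le (norm_snd_le hg hg' hw₀ hR hz)

/-! ### Hill's region -/

/-- The effective potential of a unit mass, as a function of the distance. -/
def phi (x : ℝ) : ℝ := 1 / x + x ^ 2 / 2

lemma phi_tangent {x y : ℝ} (hx : 0 < x) (hy : 0 < y) :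
    phi x + (x - 1 / x ^ 2) * (y - x) ≤ phi y := by
  have h : phi y - (phi x + (x - 1 / x ^ 2) * (y - x)) = (y - x) ^ 2 / (x ^ 2 * y) + (y - x) ^ 2 / 2 := by
    unfold phi; field_simp; ring
  have : 0 ≤ (y - x) ^ 2 / (x ^ 2 * y) + (y - x) ^ 2 / 2 := by positivity
  linarith

lemma phi_ge {x : ℝ} (hx : 0 < x) : 3 / 2 ≤ phi x := by
  have := phi_tangent one_pos hx
  norm_num [phi] at this ⊢
  linarith

lemma phi_convex {x y t : ℝ} (hx : 0 < x) (hy : 0 < y) (h0 : 0 ≤ t) (h1 : t ≤ 1) :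
    phi ((1 - t) * x + t * y) ≤ (1 - t) * phi x + t * phi y := by
  have hm : 0 < (1 - t) * x + t * y := by
    rcases h0.eq_or_lt with rfl | h0
    · simpa using hx
    · have := mul_pos h0 hy
      have := mul_nonneg (sub_nonneg.2 h1) hx.le
      linarith
  have a := mul_le_mul_of_nonneg_left (phi_tangent hm hx) (sub_nonneg.2 h1)
  have b := mul_le_mul_of_nonneg_left (phi_tangent hm hy) h0
  linear_combination a + b

/-- The function `phi` decreases up to `1` and increases afterwards, and it is steeper on the left.
So its maximum over `[1 - r, 1 + r]` is at the left end; the factored difference shows the sign. -/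
lemma phi_le_of_mem {r W : ℝ} (h0 : 0 < r) (h1 : r < 1) (hW : 1 - r ≤ W) (hW' : W ≤ 1 + r) :
    phi W ≤ phi (1 - r) := by
  have hr : 0 < 1 - r := by linarith
  have hW0 : 0 < W := by linarith
  have h : phi (1 - r) - phi W
      = (W - (1 - r)) * (2 - W * (1 - r) * (W + (1 - r))) / (2 * W * (1 - r)) := by
    unfold phi; field_simp; ring
  have h2 : 0 ≤ 2 - W * (1 - r) * (W + (1 - r)) := by
    have : W * (1 - r) * (W + (1 - r)) ≤ (1 + r) * (1 - r) * ((1 + r) + (1 - r)) := by gcongr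
    nlinarith
  have : 0 ≤ (W - (1 - r)) * (2 - W * (1 - r) * (W + (1 - r))) / (2 * W * (1 - r)) :=
    div_nonneg (mul_nonneg (by linarith) h2) (by positivity)
  linarith

lemma phi_add_lt {x : ℝ} (h0 : 0 < x) (h1 : x < 1) : phi (1 + x) < phi (1 - x) := by
  have hx : 0 < 1 - x := by linarith
  have h : phi (1 - x) - phi (1 + x) = 2 * x ^ 3 / ((1 - x) * (1 + x)) := by
    unfold phi; field_simp; ring
  have : 0 < 2 * x ^ 3 / ((1 - x) * (1 + x)) := by positivity
  linarith

lemma mass_add (μ : ℝ) (k : Primary) : mass μ k + mass μ k.other = 1 := by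
  cases k <;> simp [mass, Primary.other]

lemma other_other (k : Primary) : k.other.other = k := by cases k <;> rfl

lemma center_of_mass (μ : ℝ) (k : Primary) :
    mass μ k * coord μ k + mass μ k.other * coord μ k.other = 0 := by
  cases k <;> simp [mass, Primary.other, coord] <;> ring

lemma sq_coord_sub (μ : ℝ) (k : Primary) : (coord μ k - coord μ k.other) ^ 2 = 1 := by
  cases k <;> simp [Primary.other, coord]

lemma abs_coord_sub (μ : ℝ) (k : Primary) : |coord μ k - coord μ k.other| = 1 := by
  rw [← sq_eq_sq₀ (abs_nonneg _) zero_le_one, sq_abs, sq_coord_sub, one_pow]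

lemma norm_pos_sub (μ : ℝ) (k : Primary) : ‖pos μ k - pos μ k.other‖ = 1 := by
  rw [← sq_eq_sq₀ (norm_nonneg _) zero_le_one, normSq_E3, one_pow, ← sq_coord_sub μ k]
  simp [pos]

/-- Leibniz's formula for the moment of inertia: the origin is the centre of mass, and the primaries
are at distance `1`. -/
lemma normSq_position (μ : ℝ) (k : Primary) (q : E3) :
    ‖q‖ ^ 2 = mass μ k * ‖q - pos μ k‖ ^ 2 + mass μ k.other * ‖q - pos μ k.other‖ ^ 2
      - mass μ k * mass μ k.other := by
  simp only [normSq_E3]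
  cases k <;> simp [mass, Primary.other, coord, pos] <;> ring

/-- The negative of the effective potential on the plane, in bipolar coordinates. -/
def hill (μ : ℝ) (k : Primary) (r W : ℝ) : ℝ :=
  mass μ k * phi r + mass μ k.other * phi W - mass μ k * mass μ k.other / 2

/-- Completing squares, the kinetic and rotational terms are `½|p + rot q|² - ½(q₁² + q₂²)`.
Dropping the first summand and adding `-½ q₃²` leaves a function of the two distances only. -/
lemma neg_hill_le_H (μ : ℝ) (k : Primary) (q p : E3) :
    -hill μ k ‖q - pos μ k‖ ‖q - pos μ k.other‖ ≤ H μ (q, p) := by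
  rw [H_eq μ k]
  have h1 := normSq_position μ k q
  rw [normSq_E3 q] at h1
  rw [hill, phi, phi, normSq_E3 p]
  simp only
  have e : ∀ m x : ℝ, m / x = m * (1 / x) := fun m x => by ring
  rw [e (mass μ k), e (mass μ k.other)]
  nlinarith [sq_nonneg (p 0 + q 1), sq_nonneg (p 1 - q 0), sq_nonneg (p 2), sq_nonneg (q 2)]

/-- Relative equilibria on the line through the primaries. -/
lemma collinear_isLagrangePoint {μ : ℝ} (k : Primary) {x : ℝ} (h1 : x - coord μ k ≠ 0)
    (h2 : x - coord μ k.other ≠ 0)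
    (h : mass μ k * (x - coord μ k) / |x - coord μ k| ^ 3
      + mass μ k.other * (x - coord μ k.other) / |x - coord μ k.other| ^ 3
      = mass μ k * (x - coord μ k) + mass μ k.other * (x - coord μ k.other)) :
    ∃ y, IsLagrangePoint μ y ∧ H μ y = -hill μ k |x - coord μ k| |x - coord μ k.other| := by
  have hn : ∀ j : Primary, ‖(!₂[x, 0, 0] : E3) - pos μ j‖ = |x - coord μ j| := fun j => by
    rw [← sq_eq_sq₀ (norm_nonneg _) (abs_nonneg _), normSq_E3, sq_abs]
    simp [pos]
  have hx : mass μ k * (x - coord μ k) + mass μ k.other * (x - coord μ k.other) = x := by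
    linear_combination x * mass_add μ k - center_of_mass μ k
  rw [hx] at h
  refine ⟨(!₂[x, 0, 0], !₂[0, x, 0]), isLagrangePoint_of_grad k ?_ ?_ ?_ ?_, ?_⟩
  · rw [← sub_ne_zero, ← norm_ne_zero_iff, hn]; exact abs_ne_zero.2 h1
  · rw [← sub_ne_zero, ← norm_ne_zero_iff, hn]; exact abs_ne_zero.2 h2
  · ext i; fin_cases i <;> simp [rot]
  · rw [hn, hn]
    ext i
    fin_cases i
    · simp [rot, pos]
      linear_combination h
    · simp [rot, pos]
    · simp [rot, pos]
  · have h3 := normSq_position μ k !₂[x, 0, 0]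
    rw [hn, hn, normSq_E3] at h3
    rw [H_eq μ k, hn, hn, normSq_E3]
    simp [hill, phi] at h3 ⊢
    have e : ∀ m y : ℝ, m / y = m * y⁻¹ := fun m y => div_eq_mul_inv m y
    rw [e (mass μ k) |x - coord μ k|, e (mass μ k.other) |x - coord μ k.other|]
    linarith

/-- A Lagrange point between the primaries. -/
lemma exists_inner_point {μ : ℝ} (k : Primary) (hg : 0 < mass μ k) (hg' : 0 < mass μ k.other) :
    ∃ r, 0 < r ∧ r < 1 ∧ ∃ y, IsLagrangePoint μ y ∧ H μ y = -hill μ k r (1 - r) := by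
  set g := mass μ k
  set g' := mass μ k.other
  -- Euler's quintic: the equilibrium condition cleared of denominators. It equals `-g` at `0` and
  -- `g'` at `1`.
  obtain ⟨r, ⟨hr0, hr1⟩, hr⟩ : ∃ r ∈ Ioo (0 : ℝ) 1,
      g * (r ^ 3 - 1) * (1 - r) ^ 2 - g' * ((1 - r) ^ 3 - 1) * r ^ 2 = 0 := by
    have hc : Continuous fun r : ℝ =>
        g * (r ^ 3 - 1) * (1 - r) ^ 2 - g' * ((1 - r) ^ 3 - 1) * r ^ 2 := by fun_prop
    obtain ⟨r, hr, hr'⟩ := intermediate_value_Ioo zero_le_one hc.continuousOn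
      (show (0 : ℝ) ∈ Ioo _ _ by norm_num; exact ⟨hg, hg'⟩)
    exact ⟨r, hr, hr'⟩
  refine ⟨r, hr0, hr1, ?_⟩
  set σ := coord μ k.other - coord μ k with hσ
  have hσ2 : σ ^ 2 = 1 := by rw [← sq_coord_sub μ k]; ring
  have hσa : |σ| = 1 := by rw [hσ, abs_sub_comm]; exact abs_coord_sub μ k
  have hσ0 : σ ≠ 0 := by rintro h; simp [h] at hσ2
  have e1 : coord μ k + σ * r - coord μ k = σ * r := by ring
  have e2 : coord μ k + σ * r - coord μ k.other = -(σ * (1 - r)) := by rw [hσ]; ring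
  have hr1' : 0 < 1 - r := by linarith
  have a1 : |σ * r| = r := by rw [abs_mul, hσa, one_mul, abs_of_pos hr0]
  have a2 : |-(σ * (1 - r))| = 1 - r := by rw [abs_neg, abs_mul, hσa, one_mul, abs_of_pos hr1']
  have := collinear_isLagrangePoint (μ := μ) k (x := coord μ k + σ * r)
    (by rw [e1]; positivity) (by rw [e2]; exact neg_ne_zero.2 (by positivity))
    (by
      rw [e1, e2, a1, a2]
      field_simp
      linear_combination -hr)
  rwa [e1, e2, a1, a2] at this

/-- A Lagrange point beyond the other primary. -/
lemma exists_outer_point {μ : ℝ} (k : Primary) (hg : 0 < mass μ k) (hg' : 0 < mass μ k.other) :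
    ∃ x, 0 < x ∧ x < 1 ∧
      mass μ k * ((1 + x) - 1 / (1 + x) ^ 2) + mass μ k.other * (x - 1 / x ^ 2) = 0 ∧
      ∃ y, IsLagrangePoint μ y ∧ H μ y = -hill μ k (1 + x) x := by
  set g := mass μ k
  set g' := mass μ k.other
  -- The quintic of the outer point equals `-g'` at `0` and `7g` at `1`.
  obtain ⟨x, ⟨hx0, hx1⟩, hx⟩ : ∃ x ∈ Ioo (0 : ℝ) 1,
      g * ((1 + x) ^ 3 - 1) * x ^ 2 + g' * (x ^ 3 - 1) * (1 + x) ^ 2 = 0 := by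
    have hc : Continuous fun x : ℝ =>
        g * ((1 + x) ^ 3 - 1) * x ^ 2 + g' * (x ^ 3 - 1) * (1 + x) ^ 2 := by fun_prop
    obtain ⟨x, hx, hx'⟩ := intermediate_value_Ioo zero_le_one hc.continuousOn
      (show (0 : ℝ) ∈ Ioo _ _ by norm_num; exact ⟨hg', hg⟩)
    exact ⟨x, hx, hx'⟩
  refine ⟨x, hx0, hx1, by field_simp; linear_combination hx, ?_⟩
  set σ := coord μ k.other - coord μ k with hσ
  have hσ2 : σ ^ 2 = 1 := by rw [← sq_coord_sub μ k]; ring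
  have hσa : |σ| = 1 := by rw [hσ, abs_sub_comm]; exact abs_coord_sub μ k
  have hσ0 : σ ≠ 0 := by rintro h; simp [h] at hσ2
  have e1 : coord μ k + σ * (1 + x) - coord μ k = σ * (1 + x) := by ring
  have e2 : coord μ k + σ * (1 + x) - coord μ k.other = σ * x := by rw [hσ]; ring
  have hx1' : 0 < 1 + x := by linarith
  have a1 : |σ * (1 + x)| = 1 + x := by rw [abs_mul, hσa, one_mul, abs_of_pos hx1']
  have a2 : |σ * x| = x := by rw [abs_mul, hσa, one_mul, abs_of_pos hx0]
  have := collinear_isLagrangePoint (μ := μ) k (x := coord μ k + σ * (1 + x))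
    (by rw [e1]; positivity) (by rw [e2]; positivity)
    (by
      rw [e1, e2, a1, a2]
      field_simp
      linear_combination -hx)
  rwa [e1, e2, a1, a2] at this

/-- Below the first critical value, a sphere around the primary lies outside of Hill's region. -/
lemma exists_sphere_barrier {μ c : ℝ} {L₁ : E3 × E3} (hL₁ : IsFirstLagrangePoint μ L₁)
    (hc : c < H μ L₁) (k : Primary) (hg : 0 < mass μ k) (hg' : 0 ≤ mass μ k.other) :
    ∃ r, 0 < r ∧ r < 1 ∧ hill μ k r (1 - r) < -c := by
  rcases hg'.eq_or_lt with hg' | hg'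
  · have hm : mass μ k = 1 := by have := mass_add μ k; linarith
    set σ := coord μ k.other - coord μ k with hσ
    have hσa : |σ| = 1 := by rw [hσ, abs_sub_comm]; exact abs_coord_sub μ k
    have hσ0 : σ ≠ 0 := by rintro h; simp [h] at hσa
    -- For `g' = 0` all points of the unit circle around the primary are equilibria, except the
    -- other primary. The one opposite to it is taken, at distance `2` from it.
    obtain ⟨y, hy, hHy⟩ := collinear_isLagrangePoint (μ := μ) k (x := coord μ k - σ)
      (by simpa using hσ0)
      (by rw [show coord μ k - σ - coord μ k.other = -2 * σ by rw [hσ]; ring]; simpa using hσ0)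
      (by
        rw [← hg', show coord μ k - σ - coord μ k = -σ by ring, abs_neg, hσa]
        ring)
    have h1 := hL₁.2 y hy
    rw [hHy, hill, ← hg', hm, show coord μ k - σ - coord μ k = -σ by ring, abs_neg, hσa] at h1
    have h2 : phi 1 < -c := by simp at h1; linarith
    have hcont : ContinuousAt phi 1 :=
      (continuousAt_const.div continuousAt_id one_ne_zero).add ((continuousAt_id.pow 2).div_const 2)
    -- The sphere of radius `1` contains the massless primary, where the coordinates are singular,
    -- so the radius is taken slightly smaller.
    have h3 : ∀ᶠ r in 𝓝[<] (1 : ℝ), phi r < -c :=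
      (hcont.eventually (gt_mem_nhds h2)).filter_mono nhdsWithin_le_nhds
    have h4 : ∀ᶠ r in 𝓝[<] (1 : ℝ), r ∈ Ioo (0 : ℝ) 1 := Ioo_mem_nhdsLT zero_lt_one
    obtain ⟨r, hr, hr0, hr1⟩ := (h3.and h4).exists
    exact ⟨r, hr0, hr1, by simpa [hill, ← hg', hm] using hr⟩
  · obtain ⟨r, h0, h1, y, hy, hHy⟩ := exists_inner_point k hg hg'
    exact ⟨r, h0, h1, by have := hL₁.2 y hy; linarith⟩

/-- The value of `H` at the outer point is strictly above the one at the inner point, hence not the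
lowest, hence at least `H(L₂) > c`. Indeed `s ↦ hill (1 + s) s` is convex with its minimum at the
outer point, and reflecting the inner point in the other primary (`s = 1 - r`) already lowers
`hill`, by `phi_add_lt`. -/
lemma exists_outer_barrier {μ c : ℝ} {L₁ L₂ : E3 × E3} (hL₁ : IsFirstLagrangePoint μ L₁)
    (hL₂ : IsSecondLagrangePoint μ L₁ L₂) (hc : c < H μ L₂) (k : Primary)
    (hg : 0 < mass μ k) (hg' : 0 < mass μ k.other) :
    ∃ x, 0 < x ∧ x < 1 ∧ hill μ k (1 + x) x < -c := by
  obtain ⟨x, hx0, hx1, hx, y, hy, hHy⟩ := exists_outer_point k hg hg'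
  obtain ⟨r, hr0, hr1, y₁, hy₁, hHy₁⟩ := exists_inner_point k hg hg'
  refine ⟨x, hx0, hx1, ?_⟩
  have h1 := hL₁.2 y₁ hy₁
  have t1 := mul_le_mul_of_nonneg_left
    (phi_tangent (x := 1 + x) (y := 1 + (1 - r)) (by linarith) (by linarith)) hg.le
  have t2 := mul_le_mul_of_nonneg_left
    (phi_tangent (x := x) (y := 1 - r) (by linarith) (by linarith)) hg'.le
  have t3 := mul_lt_mul_of_pos_left
    (phi_add_lt (x := 1 - r) (by linarith) (by linarith)) hg
  have t4 : hill μ k (1 + x) x < hill μ k r (1 - r) := by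
    rw [sub_sub_cancel] at t3
    unfold hill
    have : (1 - r - x) * (mass μ k * ((1 + x) - 1 / (1 + x) ^ 2)
      + mass μ k.other * (x - 1 / x ^ 2)) = 0 := by rw [hx, mul_zero]
    linarith
  have h2 := hL₂.2.2 y hy (by linarith)
  linarith

/-- As `phi ≥ 3/2`, `g + g' = 1` and `g g' ≤ 1/4`, one has `hill ≥ 3/2 - 1/8`. This supplies the
inequality `c + g' < 1/2` needed at collisions. -/
lemma c_lt_of_hill {μ c : ℝ} {k : Primary} {r W : ℝ} (hg : 0 ≤ mass μ k)
    (hg' : 0 ≤ mass μ k.other) (hr : 0 < r) (hW : 0 < W) (h : hill μ k r W < -c) :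
    c < -(11 / 8) := by
  have h1 := mul_le_mul_of_nonneg_left (phi_ge hr) hg
  have h2 := mul_le_mul_of_nonneg_left (phi_ge hW) hg'
  have h3 := mass_add μ k
  unfold hill at h
  nlinarith [sq_nonneg (mass μ k - mass μ k.other)]

lemma triangle_le {μ : ℝ} (k : Primary) (q : E3) :
    1 ≤ ‖q - pos μ k‖ + ‖q - pos μ k.other‖ ∧ ‖q - pos μ k.other‖ ≤ 1 + ‖q - pos μ k‖ ∧
      ‖q - pos μ k‖ ≤ 1 + ‖q - pos μ k.other‖ := by
  have h := norm_pos_sub μ k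
  refine ⟨?_, ?_, ?_⟩
  · rw [← h, norm_sub_rev q (pos μ k)]
    exact norm_sub_le_norm_sub_add_norm_sub _ q _
  · rw [← h, add_comm]
    exact norm_sub_le_norm_sub_add_norm_sub q (pos μ k) _
  · rw [← h, norm_sub_rev (pos μ k), add_comm]
    exact norm_sub_le_norm_sub_add_norm_sub q (pos μ k.other) _

lemma norm_ne_of_sphere_barrier {μ c r : ℝ} {k : Primary}
    (hg' : 0 ≤ mass μ k.other) (h0 : 0 < r) (h1 : r < 1) (h : hill μ k r (1 - r) < -c)
    {q p : E3} (hH : H μ (q, p) = c) : ‖q - pos μ k‖ ≠ r := by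
  intro hr
  have h2 := neg_hill_le_H μ k q p
  obtain ⟨t1, t2, -⟩ := triangle_le (μ := μ) k q
  rw [hr] at h2 t1 t2
  have h3 := mul_le_mul_of_nonneg_left
    (phi_le_of_mem h0 h1 (W := ‖q - pos μ k.other‖) (by linarith) (by linarith)) hg'
  unfold hill at h h2
  linarith

/-- A linear function of the distances to the primaries: the Cartesian oval `barrier = 1 + x + y`
separates Hill's region from infinity. -/
def barrier (μ : ℝ) (k : Primary) (x y : ℝ) (q : E3) : ℝ :=
  (1 + y - x) * ‖q - pos μ k‖ + (1 + x - y) * ‖q - pos μ k.other‖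

lemma hill_other (μ : ℝ) (k : Primary) (r W : ℝ) : hill μ k.other W r = hill μ k r W := by
  rw [hill, hill, other_other]; ring

/-- In the plane of the two distances the oval is a line through `(1 + x, x)` and `(y, 1 + y)`. The
triangle inequality cuts out the segment between these points, and `hill` is convex, so `hill < -c`
on all of it. -/
lemma barrier_ne {μ c x y : ℝ} {k : Primary} (hg : 0 ≤ mass μ k) (hg' : 0 ≤ mass μ k.other)
    (hx : 0 < x) (hy : 0 < y) (h1 : hill μ k (1 + x) x < -c) (h2 : hill μ k y (1 + y) < -c)
    {q p : E3} (hH : H μ (q, p) = c) : barrier μ k x y q ≠ 1 + x + y := by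
  intro hb
  have h3 := neg_hill_le_H μ k q p
  obtain ⟨-, t1, t2⟩ := triangle_le (μ := μ) k q
  unfold barrier at hb
  set r := ‖q - pos μ k‖
  set W := ‖q - pos μ k.other‖
  obtain ⟨t, ht⟩ : ∃ t, r - W = 1 - 2 * t := ⟨(1 - (r - W)) / 2, by ring⟩
  have ht0 : 0 ≤ t := by linarith
  have ht1 : t ≤ 1 := by linarith
  have hW : W = (1 - t) * x + t * (1 + y) := by
    have hr : r = W + 1 - 2 * t := by linarith
    rw [hr] at hb
    linarith
  have hr : r = (1 - t) * (1 + x) + t * y := by linarith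
  have c1 := mul_le_mul_of_nonneg_left
    (phi_convex (x := 1 + x) (y := y) (by linarith) hy ht0 ht1) hg
  have c2 := mul_le_mul_of_nonneg_left
    (phi_convex (x := x) (y := 1 + y) hx (by linarith) ht0 ht1) hg'
  rw [← hr] at c1
  rw [← hW] at c2
  have e : hill μ k r W ≤ (1 - t) * hill μ k (1 + x) x + t * hill μ k y (1 + y) := by
    unfold hill; linarith
  have e2 : (1 - t) * hill μ k (1 + x) x + t * hill μ k y (1 + y) < -c := by
    rcases ht0.eq_or_lt with rfl | ht0
    · simpa using h1
    · have a1 := mul_lt_mul_of_pos_left h2 ht0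
      have a2 := mul_le_mul_of_nonneg_left h1.le (sub_nonneg.2 ht1)
      linarith
  linarith

/-! ### The function defining the open book -/

/-- `|q - a'|⁴ + |q - a|⁴`. -/
def weight (μ : ℝ) (k : Primary) (z : Phase) : ℝ :=
  (‖offset μ k z‖ ^ 2) ^ 2 + (‖relPos z‖ ^ 2) ^ 2

/-- The correction which makes the real part of `bookMap` the same at both primaries. -/
def shear (μ : ℝ) (k : Primary) (z : Phase) : ℝ :=
  (coord μ k.other - coord μ k) * ((1 - z.1 0) ^ 2 * ((‖z.2‖ ^ 2) ^ 2 * z.1 1))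

/-- The function whose argument increases along the flow: a perturbation of `(1 - ξ₀) q₃ + i ξ₃`,
a multiple of `q₃ - i p₃` away from collisions, by a multiple of `η₃` near collisions. -/
def bookMap (μ : ℝ) (k : Primary) (ε : ℝ) (z : Phase) : ℂ :=
  (((1 - z.1 0) * relPos z 2 + ε * (weight μ k z * z.2 3 + shear μ k z * z.1 3) : ℝ) : ℂ)
    + ((z.1 3 : ℝ) : ℂ) * Complex.I

lemma contDiff_weight (μ : ℝ) (k : Primary) : ContDiff ℝ ∞ (weight μ k) :=
  (((contDiff_offset μ k).norm_sq ℝ).pow 2).add ((contDiff_relPos.norm_sq ℝ).pow 2)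

lemma contDiff_shear (μ : ℝ) (k : Primary) : ContDiff ℝ ∞ (shear μ k) :=
  contDiff_const.mul (((contDiff_const.sub (contDiff_coord₁ 0)).pow 2).mul
    (((contDiff_snd.norm_sq ℝ).pow 2).mul (contDiff_coord₁ 1)))

lemma contDiff_bookMap (μ : ℝ) (k : Primary) (ε : ℝ) : ContDiff ℝ ∞ (bookMap μ k ε) := by
  have h1 : ContDiff ℝ ∞ (fun z : Phase => (1 - z.1 0) * relPos z 2
      + ε * (weight μ k z * z.2 3 + shear μ k z * z.1 3)) :=
    ((contDiff_const.sub (contDiff_coord₁ 0)).mul (contDiff_euclidean.1 contDiff_relPos 2)).add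
      (contDiff_const.mul (((contDiff_weight μ k).mul (contDiff_coord₂ 3)).add
        ((contDiff_shear μ k).mul (contDiff_coord₁ 3))))
  exact (Complex.ofRealCLM.contDiff.comp h1).add
    ((Complex.ofRealCLM.contDiff.comp (contDiff_coord₁ 3)).mul contDiff_const)

lemma fderiv_bookMap (μ : ℝ) (k : Primary) (ε : ℝ) (z v : Phase) :
    fderiv ℝ (bookMap μ k ε) z v
      = ((-v.1 0 * relPos z 2 + (1 - z.1 0) * relPosDeriv z v 2
        + ε * (fderiv ℝ (weight μ k) z v * z.2 3 + weight μ k z * v.2 3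
          + (fderiv ℝ (shear μ k) z v * z.1 3 + shear μ k z * v.1 3)) : ℝ) : ℂ)
        + ((v.1 3 : ℝ) : ℂ) * Complex.I := by
  obtain ⟨L, hL, hLv⟩ := exists_hasFDerivAt_relPos z
  have X := fun i => hasFDerivAt_coord₁ i z
  have Y := fun i => hasFDerivAt_coord₂ i z
  have hW : HasFDerivAt (weight μ k) _ z :=
    ((contDiff_weight μ k).differentiable (by simp) z).hasFDerivAt
  have hS : HasFDerivAt (shear μ k) _ z :=
    ((contDiff_shear μ k).differentiable (by simp) z).hasFDerivAt
  have hL2 : HasFDerivAt (fun w => relPos w 2) ((EuclideanSpace.proj 2 : E3 →L[ℝ] ℝ).comp L) z :=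
    (EuclideanSpace.proj 2 : E3 →L[ℝ] ℝ).hasFDerivAt.comp z hL
  have h1 := (((X 0).const_sub 1).mul hL2).add
    (((hW.mul (Y 3)).add (hS.mul (X 3))).const_mul ε)
  have h2 : HasFDerivAt (bookMap μ k ε) _ z := (Complex.ofRealCLM.hasFDerivAt.comp z h1).add
    ((Complex.ofRealCLM.hasFDerivAt.comp z (X 3)).mul_const Complex.I)
  rw [h2.fderiv]
  apply Complex.ext
  · simp [hLv]
    ring
  · simp [hLv]

/-! ### The rotation of the book map as a quadratic form -/

section Forms

variable {μ : ℝ} {k : Primary} {c ε : ℝ} {z : Phase}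

lemma weight_pos (hz : position μ k z ≠ pos μ k.other) : 0 < weight μ k z := by
  have := norm_pos_iff.2 (offset_ne_zero.2 hz)
  unfold weight
  positivity

/-- For `ξ₃ = 0` the real part is `((1 - ξ₀)² + ε weight) η₃`. The perturbation keeps the factor
positive at collisions. -/
lemma bookMap_eq_zero_iff (hε : 0 < ε) (hz : position μ k z ≠ pos μ k.other) :
    bookMap μ k ε z = 0 ↔ z.1 3 = 0 ∧ z.2 3 = 0 := by
  have hw := weight_pos hz
  constructor
  · intro h
    have him := congrArg Complex.im h
    have hre := congrArg Complex.re h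
    simp [bookMap] at him hre
    refine ⟨him, ?_⟩
    rw [him] at hre
    have : ((1 - z.1 0) ^ 2 + ε * weight μ k z) * z.2 3 = 0 := by linear_combination hre
    exact (mul_eq_zero.1 this).resolve_left (by positivity)
  · rintro ⟨h1, h2⟩
    simp [bookMap, h1, h2]

/-- At planar points `bookMap` is a submersion of the level set. -/
lemma exists_tangent_fderiv_bookMap (hε : 0 < ε) (hz : z ∈ level μ k c) (h1 : z.1 3 = 0)
    (h2 : z.2 3 = 0) (a : ℂ) :
    ∃ w ∈ tangentLevel μ k c z, fderiv ℝ (bookMap μ k ε) z w = a := by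
  have hw := weight_pos hz.2.1
  have hσ : 0 < (1 - z.1 0) ^ 2 + ε * weight μ k z := by positivity
  set σ := (1 - z.1 0) ^ 2 + ε * weight μ k z with hσdef
  set y := (a.re - ((1 - z.1 0) * z.2 0 + ε * shear μ k z) * a.im) / σ with hy
  -- At planar points vertical vectors are tangent to the level set, as `Q` is even under reflection
  -- in the plane. On them the derivative is triangular with diagonal entries `σ` and `1`.
  refine ⟨((!₂[0, 0, 0, a.im], !₂[0, 0, 0, y]) : Phase), ⟨⟨?_, ?_⟩, ?_⟩, ?_⟩
  · simp [inner_E4, h1]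
  · simp [inner_E4, h1, h2]
  · rw [(hasFDerivAt_Q c hz.2.1).fderiv]
    simp [inner_E4, gradFst, gradSnd, h1, h2]
  · rw [fderiv_bookMap]
    have hyσ : y * σ = a.re - ((1 - z.1 0) * z.2 0 + ε * shear μ k z) * a.im := by
      rw [hy]; field_simp
    apply Complex.ext
    · simp [relPosDeriv, vec, h1, h2]
      linear_combination hyσ
    · simp

/-! The third components of the vector field are linear in `(η₃, ξ₃)`; the coefficients: -/

/-- Coefficient of `η₃` in `ξ₃'`. -/
def coefDiag (μ : ℝ) (k : Primary) (c : ℝ) (z : Phase) : ℝ :=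
  f μ k c z ^ 2 + kap μ k c z * (1 - z.1 0) ^ 3 * pull μ k z

/-- Coefficient of `ξ₃` in `ξ₃'`, the negative of the coefficient of `η₃` in `η₃'`. -/
def coefMix (μ : ℝ) (k : Primary) (c : ℝ) (z : Phase) : ℝ :=
  kap μ k c z * (1 - z.1 0) * pull μ k z
    * ((1 - z.1 0) * z.2 0 - inner ℝ (offset μ k z) (vec z.1))

/-- Coefficient of `ξ₃` in `η₃'`. -/
def coefLow (μ : ℝ) (k : Primary) (c : ℝ) (z : Phase) : ℝ :=
  kap μ k c z * inner ℝ (gradFst μ k c z) z.1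
    - (f μ k c z ^ 2 * ‖z.2‖ ^ 2 + kap μ k c z * inner ℝ (gradSnd μ k z) z.2)
    - kap μ k c z * (1 - z.1 0) * pull μ k z * z.2 0 ^ 2

/-- The coefficients depend on the whole point `z`, so this is not a linearization: it makes every
quantity below a quadratic form in `(η₃, ξ₃)`, with coefficients that can be bounded by compactness.
-/
lemma field_three (hz : z ∈ TstarS3) :
    (field μ k c z).1 3 = coefDiag μ k c z * z.2 3 + coefMix μ k c z * z.1 3 ∧
      (field μ k c z).2 3 = -coefMix μ k c z * z.2 3 + coefLow μ k c z * z.1 3 := by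
  have hb : inner ℝ (gradSnd μ k z) z.1
      = (1 - z.1 0) * pull μ k z * inner ℝ (offset μ k z) (vec z.1) := by
    rw [inner_E4, inner_E3]; simp [gradSnd, inner_E3, vec]; ring
  have hb' : inner ℝ z.2 z.1 = (0 : ℝ) := by rw [real_inner_comm]; exact hz.2
  constructor
  · simp only [field, inner_add_left, inner_smul_left, hb, hb', conj_trivial, coefDiag, coefMix]
    simp [gradSnd]
    ring
  · simp only [field, inner_add_left, inner_smul_left, hb, hb', conj_trivial, coefMix, coefLow,
      real_inner_self_eq_norm_sq]
    simp [gradFst]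
    ring

lemma continuousAt_coefDiag (hz : position μ k z ≠ pos μ k.other) :
    ContinuousAt (coefDiag μ k c) z :=
  ((contDiffAt_f hz).continuousAt.pow 2).add (((contDiffAt_kap hz).continuousAt.mul
    ((continuousAt_const.sub (contDiff_coord₁ 0).continuous.continuousAt).pow 3)).mul
    (contDiffAt_pull hz).continuousAt)

lemma continuousAt_coefMix (hz : position μ k z ≠ pos μ k.other) :
    ContinuousAt (coefMix μ k c) z := by
  have hs : ContinuousAt (fun z : Phase => 1 - z.1 0) z :=
    continuousAt_const.sub (contDiff_coord₁ 0).continuous.continuousAt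
  have hi : ContinuousAt (fun z : Phase => (inner ℝ (offset μ k z) (vec z.1) : ℝ)) z :=
    ((contDiff_offset μ k).inner ℝ (contDiff_vec.comp contDiff_fst)).continuous.continuousAt
  exact (((contDiffAt_kap hz).continuousAt.mul hs).mul (contDiffAt_pull hz).continuousAt).mul
    ((hs.mul (contDiff_coord₂ 0).continuous.continuousAt).sub hi)

lemma continuousAt_coefLow (hz : position μ k z ≠ pos μ k.other) :
    ContinuousAt (coefLow μ k c) z := by
  have hs : ContinuousAt (fun z : Phase => 1 - z.1 0) z :=
    continuousAt_const.sub (contDiff_coord₁ 0).continuous.continuousAt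
  have hk := (contDiffAt_kap (c := c) hz).continuousAt
  exact ((hk.mul ((contDiffAt_gradFst hz).continuousAt.inner continuousAt_fst)).sub
    ((((contDiffAt_f hz).continuousAt.pow 2).mul (continuousAt_snd.norm.pow 2)).add
      (hk.mul ((contDiffAt_gradSnd hz).continuousAt.inner continuousAt_snd)))).sub
    (((hk.mul hs).mul (contDiffAt_pull hz).continuousAt).mul
      ((contDiff_coord₂ 0).continuous.continuousAt.pow 2))

/-- The rate of change of a function along the Hamiltonian vector field. -/
def rate (μ : ℝ) (k : Primary) (c : ℝ) (u : Phase → ℝ) (z : Phase) : ℝ :=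
  fderiv ℝ u z (field μ k c z)

lemma continuousAt_rate {u : Phase → ℝ} (hu : ContDiff ℝ ∞ u)
    (hz : position μ k z ≠ pos μ k.other) : ContinuousAt (rate μ k c u) z :=
  (hu.continuous_fderiv (by simp)).continuousAt.clm_apply (contDiffAt_field hz).continuousAt

lemma relPos_collision (hz : z ∈ TstarS3) (h : z.1 0 = 1) : relPos z = 0 := by
  obtain ⟨-, -, -, h0⟩ := collision_coords hz h
  ext i; fin_cases i <;> simp [h, h0]

lemma norm_offset_collision (hz : z ∈ TstarS3) (h : z.1 0 = 1) : ‖offset μ k z‖ = 1 := by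
  rw [offset, position, relPos_collision hz h, add_zero, norm_pos_sub]

/-- `weight` depends only on the position, which has zero velocity at a collision in the regularized
time. -/
lemma rate_weight_collision (hz : z ∈ TstarS3) (h : z.1 0 = 1) :
    rate μ k c (weight μ k) z = 0 := by
  obtain ⟨L, hL, hLv⟩ := exists_hasFDerivAt_relPos z
  have hoff : HasFDerivAt (offset μ k) L z := (hL.const_add (pos μ k)).sub_const _
  have hW : HasFDerivAt (weight μ k) _ z := (hoff.norm_sq.pow 2).add (hL.norm_sq.pow 2)
  have h0 : relPosDeriv z (field μ k c z) = 0 := by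
    rw [field_position μ k c hz, h]
    obtain ⟨h1, h2, h3, -⟩ := collision_coords hz h
    ext i; fin_cases i <;> simp [vec, h1, h2, h3]
  rw [rate, hW.fderiv]
  simp [hLv, h0]

/-- The factor `(1 - ξ₀)²` vanishes to second order. -/
lemma rate_shear_collision (h : z.1 0 = 1) : rate μ k c (shear μ k) z = 0 := by
  have hM : DifferentiableAt ℝ (fun z : Phase => (‖z.2‖ ^ 2) ^ 2 * z.1 1) z :=
    ((((contDiff_snd (𝕜 := ℝ) (n := ∞) (E := E4) (F := E4)).norm_sq ℝ).pow 2).mul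
      (contDiff_coord₁ 1)).differentiable (by simp) z
  have hS : HasFDerivAt (shear μ k) _ z :=
    ((((hasFDerivAt_coord₁ 0 z).const_sub 1).pow 2).mul hM.hasFDerivAt).const_mul
      (coord μ k.other - coord μ k)
  rw [rate, hS.fderiv]
  simp [h]

/-- The rotation of `(1 - ξ₀) q₃ + i ξ₃`, as a quadratic form in `(η₃, ξ₃)`. -/
def rotForm (μ : ℝ) (k : Primary) (c : ℝ) (z : Phase) (a b : ℝ) : ℝ :=
  coefDiag μ k c z * (z.2 0 * b + (1 - z.1 0) * a) ^ 2 + (1 - z.1 0) * kap μ k c z * b ^ 2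

/-- The contribution of the perturbation to the rotation. -/
def twistForm (μ : ℝ) (k : Primary) (c : ℝ) (z : Phase) (a b : ℝ) : ℝ :=
  weight μ k z * (a * (coefDiag μ k c z * a + coefMix μ k c z * b)
      - b * (-coefMix μ k c z * a + coefLow μ k c z * b))
    - rate μ k c (weight μ k) z * (a * b) - rate μ k c (shear μ k) z * b ^ 2

/-- The real part of `bookMap`, as a linear form in `(η₃, ξ₃)`. -/
def reForm (μ : ℝ) (k : Primary) (ε : ℝ) (z : Phase) (a b : ℝ) : ℝ :=
  (1 - z.1 0) * (z.2 0 * b + (1 - z.1 0) * a) + ε * (weight μ k z * a + shear μ k z * b)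

/-- The derivative of the real part of `bookMap`, as a linear form in `(η₃, ξ₃)`. -/
def reRateForm (μ : ℝ) (k : Primary) (c ε : ℝ) (z : Phase) (a b : ℝ) : ℝ :=
  -(field μ k c z).1 0 * (z.2 0 * b + (1 - z.1 0) * a) - (1 - z.1 0) * kap μ k c z * b
    + ε * (rate μ k c (weight μ k) z * a
      + weight μ k z * (-coefMix μ k c z * a + coefLow μ k c z * b)
      + (rate μ k c (shear μ k) z * b
        + shear μ k z * (coefDiag μ k c z * a + coefMix μ k c z * b)))

lemma bookMap_eq : bookMap μ k ε z
    = ((reForm μ k ε z (z.2 3) (z.1 3) : ℝ) : ℂ) + ((z.1 3 : ℝ) : ℂ) * Complex.I := by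
  simp only [bookMap, reForm, relPos_two]

lemma fderiv_bookMap_field (hz : z ∈ TstarS3) : fderiv ℝ (bookMap μ k ε) z (field μ k c z)
    = ((reRateForm μ k c ε z (z.2 3) (z.1 3) : ℝ) : ℂ)
      + ((coefDiag μ k c z * z.2 3 + coefMix μ k c z * z.1 3 : ℝ) : ℂ) * Complex.I := by
  obtain ⟨h1, h2⟩ := field_three (μ := μ) (k := k) (c := c) hz
  have h3 : relPosDeriv z (field μ k c z) 2 = -kap μ k c z * z.1 3 := by
    rw [field_position μ k c hz]; simp [vec, rot]
  rw [fderiv_bookMap, h1, h2, h3]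
  congr 2
  simp only [reRateForm, rate, relPos_two]
  ring

/-- The third component of the momentum equation expresses `(1 - ξ₀) ξ₃' + ξ₀' ξ₃` as `coefDiag`
times `q₃`. With it the mixed terms of the unperturbed part combine into the square in `rotForm`. -/
lemma im_bookMap (hz : z ∈ TstarS3) :
    (star (bookMap μ k ε z) * fderiv ℝ (bookMap μ k ε) z (field μ k c z)).im
      = rotForm μ k c z (z.2 3) (z.1 3) + ε * twistForm μ k c z (z.2 3) (z.1 3) := by
  have h := congrArg (fun x : E3 => x 2) (field_momentum μ k c hz)
  obtain ⟨h1, -⟩ := field_three (μ := μ) (k := k) (c := c) hz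
  simp only [PiLp.add_apply, PiLp.smul_apply, smul_eq_mul, offset_two, relPos_two] at h
  have e1 : vec (field μ k c z).1 2 = (field μ k c z).1 3 := rfl
  have e2 : vec z.1 2 = z.1 3 := rfl
  have e3 : rot (vec z.1) 2 = 0 := rfl
  rw [e1, e2, e3, h1] at h
  rw [fderiv_bookMap_field hz, bookMap_eq]
  simp only [Complex.star_def, map_add, map_mul, Complex.conj_ofReal, Complex.conj_I, Complex.mul_im,
    Complex.add_re, Complex.add_im, Complex.ofReal_re, Complex.ofReal_im, Complex.mul_re,
    Complex.I_re, Complex.I_im, Complex.neg_re, Complex.neg_im, mul_zero, mul_one,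
    add_zero, zero_add, sub_zero, neg_zero, zero_mul]
  rw [reForm, reRateForm, rotForm, twistForm]
  have hd : coefDiag μ k c z = f μ k c z ^ 2 + kap μ k c z * (1 - z.1 0) ^ 3 * pull μ k z := rfl
  linear_combination (z.2 0 * z.1 3 + (1 - z.1 0) * z.2 3) * h
    - (z.2 0 * z.1 3 + (1 - z.1 0) * z.2 3) ^ 2 * hd

lemma pull_nonneg (hg' : 0 ≤ mass μ k.other) : 0 ≤ pull μ k z := by
  unfold pull; positivity

lemma coefDiag_pos (hg : 0 < mass μ k) (hg' : 0 ≤ mass μ k.other) (hz : z ∈ sheet μ c k) :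
    0 < coefDiag μ k c z := by
  have h1 := kap_pos hg hz
  have h2 := one_sub_nonneg hz.1.1
  have h3 := pull_nonneg (z := z) hg'
  have h4 := hz.2
  unfold coefDiag
  positivity

lemma rotForm_nonneg (hg : 0 < mass μ k) (hg' : 0 ≤ mass μ k.other) (hz : z ∈ sheet μ c k)
    (a b : ℝ) : 0 ≤ rotForm μ k c z a b := by
  have h1 := kap_pos hg hz
  have h2 := one_sub_nonneg hz.1.1
  have h3 := coefDiag_pos hg hg' hz
  unfold rotForm
  positivity

/-- Away from collisions `rotForm` is definite, so its kernel is trivial. At a collision `weight =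
1`, both rates and `coefMix` vanish, and what remains is `a² + κ (1/2 - c - g') b²`. -/
lemma twistForm_pos (hg : 0 < mass μ k) (hg' : 0 ≤ mass μ k.other)
    (hc : c + mass μ k.other < 1 / 2) (hz : z ∈ sheet μ c k) {a b : ℝ} (hab : a ≠ 0 ∨ b ≠ 0)
    (h : rotForm μ k c z a b = 0) : 0 < twistForm μ k c z a b := by
  have h1 := kap_pos hg hz
  have h3 := coefDiag_pos hg hg' hz
  have hT := hz.1.1
  by_cases h0 : z.1 0 = 1
  · have hK : coefLow μ k c z = -kap μ k c z * (1 / 2 - c - mass μ k.other) := by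
      have hk : kap μ k c z = ‖z.2‖ ^ 2 := by rw [kap, f_collision hT h0, mul_one]
      obtain ⟨x1, x2, x3, y0⟩ := collision_coords hT h0
      have hgS : gradSnd μ k z = 0 := by
        ext i; fin_cases i <;> simp [gradSnd, h0]
      have hgF : inner ℝ (gradFst μ k c z) z.1 = -bracket μ k c z := by
        rw [inner_E4]; simp [gradFst, h0, x1, x2, x3]
      rw [coefLow, hgS, hgF, f_collision hT h0, hk, h0, bracket, norm_offset_collision hT h0, x1, x2]
      simp
      ring
    have hw : weight μ k z = 1 := by
      rw [weight, norm_offset_collision hT h0, relPos_collision hT h0]; simp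
    have hd : coefDiag μ k c z = 1 := by rw [coefDiag, f_collision hT h0, h0]; ring
    have hm : coefMix μ k c z = 0 := by rw [coefMix, h0]; ring
    rw [twistForm, hK, hw, hd, hm, rate_weight_collision hT h0, rate_shear_collision h0]
    have e : 0 < kap μ k c z * (1 / 2 - c - mass μ k.other) := mul_pos h1 (by linarith)
    have e2 : 0 < a ^ 2 + kap μ k c z * (1 / 2 - c - mass μ k.other) * b ^ 2 := by
      rcases hab with h | h
      · positivity
      · positivity
    linarith
  · exfalso
    have hs := one_sub_pos hT h0
    unfold rotForm at h
    have t1 : 0 ≤ coefDiag μ k c z * (z.2 0 * b + (1 - z.1 0) * a) ^ 2 := by positivity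
    have t2 : 0 ≤ (1 - z.1 0) * kap μ k c z * b ^ 2 := by positivity
    have hb : b = 0 := by
      have : (1 - z.1 0) * kap μ k c z * b ^ 2 = 0 := by linarith
      simpa [hs.ne', h1.ne'] using this
    have ha : a = 0 := by
      have : coefDiag μ k c z * (z.2 0 * b + (1 - z.1 0) * a) ^ 2 = 0 := by linarith
      simpa [hs.ne', h3.ne', hb] using this
    rcases hab with h | h
    exacts [h ha, h hb]

end Forms

/-! ### Quadratic forms over compact sets -/

/-- The unit vectors of `ℝ²`. -/
def unitPairs : Set (ℝ × ℝ) := {p | p.1 ^ 2 + p.2 ^ 2 = 1}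

lemma isCompact_unitPairs : IsCompact unitPairs := by
  refine Metric.isCompact_of_isClosed_isBounded
    (isClosed_eq (by fun_prop) continuous_const) ?_
  refine (Metric.isBounded_closedBall (x := (0 : ℝ × ℝ)) (r := 1)).subset fun p hp => ?_
  have hp' : p.1 ^ 2 + p.2 ^ 2 = 1 := hp
  rw [mem_closedBall_zero_iff, Prod.norm_def, Real.norm_eq_abs, Real.norm_eq_abs]
  exact max_le (abs_le_one_iff_mul_self_le_one.2 (by nlinarith [sq_nonneg p.2]))
    (abs_le_one_iff_mul_self_le_one.2 (by nlinarith [sq_nonneg p.1]))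

lemma ne_zero_of_mem_unitPairs {p : ℝ × ℝ} (hp : p ∈ unitPairs) : p.1 ≠ 0 ∨ p.2 ≠ 0 := by
  by_contra! h
  have hp' : p.1 ^ 2 + p.2 ^ 2 = 1 := hp
  simp [h.1, h.2] at hp'

section Quadratic

variable {E : Type*} [TopologicalSpace E] {K : Set E} {A : E → ℝ → ℝ → ℝ}

/-- By homogeneity the extrema over the compact set `K × S¹` control the form everywhere. -/
lemma quad_bounds (hK : IsCompact K)
    (hA : ContinuousOn (fun p : E × ℝ × ℝ => A p.1 p.2.1 p.2.2) (K ×ˢ unitPairs))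
    (hom : ∀ z t a b, A z (t * a) (t * b) = t ^ 2 * A z a b) :
    (∃ C, 0 < C ∧ ∀ z ∈ K, ∀ a b, A z a b ≤ C * (a ^ 2 + b ^ 2)) ∧
    ((∀ z ∈ K, ∀ a b, (a ≠ 0 ∨ b ≠ 0) → 0 < A z a b) →
      ∃ δ > 0, ∀ z ∈ K, ∀ a b, δ * (a ^ 2 + b ^ 2) ≤ A z a b) := by
  have hcomp := hK.prod isCompact_unitPairs
  have hzero : ∀ z, A z 0 0 = 0 := fun z => by simpa using hom z 0 0 0
  have hnorm : ∀ a b : ℝ, (a ≠ 0 ∨ b ≠ 0) → ∃ t a' b' : ℝ, (a', b') ∈ unitPairs ∧ a = t * a' ∧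
      b = t * b' ∧ t ^ 2 = a ^ 2 + b ^ 2 := by
    intro a b hab
    have hpos : 0 < a ^ 2 + b ^ 2 := by rcases hab with h | h <;> positivity
    have ht : √(a ^ 2 + b ^ 2) ≠ 0 := (Real.sqrt_pos.2 hpos).ne'
    refine ⟨√(a ^ 2 + b ^ 2), a / √(a ^ 2 + b ^ 2), b / √(a ^ 2 + b ^ 2), ?_, ?_, ?_, Real.sq_sqrt hpos.le⟩
    · change (a / √(a ^ 2 + b ^ 2)) ^ 2 + (b / √(a ^ 2 + b ^ 2)) ^ 2 = 1
      rw [div_pow, div_pow, Real.sq_sqrt hpos.le, ← add_div, div_self hpos.ne']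
    · field_simp
    · field_simp
  constructor
  · obtain ⟨C, hC⟩ := hcomp.exists_bound_of_continuousOn hA
    refine ⟨max C 1, by positivity, fun z hz a b => ?_⟩
    by_cases hab : a ≠ 0 ∨ b ≠ 0
    · obtain ⟨t, a', b', hab', rfl, rfl, ht⟩ := hnorm a b hab
      rw [hom, ← ht, mul_comm]
      refine mul_le_mul_of_nonneg_right ?_ (sq_nonneg t)
      exact ((le_abs_self _).trans (hC (z, a', b') ⟨hz, hab'⟩)).trans (le_max_left _ _)
    · push Not at hab
      rw [hab.1, hab.2, hzero]; simp
  · intro hpos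
    rcases (K ×ˢ unitPairs).eq_empty_or_nonempty with hemp | hne
    · refine ⟨1, one_pos, fun z hz => ?_⟩
      have : (z, ((1 : ℝ), (0 : ℝ))) ∈ K ×ˢ unitPairs := ⟨hz, by simp [unitPairs]⟩
      rw [hemp] at this
      exact this.elim
    · obtain ⟨p, hp, hmin⟩ := hcomp.exists_isMinOn hne hA
      refine ⟨A p.1 p.2.1 p.2.2, hpos _ hp.1 _ _ (ne_zero_of_mem_unitPairs hp.2),
        fun z hz a b => ?_⟩
      by_cases hab : a ≠ 0 ∨ b ≠ 0
      · obtain ⟨t, a', b', hab', rfl, rfl, ht⟩ := hnorm a b hab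
        rw [hom, ← ht, mul_comm]
        refine mul_le_mul_of_nonneg_left ?_ (sq_nonneg t)
        exact hmin (show (z, a', b') ∈ K ×ˢ unitPairs from ⟨hz, hab'⟩)
      · push Not at hab
        rw [hab.1, hab.2, hzero]; simp

/-- A nonnegative function becomes positive after adding a small multiple of one which is positive
on its zero set. -/
lemma exists_pos_add_mul {T : Type*} [TopologicalSpace T] {M : Set T} (hM : IsCompact M)
    {u w : T → ℝ} (hu : ContinuousOn u M) (hw : ContinuousOn w M) (h0 : ∀ x ∈ M, 0 ≤ u x)
    (h1 : ∀ x ∈ M, u x = 0 → 0 < w x) :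
    ∃ ε₀ > 0, ∀ ε, 0 < ε → ε ≤ ε₀ → ∀ x ∈ M, 0 < u x + ε * w x := by
  suffices h : ∃ ε₀ > 0, ∀ x ∈ M, 0 < u x + ε₀ * w x by
    obtain ⟨ε₀, hε₀, h⟩ := h
    refine ⟨ε₀, hε₀, fun ε hε hle x hx => ?_⟩
    by_cases hwx : 0 < w x
    · have := h0 x hx
      positivity
    · have h2 := h x hx
      push Not at hwx
      nlinarith
  rcases M.eq_empty_or_nonempty with rfl | hne
  · exact ⟨1, one_pos, by simp⟩
  obtain ⟨C, hC⟩ := hM.exists_bound_of_continuousOn hw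
  -- The minimum `m` of `max u w` is positive. Where `w ≤ 0` one has `u ≥ m`, so the perturbation
  -- only has to stay below `m`; elsewhere the sum is positive anyway.
  have hc : ContinuousOn (fun x => max (u x) (w x)) M := hu.sup hw
  obtain ⟨p, hp, hmin⟩ := hM.exists_isMinOn hne hc
  set m := max (u p) (w p)
  have hm : 0 < m := by
    rcases (h0 p hp).eq_or_lt with h | h
    · exact lt_max_of_lt_right (h1 p hp h.symm)
    · exact lt_max_of_lt_left h
  have hC0 : 0 ≤ C := (norm_nonneg _).trans (hC p hp)
  refine ⟨m / (2 * (C + 1)), by positivity, fun x hx => ?_⟩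
  have hx' : m ≤ max (u x) (w x) := hmin hx
  by_cases hwx : 0 < w x
  · have := h0 x hx
    positivity
  · push Not at hwx
    have hux : m ≤ u x := by
      rcases le_max_iff.1 hx' with h | h
      · exact h
      · linarith
    have hwC : -C ≤ w x := by have := hC x hx; rw [Real.norm_eq_abs] at this; linarith [neg_abs_le (w x)]
    have e : m / (2 * (C + 1)) * C ≤ m / 2 := by
      rw [div_mul_eq_mul_div, div_le_div_iff₀ (by positivity) (by positivity)]
      nlinarith
    have := mul_le_mul_of_nonneg_left hwC (show 0 ≤ m / (2 * (C + 1)) by positivity)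
    linarith

end Quadratic

/-- Uniform estimates for the rotation of `bookMap` on compact parts of the sheet. -/
theorem exists_bookMap_estimates {μ : ℝ} {k : Primary} {c R w₀ : ℝ} (hg : 0 < mass μ k)
    (hg' : 0 ≤ mass μ k.other) (hc : c + mass μ k.other < 1 / 2) (hw₀ : 0 < w₀) (hR : 0 < R) :
    ∃ ε₀ > 0, ∀ ε, 0 < ε → ε ≤ ε₀ → ∃ C δ : ℝ, 0 < C ∧ 0 < δ ∧ ∀ z ∈ core μ c k R w₀,
      ‖fderiv ℝ (bookMap μ k ε) z (field μ k c z)‖ ≤ C * ‖bookMap μ k ε z‖ ∧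
      δ * ‖bookMap μ k ε z‖ ^ 2
        ≤ (star (bookMap μ k ε z) * fderiv ℝ (bookMap μ k ε) z (field μ k c z)).im := by
  set K := core μ c k R w₀
  have hK : IsCompact K := isCompact_core hg hg' hw₀ hR
  have hKs : ∀ z ∈ K, z ∈ sheet μ c k := fun z hz => hz.1
  have hKp : ∀ z ∈ K, position μ k z ≠ pos μ k.other := fun z hz => hz.1.1.2.1
  have lift : ∀ {u : Phase → ℝ}, (∀ z ∈ K, ContinuousAt u z) →
      ContinuousOn (fun p : Phase × ℝ × ℝ => u p.1) (K ×ˢ unitPairs) := fun hu p hp =>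
    ((hu p.1 hp.1).comp continuousAt_fst).continuousWithinAt
  have cs := lift (u := fun z => 1 - z.1 0) fun z _ =>
    continuousAt_const.sub (contDiff_coord₁ 0).continuous.continuousAt
  have cy := lift (u := fun z => z.2 0) fun z _ => (contDiff_coord₂ 0).continuous.continuousAt
  have ck := lift (u := kap μ k c) fun z hz => (contDiffAt_kap (hKp z hz)).continuousAt
  have cd := lift (u := coefDiag μ k c) fun z hz => continuousAt_coefDiag (hKp z hz)
  have cm := lift (u := coefMix μ k c) fun z hz => continuousAt_coefMix (hKp z hz)
  have cl := lift (u := coefLow μ k c) fun z hz => continuousAt_coefLow (hKp z hz)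
  have cw := lift (u := weight μ k) fun z _ => (contDiff_weight μ k).continuous.continuousAt
  have csh := lift (u := shear μ k) fun z _ => (contDiff_shear μ k).continuous.continuousAt
  have crw := lift (u := rate μ k c (weight μ k)) fun z hz =>
    continuousAt_rate (contDiff_weight μ k) (hKp z hz)
  have crs := lift (u := rate μ k c (shear μ k)) fun z hz =>
    continuousAt_rate (contDiff_shear μ k) (hKp z hz)
  have cf := lift (u := fun z => (field μ k c z).1 0) fun z hz =>
    (contDiff_coord₁ 0).continuous.continuousAt.comp (contDiffAt_field (hKp z hz)).continuousAt
  have ca : ContinuousOn (fun p : Phase × ℝ × ℝ => p.2.1) (K ×ˢ unitPairs) := by fun_prop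
  have cb : ContinuousOn (fun p : Phase × ℝ × ℝ => p.2.2) (K ×ˢ unitPairs) := by fun_prop
  have hrot : ContinuousOn (fun p : Phase × ℝ × ℝ => rotForm μ k c p.1 p.2.1 p.2.2)
      (K ×ˢ unitPairs) := by
    unfold rotForm
    exact (cd.mul (((cy.mul cb).add (cs.mul ca)).pow 2)).add ((cs.mul ck).mul (cb.pow 2))
  have htw : ContinuousOn (fun p : Phase × ℝ × ℝ => twistForm μ k c p.1 p.2.1 p.2.2)
      (K ×ˢ unitPairs) := by
    unfold twistForm
    exact ((cw.mul ((ca.mul ((cd.mul ca).add (cm.mul cb))).sub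
      (cb.mul ((cm.neg.mul ca).add (cl.mul cb))))).sub (crw.mul (ca.mul cb))).sub
      (crs.mul (cb.pow 2))
  obtain ⟨ε₀, hε₀, hpos⟩ := exists_pos_add_mul (hK.prod isCompact_unitPairs) hrot htw
    (fun p hp => rotForm_nonneg hg hg' (hKs _ hp.1) _ _)
    (fun p hp => twistForm_pos hg hg' hc (hKs _ hp.1) (ne_zero_of_mem_unitPairs hp.2))
  refine ⟨ε₀, hε₀, fun ε hε hle => ?_⟩
  have hform : ContinuousOn (fun p : Phase × ℝ × ℝ =>
      rotForm μ k c p.1 p.2.1 p.2.2 + ε * twistForm μ k c p.1 p.2.1 p.2.2) (K ×ˢ unitPairs) :=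
    hrot.add (htw.const_smul ε)
  have hre : ContinuousOn (fun p : Phase × ℝ × ℝ => reForm μ k ε p.1 p.2.1 p.2.2)
      (K ×ˢ unitPairs) := by
    unfold reForm
    exact (cs.mul ((cy.mul cb).add (cs.mul ca))).add
      (((cw.mul ca).add (csh.mul cb)).const_smul ε)
  have hrate : ContinuousOn (fun p : Phase × ℝ × ℝ => reRateForm μ k c ε p.1 p.2.1 p.2.2)
      (K ×ˢ unitPairs) := by
    unfold reRateForm
    exact ((cf.neg.mul ((cy.mul cb).add (cs.mul ca))).sub ((cs.mul ck).mul cb)).add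
      ((((crw.mul ca).add (cw.mul ((cm.neg.mul ca).add (cl.mul cb)))).add
        ((crs.mul cb).add (csh.mul ((cd.mul ca).add (cm.mul cb))))).const_smul ε)
  have hposall : ∀ z ∈ K, ∀ a b : ℝ, (a ≠ 0 ∨ b ≠ 0) →
      0 < rotForm μ k c z a b + ε * twistForm μ k c z a b := by
    intro z hz a b hab
    have hp : 0 < a ^ 2 + b ^ 2 := by rcases hab with h | h <;> positivity
    have ht : 0 < √(a ^ 2 + b ^ 2) := Real.sqrt_pos.2 hp
    have h := hpos ε hε hle (z, a / √(a ^ 2 + b ^ 2), b / √(a ^ 2 + b ^ 2)) ⟨hz, by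
      change (a / √(a ^ 2 + b ^ 2)) ^ 2 + (b / √(a ^ 2 + b ^ 2)) ^ 2 = 1
      rw [div_pow, div_pow, Real.sq_sqrt hp.le, ← add_div, div_self hp.ne']⟩
    have e : rotForm μ k c z a b + ε * twistForm μ k c z a b = (√(a ^ 2 + b ^ 2)) ^ 2 *
        (rotForm μ k c z (a / √(a ^ 2 + b ^ 2)) (b / √(a ^ 2 + b ^ 2))
          + ε * twistForm μ k c z (a / √(a ^ 2 + b ^ 2)) (b / √(a ^ 2 + b ^ 2))) := by
      unfold rotForm twistForm
      field_simp
    rw [e]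
    exact mul_pos (by positivity) h
  obtain ⟨δ₁, hδ₁, hlow⟩ := (quad_bounds hK hform (by
    intro z t a b; unfold rotForm twistForm; ring)).2 hposall
  obtain ⟨⟨C₂, hC₂, hN⟩, hN'⟩ := quad_bounds (A := fun z a b => reForm μ k ε z a b ^ 2 + b ^ 2) hK
    ((hre.pow 2).add (cb.pow 2)) (by intro z t a b; unfold reForm; ring)
  obtain ⟨δ₂, hδ₂, hN'⟩ := hN' (by
    intro z hz a b hab
    by_cases hb : b = 0
    · have ha : a ≠ 0 := hab.resolve_right (not_not.2 hb)
      have hw := weight_pos (hKp z hz)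
      have : reForm μ k ε z a b = ((1 - z.1 0) ^ 2 + ε * weight μ k z) * a := by
        rw [reForm, hb]; ring
      rw [this]
      positivity
    · positivity)
  obtain ⟨C₃, hC₃, hD⟩ := (quad_bounds (A := fun z a b => reRateForm μ k c ε z a b ^ 2
    + (coefDiag μ k c z * a + coefMix μ k c z * b) ^ 2) hK
    ((hrate.pow 2).add (((cd.mul ca).add (cm.mul cb)).pow 2))
    (by intro z t a b; unfold reRateForm; ring)).1
  have hnorm : ∀ x y : ℝ, ‖((x : ℝ) : ℂ) + ((y : ℝ) : ℂ) * Complex.I‖ ^ 2 = x ^ 2 + y ^ 2 := by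
    intro x y
    rw [← Complex.normSq_eq_norm_sq, Complex.normSq_add_mul_I]
  -- Both estimates compare with `η₃² + ξ₃²`, which bounds `|Θ|²` from both sides: above with `C₂`,
  -- below with `δ₂`.
  refine ⟨√(C₃ / δ₂), δ₁ / C₂, by positivity, by positivity, fun z hz => ⟨?_, ?_⟩⟩
  · rw [← sq_le_sq₀ (norm_nonneg _) (by positivity), mul_pow, Real.sq_sqrt (by positivity),
      fderiv_bookMap_field (hKs z hz).1.1, bookMap_eq, hnorm, hnorm]
    calc _ ≤ C₃ * (z.2 3 ^ 2 + z.1 3 ^ 2) := hD z hz _ _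
      _ = C₃ / δ₂ * (δ₂ * (z.2 3 ^ 2 + z.1 3 ^ 2)) := by field_simp
      _ ≤ _ := mul_le_mul_of_nonneg_left (hN' z hz _ _) (by positivity)
  · rw [im_bookMap (hKs z hz).1.1, bookMap_eq, hnorm]
    calc _ ≤ δ₁ / C₂ * (C₂ * (z.2 3 ^ 2 + z.1 3 ^ 2)) :=
          mul_le_mul_of_nonneg_left (hN z hz _ _) (by positivity)
      _ = δ₁ * (z.2 3 ^ 2 + z.1 3 ^ 2) := by field_simp
      _ ≤ _ := hlow z hz _ _

/-! ### Passing from one primary to the other -/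

/-- The covector at the other primary of the point with the same position and momentum. -/
def switch (μ : ℝ) (k : Primary) (z : Phase) : Phase :=
  (z.1, z.2 + ((coord μ k - coord μ k.other) * (1 - z.1 0)⁻¹) •
    !₂[z.1 1, 1 - z.1 1 * z.1 1 * (1 - z.1 0)⁻¹, -(z.1 1 * z.1 2 * (1 - z.1 0)⁻¹),
      -(z.1 1 * z.1 3 * (1 - z.1 0)⁻¹)])

section Switch

variable {μ : ℝ} {k : Primary} {c : ℝ} {z : Phase}

/-- The added covector is the gradient on `S³` of `(a₁ - a₁') ξ₁ / (1 - ξ₀)`, so the change of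
coordinates is a translation in the fibres by an exact form, generated by the shift of the origin
from one primary to the other. -/
lemma switch_mem_TstarS3 (hz : z ∈ TstarS3) (h0 : z.1 0 ≠ 1) : switch μ k z ∈ TstarS3 := by
  refine ⟨hz.1, ?_⟩
  have hs := (one_sub_pos hz h0).ne'
  have h1 := normSq_TstarS3 hz
  have h2 := inner_TstarS3 hz
  rw [inner_E4]
  simp [switch]
  field_simp
  linear_combination (1 - z.1 0) ^ 2 * h2 - (coord μ k - coord μ k.other) * z.1 1 * h1

lemma position_switch (h0 : z.1 0 ≠ 1) :
    position μ k.other (switch μ k z) = position μ k z := by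
  have hs : 1 - z.1 0 ≠ 0 := sub_ne_zero.2 (Ne.symm h0)
  ext i
  fin_cases i <;> simp [switch] <;> field_simp <;> ring

lemma relPos_switch (h0 : z.1 0 ≠ 1) : relPos (switch μ k z) = offset μ k z := by
  rw [← position_sub_pos μ k.other, position_switch h0, offset]

lemma offset_switch (h0 : z.1 0 ≠ 1) : offset μ k.other (switch μ k z) = relPos z := by
  rw [offset, position_switch h0, other_other, position_sub_pos]

lemma momentum_switch : momentum (switch μ k z) = momentum z := rfl

lemma offset_ne_zero_of_sheet (hz : z ∈ sheet μ c k) : 0 < ‖offset μ k z‖ :=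
  norm_pos_iff.2 (offset_ne_zero.2 hz.1.2.1)

lemma norm_switch (hz : z ∈ TstarS3) (h0 : z.1 0 ≠ 1) :
    ‖offset μ k z‖ = (1 - z.1 0) * ‖(switch μ k z).2‖ := by
  rw [← relPos_switch h0]
  exact norm_relPos (switch_mem_TstarS3 hz h0)

lemma switch_mem_sheet (hg : 0 < mass μ k) (hg' : 0 < mass μ k.other) (hz : z ∈ sheet μ c k)
    (h0 : z.1 0 ≠ 1) : switch μ k z ∈ sheet μ c k.other := by
  refine mem_sheet_of_energy hg' (switch_mem_TstarS3 hz.1.1 h0) h0 ?_ ?_ ?_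
  · have h1 := norm_switch (μ := μ) (k := k) hz.1.1 h0
    have h2 := offset_ne_zero_of_sheet hz
    rw [h1] at h2
    exact norm_pos_iff.1 (pos_of_mul_pos_right h2 (one_sub_nonneg hz.1.1))
  · rw [position_switch h0, other_other, ← sub_ne_zero, position_sub_pos, ← norm_pos_iff]
    exact norm_relPos_pos hg hz h0
  · rw [position_switch h0, momentum_switch]
    exact H_eq_energy hg hz h0

/-- Switching changes `η₃` by a multiple of `ξ₁ξ₃/(1 - ξ₀)²`. With coefficient `|q-a|⁴ + |q-a'|⁴`
this change splits into two parts, one absorbed by each `shear`. The fourth powers make each `shear`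
smooth at its own collisions, where `|q-a|⁴/(1 - ξ₀)² = (1 - ξ₀)²|η|⁴`. -/
lemma bookMap_switch (ε : ℝ) (hz : z ∈ TstarS3) (h0 : z.1 0 ≠ 1) :
    bookMap μ k.other ε (switch μ k z) = bookMap μ k ε z := by
  have hs := (one_sub_pos hz h0).ne'
  have e1 : relPos (switch μ k z) 2 = relPos z 2 := by rw [relPos_switch h0, offset_two]
  have e2 : weight μ k.other (switch μ k z) = weight μ k z := by
    rw [weight, weight, relPos_switch h0, offset_switch h0, add_comm]
  have e3 : (switch μ k z).2 3 = z.2 3 - (coord μ k - coord μ k.other) * (1 - z.1 0)⁻¹ *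
      (z.1 1 * z.1 3 * (1 - z.1 0)⁻¹) := by simp [switch]; ring
  have e4 : shear μ k z
      = (coord μ k.other - coord μ k) * ((‖relPos z‖ ^ 2) ^ 2 * ((1 - z.1 0)⁻¹ ^ 2 * z.1 1)) := by
    rw [shear, norm_relPos hz]; field_simp
  have e5 : shear μ k.other (switch μ k z)
      = (coord μ k - coord μ k.other) * ((‖offset μ k z‖ ^ 2) ^ 2 * ((1 - z.1 0)⁻¹ ^ 2 * z.1 1)) := by
    rw [shear, norm_switch hz h0, other_other]
    have e : (switch μ k z).1 = z.1 := rfl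
    rw [e]; field_simp
  have e6 : (switch μ k z).1 = z.1 := rfl
  unfold bookMap
  rw [e1, e2, e3, e4, e5, e6]
  congr 2
  unfold weight
  ring

/-- On `T^*S³`, away from collisions, the covector is determined by `ξ` and the position. -/
lemma eq_of_position_eq {w : Phase} (hz : z ∈ TstarS3) (hw : w ∈ TstarS3) (h0 : z.1 0 ≠ 1)
    (h1 : z.1 = w.1) (h2 : relPos z = relPos w) : z = w := by
  have h := eq_zero_of_relPosDeriv (v := ((0 : E4), z.2 - w.2)) hz h0 (by
    have hw2 := hw.2
    rw [← h1] at hw2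
    simp [inner_sub_right, hz.2, hw2]) rfl (by
    have h3 := sub_eq_zero.2 h2
    rw [← h3, relPos, relPos, ← h1]
    ext i
    fin_cases i <;> simp [relPosDeriv, vec] <;> ring)
  exact Prod.ext h1 (sub_eq_zero.1 (congrArg Prod.snd h))

/-- Stereographic projection is an immersion: the expression in `h2` is `(1 - ξ₀)²` times the
derivative of `ξ⃗/(1 - ξ₀)`. -/
lemma eq_zero_of_momentum {V : E4} (hz : z ∈ TstarS3) (h0 : z.1 0 ≠ 1)
    (h1 : inner ℝ z.1 V = (0 : ℝ)) (h2 : (1 - z.1 0) • vec V + V 0 • vec z.1 = 0) : V = 0 := by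
  have hs := (one_sub_pos hz h0).ne'
  have n := normSq_TstarS3 hz
  rw [inner_E4] at h1
  have r0 := congrArg (fun x : E3 => x 0) h2
  have r1 := congrArg (fun x : E3 => x 1) h2
  have r2 := congrArg (fun x : E3 => x 2) h2
  simp [vec] at r0 r1 r2
  have hV : V 0 = 0 := by
    have : (1 - z.1 0) * V 0 = 0 := by
      linear_combination z.1 1 * r0 + z.1 2 * r1 + z.1 3 * r2 - V 0 * n - (1 - z.1 0) * h1
    exact (mul_eq_zero.1 this).resolve_left hs
  rw [hV] at r0 r1 r2
  simp [hs] at r0 r1 r2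
  ext i
  fin_cases i
  exacts [hV, r0, r1, r2]

/-- Up to the factor `g |q - a|`, the right-hand side is symmetric in the two primaries: it
expresses `X_H`. The same holds in `field_position_sheet`, and this makes the two regularized fields
comparable. -/
lemma field_momentum_sheet (hg : 0 < mass μ k) (hz : z ∈ sheet μ c k) (h0 : z.1 0 ≠ 1) :
    (1 - z.1 0) • vec (field μ k c z).1 + (field μ k c z).1 0 • vec z.1
      = (mass μ k * ‖relPos z‖) • ((1 - z.1 0) ^ 2 • ((mass μ k / ‖relPos z‖ ^ 3) • relPos z
        + (mass μ k.other / ‖offset μ k z‖ ^ 3) • offset μ k z)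
        + (1 - z.1 0) • rot (vec z.1)) := by
  have hη := norm_snd_pos hg hz
  have hs := one_sub_pos hz.1.1 h0
  have hW := offset_ne_zero_of_sheet hz
  rw [field_momentum μ k c hz.1.1, kap_eq hg hz, norm_relPos hz.1.1,
    show f μ k c z = mass μ k / ‖z.2‖ by rw [eq_div_iff hη.ne', mul_comm]; exact norm_mul_f hg hz, pull]
  ext i
  simp only [PiLp.add_apply, PiLp.smul_apply, smul_eq_mul]
  field_simp
  ring

lemma field_position_sheet (hg : 0 < mass μ k) (hz : z ∈ sheet μ c k) (h0 : z.1 0 ≠ 1) :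
    relPosDeriv z (field μ k c z) = (mass μ k * ‖relPos z‖) •
      (1 - z.1 0)⁻¹ • (-vec z.1 + (1 - z.1 0) • rot (position μ k z)) := by
  have hs := one_sub_pos hz.1.1 h0
  rw [field_position μ k c hz.1.1, kap_eq hg hz, norm_relPos hz.1.1, smul_smul]
  congr 1
  field_simp

/-- The change of coordinates maps one regularized vector field to the other. -/
lemma hasDerivAt_switch (hg : 0 < mass μ k) (hg' : 0 < mass μ k.other) {ζ : ℝ → Phase} {t l l' : ℝ}
    (hζ : ∀ s, ζ s ∈ sheet μ c k) (h0 : (ζ t).1 0 ≠ 1)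
    (hd : HasDerivAt ζ (l • field μ k c (ζ t)) t)
    (hl : l * (mass μ k * ‖relPos (ζ t)‖) = l' * (mass μ k.other * ‖offset μ k (ζ t)‖)) :
    HasDerivAt (fun s => switch μ k (ζ s)) (l' • field μ k.other c (switch μ k (ζ t))) t := by
  set z := ζ t with hz
  have hzs := hζ t
  rw [← hz] at hzs
  have hT := hzs.1.1
  have hs := one_sub_pos hT h0
  have hcont : ContinuousAt ζ t := hd.continuousAt
  have hev : ∀ᶠ s in 𝓝 t, (ζ s).1 0 ≠ 1 := by
    have : ContinuousAt (fun s => (ζ s).1 0) t :=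
      (contDiff_coord₁ 0).continuous.continuousAt.comp hcont
    exact this.eventually_ne h0
  have hdiff : DifferentiableAt ℝ (switch μ k) z := by
    have hinv : DifferentiableAt ℝ (fun w : Phase => (1 - w.1 0)⁻¹) z :=
      (DifferentiableAt.const_sub (hasFDerivAt_coord₁ 0 z).differentiableAt 1).inv hs.ne'
    have x : ∀ i, DifferentiableAt ℝ (fun w : Phase => w.1 i) z := fun i =>
      (hasFDerivAt_coord₁ i z).differentiableAt
    refine differentiableAt_fst.prodMk (differentiableAt_snd.add
      ((hinv.const_mul _).smul ?_))
    rw [differentiableAt_euclidean]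
    intro i
    fin_cases i
    · exact x 1
    · exact DifferentiableAt.const_sub (((x 1).mul (x 1)).mul hinv) 1
    · exact (((x 1).mul (x 2)).mul hinv).neg
    · exact (((x 1).mul (x 3)).mul hinv).neg
  -- The derivative of `switch` is never computed. The vector `D` is identified by its `ξ`-part, its
  -- effect on the position, and its tangency to `T^*S³`.
  set D := fderiv ℝ (switch μ k) z (l • field μ k c z) with hD
  have hsw : HasDerivAt (fun s => switch μ k (ζ s)) D t := hdiff.hasFDerivAt.comp_hasDerivAt t hd
  set z' := switch μ k z with hz'
  have hz's : z' ∈ sheet μ c k.other := switch_mem_sheet hg hg' hzs h0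
  have hT' := hz's.1.1
  have h0' : z'.1 0 ≠ 1 := h0
  have hD1 : D.1 = (l • field μ k c z).1 := by
    have a : HasDerivAt (fun s => (switch μ k (ζ s)).1) D.1 t :=
      HasFDerivAt.comp_hasDerivAt (f := fun s => switch μ k (ζ s)) t
        (ContinuousLinearMap.fst ℝ E4 E4).hasFDerivAt hsw
    have b : HasDerivAt (fun s => (ζ s).1) (l • field μ k c z).1 t :=
      (hasFDerivAt_fst (p := ζ t)).comp_hasDerivAt t hd
    exact a.unique b
  have hDy : relPosDeriv z' D = l • relPosDeriv z (field μ k c z) := by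
    obtain ⟨L, hL, hLv⟩ := exists_hasFDerivAt_relPos z'
    obtain ⟨M, hM, hMv⟩ := exists_hasFDerivAt_relPos z
    have a : HasDerivAt (fun s => relPos (switch μ k (ζ s))) (L D) t :=
      HasFDerivAt.comp_hasDerivAt (f := fun s => switch μ k (ζ s)) t hL hsw
    have b : HasDerivAt (fun s => offset μ k (ζ s)) (M (l • field μ k c z)) t := by
      have : HasFDerivAt (offset μ k) M z := (hM.const_add (pos μ k)).sub_const _
      exact this.comp_hasDerivAt t hd
    have e := a.unique (b.congr_of_eventuallyEq (hev.mono fun s hs => relPos_switch hs))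
    rw [← hLv, e, map_smul, hMv]
  have hDT : inner ℝ D.1 z'.2 + inner ℝ z'.1 D.2 = (0 : ℝ) := by
    have a : HasDerivAt (fun s => (switch μ k (ζ s)).1) D.1 t :=
      HasFDerivAt.comp_hasDerivAt (f := fun s => switch μ k (ζ s)) t
        (ContinuousLinearMap.fst ℝ E4 E4).hasFDerivAt hsw
    have b : HasDerivAt (fun s => (switch μ k (ζ s)).2) D.2 t :=
      HasFDerivAt.comp_hasDerivAt (f := fun s => switch μ k (ζ s)) t
        (ContinuousLinearMap.snd ℝ E4 E4).hasFDerivAt hsw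
    have e := (a.inner ℝ b).unique ((hasDerivAt_const t (0 : ℝ)).congr_of_eventuallyEq
      (hev.mono fun s hs => (switch_mem_TstarS3 (hζ s).1.1 hs).2))
    rw [← e, add_comm]
  have hn : ‖relPos z'‖ = ‖offset μ k z‖ := by rw [hz', relPos_switch h0]
  have hn' : ‖offset μ k.other z'‖ = ‖relPos z‖ := by rw [hz', offset_switch h0]
  obtain ⟨t1, -⟩ := field_mem_tangent μ k c hzs.1.2.1 hT
  obtain ⟨t1', t2'⟩ := field_mem_tangent μ k.other c hz's.1.2.1 hT'
  have hmom : (l • field μ k c z).1 = (l' • field μ k.other c z').1 := by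
    rw [← sub_eq_zero]
    refine eq_zero_of_momentum hT h0 ?_ ?_
    · simp only [Prod.smul_fst, inner_sub_right, inner_smul_right, t1]
      rw [show inner ℝ z.1 (field μ k.other c z').1 = (0 : ℝ) from t1']
      ring
    · have a := congrArg (l • ·) (field_momentum_sheet hg hzs h0)
      have b := congrArg (l' • ·) (field_momentum_sheet hg' hz's h0')
      simp only [hn, hn', other_other] at b
      rw [smul_smul, ← hl, ← smul_smul, show relPos z' = offset μ k z from relPos_switch h0,
        show offset μ k.other z' = relPos z from offset_switch h0, show z'.1 = z.1 from rfl,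
        add_comm ((mass μ k.other / ‖offset μ k z‖ ^ 3) • offset μ k z), smul_smul, ← smul_smul l] at b
      rw [smul_smul] at b
      have e := a.trans ((smul_smul _ _ _).trans b.symm)
      rw [← sub_eq_zero] at e
      rw [← e]
      ext i
      fin_cases i <;> simp [vec] <;> ring
  have hfin : D - l' • field μ k.other c z' = 0 := by
    refine eq_zero_of_relPosDeriv hT' h0' ?_ ?_ ?_
    · have t3 : inner ℝ (l' • field μ k.other c z').1 z'.2
          + inner ℝ z'.1 (l' • field μ k.other c z').2 = (0 : ℝ) := by
        simp only [Prod.smul_fst, Prod.smul_snd, inner_smul_left, inner_smul_right, conj_trivial]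
        linear_combination l' * t2'
      rw [hD1, hmom] at hDT
      simp only [Prod.snd_sub, inner_sub_right]
      linarith
    · rw [Prod.fst_sub, hD1, hmom, sub_self]
    · have e : relPosDeriv z' (D - l' • field μ k.other c z')
          = relPosDeriv z' D - l' • relPosDeriv z' (field μ k.other c z') := by
        ext i
        fin_cases i <;> simp [relPosDeriv, vec] <;> ring
      rw [e, hDy, field_position_sheet hg hzs h0, field_position_sheet hg' hz's h0', hn,
        show position μ k.other z' = position μ k z from position_switch h0, show z'.1 = z.1 from rfl,
        smul_smul, smul_smul l', hl, sub_self]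
  rw [← sub_eq_zero.1 hfin]
  exact hsw

end Switch

/-! ### Circle families from estimates on compact cores -/

section Cores

variable {F : PatchedSpace} {X : F.index → Phase → Phase}

/-- Two local expressions of a function on the space have the same value and the same derivative along
the vector field. -/
lemma fderiv_eq_of_chartChange (hinj : ∀ i, Function.Injective (F.incl i)) (hchange : ChartChange F X)
    (hloc : ∀ i, ∀ z : F.patch i, ∃ ε > (0 : ℝ), ∀ᶠ w in 𝓝 z, ∃ ζ : ℝ → F.patch i, ζ 0 = w ∧
      ∀ t ∈ Ioo (-ε) ε, HasDerivAt (fun s => (ζ s : Phase)) (X i (ζ t)) t)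
    {Θ : F.carrier → ℂ} {Ψ : F.index → Phase → ℂ} (hΨ : ∀ i (z : F.patch i), Θ (F.incl i z) = Ψ i z)
    (hsm : ∀ i, ContDiff ℝ ∞ (Ψ i)) {i j : F.index} {z : F.patch i} {w : F.patch j}
    (h : F.incl i z = F.incl j w) :
    Ψ i z = Ψ j w ∧ fderiv ℝ (Ψ i) z (X i z) = fderiv ℝ (Ψ j) w (X j w) := by
  refine ⟨by rw [← hΨ, ← hΨ, h], ?_⟩
  obtain ⟨ε, hε, hev⟩ := hloc i z
  obtain ⟨ζ, rfl, hζ⟩ := hev.self_of_nhds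
  have hd := hζ 0 ⟨by linarith, hε⟩
  obtain ⟨ζ', he, hd'⟩ := hchange i j w ζ 0 h hd
  have hw : ζ' 0 = w := hinj j (by rw [← he.self_of_nhds, h])
  have a : HasDerivAt (fun s => Ψ i (ζ s)) (fderiv ℝ (Ψ i) (ζ 0) (X i (ζ 0))) 0 :=
    HasFDerivAt.comp_hasDerivAt (f := fun s => (ζ s : Phase)) 0
      ((hsm i).differentiable (by simp) _).hasFDerivAt hd
  have b : HasDerivAt (fun s => Ψ j (ζ' s)) (fderiv ℝ (Ψ j) (ζ' 0) (X j w)) 0 :=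
    HasFDerivAt.comp_hasDerivAt (f := fun s => (ζ' s : Phase)) 0
      ((hsm j).differentiable (by simp) _).hasFDerivAt hd'
  rw [hw] at b
  refine a.unique (b.congr_of_eventuallyEq ?_)
  filter_upwards [he] with s hs
  rw [← hΨ, ← hΨ, hs]

/-- A point of the component may be given in a patch whose core misses it. Its estimates are then
read off in the patch whose core contains it, since `Θ` and its derivative along the field do not
depend on the patch. -/
theorem isCircleFamily_of_cores (hcont : ∀ i, Continuous (F.incl i))
    (hinj : ∀ i, Function.Injective (F.incl i)) (hchange : ChartChange F X) [Finite F.index]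
    {x₀ : F.carrier} (K : (i : F.index) → Set (F.patch i)) (hK : ∀ i, IsCompact (K i))
    (hcover : connectedComponent x₀ ⊆ ⋃ i, F.incl i '' K i)
    (hloc : ∀ i, ∀ z : F.patch i, ∃ ε > (0 : ℝ), ∀ᶠ w in 𝓝 z, ∃ ζ : ℝ → F.patch i, ζ 0 = w ∧
      ∀ t ∈ Ioo (-ε) ε, HasDerivAt (fun s => (ζ s : Phase)) (X i (ζ t)) t)
    {B : Set F.carrier} {Θ : F.carrier → ℂ} {Ψ : F.index → Phase → ℂ} (hΘ : Continuous Θ)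
    (hΨ : ∀ i (z : F.patch i), Θ (F.incl i z) = Ψ i z) (hsm : ∀ i, ContDiff ℝ ∞ (Ψ i))
    (hopen : ∀ i (z : F.patch i), F.incl i z ∈ connectedComponent x₀ →
      ∀ᶠ w in 𝓝 z, F.incl i w ∈ connectedComponent x₀)
    (hzero : ∀ x ∈ connectedComponent x₀, Θ x = 0 ↔ x ∈ B) (hBS : B ⊆ connectedComponent x₀)
    (hsurj : ∀ i (z : F.patch i), F.incl i z ∈ connectedComponent x₀ → Ψ i z = 0 →
      ∀ a : ℂ, ∃ w ∈ F.tangent i z, fderiv ℝ (Ψ i) z w = a)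
    (hne : ∀ i (z : F.patch i), F.incl i z ∈ connectedComponent x₀ → X i z ≠ 0)
    (hest : ∀ i, ∃ C δ : ℝ, 0 < C ∧ 0 < δ ∧ ∀ z ∈ K i,
      ‖fderiv ℝ (Ψ i) z (X i z)‖ ≤ C * ‖Ψ i z‖ ∧
      δ * ‖Ψ i z‖ ^ 2 ≤ (star (Ψ i z) * fderiv ℝ (Ψ i) z (X i z)).im) :
    IsCircleFamily F X (connectedComponent x₀) B Θ := by
  have hcomp : IsCompact (connectedComponent x₀) :=
    (isCompact_iUnion fun i => (hK i).image (hcont i)).of_isClosed_subset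
      isClosed_connectedComponent hcover
  choose C δ hC hδ hest using hest
  have : Nonempty F.index := by
    obtain ⟨i, -⟩ := mem_iUnion.1 (hcover mem_connectedComponent)
    exact ⟨i⟩
  obtain ⟨i₁, hi₁⟩ := Finite.exists_max C
  obtain ⟨i₂, hi₂⟩ := Finite.exists_min δ
  have key : ∀ i (z : F.patch i), F.incl i z ∈ connectedComponent x₀ →
      ‖fderiv ℝ (Ψ i) z (X i z)‖ ≤ C i₁ * ‖Ψ i z‖ ∧
      δ i₂ * ‖Ψ i z‖ ^ 2 ≤ (star (Ψ i z) * fderiv ℝ (Ψ i) z (X i z)).im := by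
    intro i z hz
    obtain ⟨j, w, hw, he⟩ := mem_iUnion.1 (hcover hz)
    obtain ⟨e1, e2⟩ := fderiv_eq_of_chartChange hinj hchange hloc hΨ hsm he
    rw [← e1, ← e2]
    obtain ⟨h1, h2⟩ := hest j w hw
    exact ⟨h1.trans (by gcongr; exact hi₁ j), le_trans (by gcongr; exact hi₂ j) h2⟩
  exact isCircleFamily_of_estimates hcont rfl hΘ hΨ hsm hcomp hopen hzero hBS hsurj (hδ i₂)
    (fun i z hz => (key i z hz).1) (fun i z hz => (key i z hz).2) hne
    (exists_isIntegralLine_of_cores hcont hinj hchange K hK hcover hloc)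

end Cores

/-! ### Flows and components for open parts of a level set -/

section Patches

variable {μ : ℝ} {k : Primary} {c : ℝ} {P : Set Phase}

lemma exists_flow_of_isOpen_level (hPl : P ⊆ level μ k c)
    (hP : ∀ z ∈ P, ∃ U ∈ 𝓝 z, U ∩ level μ k c ⊆ P) {V : Phase → Phase} {l : Phase → ℝ}
    (hl : ∀ z ∈ P, ContDiffAt ℝ 1 l z) (hV : ∀ z ∈ P, V z = l z • field μ k c z) (z : P) :
    ∃ ε > (0 : ℝ), ∀ᶠ w in 𝓝 z, ∃ ζ : ℝ → P, ζ 0 = w ∧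
      ∀ t ∈ Ioo (-ε) ε, HasDerivAt (fun s => (ζ s : Phase)) (V (ζ t)) t := by
  obtain ⟨U, hU, hUP⟩ := hP z z.2
  obtain ⟨ε, hε, h⟩ := exists_local_flow_level (hPl z.2) (hl z z.2) hU
  refine ⟨ε, hε, ?_⟩
  have h' : ∀ᶠ w : P in 𝓝 z, _ := (continuous_subtype_val.tendsto z).eventually h
  filter_upwards [h'] with w hw
  obtain ⟨α, h0, hα⟩ := hw (hPl w.2)
  classical
  -- The value outside the interval of existence is immaterial.
  let ζ : ℝ → P := fun t =>
    if ht : t ∈ Ioo (-ε) ε then ⟨α t, hUP ⟨(hα t ht).1.1, (hα t ht).1.2⟩⟩ else w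
  have hζ : ∀ t ∈ Ioo (-ε) ε, (ζ t : Phase) = α t := fun t ht => by simp only [ζ, dif_pos ht]
  refine ⟨ζ, Subtype.ext ?_, fun t ht => ?_⟩
  · rw [hζ 0 ⟨by linarith, hε⟩, h0]
  · have hev : (fun s => (ζ s : Phase)) =ᶠ[𝓝 t] α := by
      filter_upwards [isOpen_Ioo.mem_nhds ht] with s hs using hζ s hs
    rw [hV _ (ζ t).2, hζ t ht]
    exact (hα t ht).2.congr_of_eventuallyEq hev

lemma eventually_mem_connectedComponent {T : Type*} [TopologicalSpace T] (hPl : P ⊆ level μ k c)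
    (hP : ∀ z ∈ P, ∃ U ∈ 𝓝 z, U ∩ level μ k c ⊆ P) {φ : P → T} (hφ : Continuous φ) {x₀ : T} {z : P}
    (hV : field μ k c z ≠ 0) (hz : φ z ∈ connectedComponent x₀) :
    ∀ᶠ w in 𝓝 z, φ w ∈ connectedComponent x₀ := by
  obtain ⟨U, hU, hUP⟩ := hP z z.2
  obtain ⟨N, hN, hzN, hpre, hev⟩ := exists_isPreconnected_level (hPl z.2) hV hU
  have hev' : ∀ᶠ w : P in 𝓝 z, _ := (continuous_subtype_val.tendsto z).eventually hev
  have hpre' : IsPreconnected ((↑) ⁻¹' N : Set P) :=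
    IsInducing.subtypeVal.isPreconnected_image.1 (by
      rwa [image_preimage_eq_of_subset (by rw [Subtype.range_coe]; exact hN.trans hUP)])
  filter_upwards [hev'] with w hw
  rw [connectedComponent_eq hz]
  exact (hpre'.image φ hφ.continuousOn).subset_connectedComponent
    (mem_image_of_mem φ (show z ∈ ((↑) ⁻¹' N : Set P) from hzN))
    (mem_image_of_mem φ (show w ∈ ((↑) ⁻¹' N : Set P) from hw (hPl w.2)))

end Patches

/-- The form in which barriers are used: a connected set cannot cross a level that it never attains.
-/
lemma lt_of_ne_of_isPreconnected {T : Type*} [TopologicalSpace T] {S : Set T} (hS : IsPreconnected S)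
    {g : T → ℝ} (hg : ContinuousOn g S) {v : ℝ} (hne : ∀ x ∈ S, g x ≠ v) {x₀ : T} (h₀ : x₀ ∈ S)
    (hv : g x₀ < v) : ∀ x ∈ S, g x < v := by
  intro x hx
  by_contra! hle
  obtain ⟨y, hy, hyv⟩ := hS.intermediate_value h₀ hx hg ⟨hv.le, hle⟩
  exact hne y hy hyv

/-! ### Regularization at one primary -/

section Pages

variable {μ : ℝ} {k : Primary} {c ε : ℝ} {z : Phase}

lemma bookMap_im : (bookMap μ k ε z).im = z.1 3 := by simp [bookMap]

lemma bookMap_re (h : z.1 3 = 0) :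
    (bookMap μ k ε z).re = ((1 - z.1 0) ^ 2 + ε * weight μ k z) * z.2 3 := by
  simp [bookMap, relPos, vec, h]
  ring

lemma eq_norm_mul_one_iff (w : ℂ) :
    w = (‖w‖ : ℂ) * ((1 : Circle) : ℂ) ↔ w.im = 0 ∧ 0 ≤ w.re := by
  rw [Circle.coe_one, mul_one]
  constructor
  · intro h
    have h1 : w.re = ‖w‖ := by conv_lhs => rw [h, Complex.ofReal_re]
    have h2 : w.im = 0 := by conv_lhs => rw [h, Complex.ofReal_im]
    exact ⟨h2, by rw [h1]; exact norm_nonneg w⟩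
  · rintro ⟨h1, h2⟩
    have h3 := Complex.abs_re_eq_norm.2 h1
    rw [abs_of_nonneg h2] at h3
    apply Complex.ext <;> simp [h1, h3]

lemma eq_norm_mul_neg_one_iff (w : ℂ) :
    w = (‖w‖ : ℂ) * ((-1 : Circle) : ℂ) ↔ w.im = 0 ∧ w.re ≤ 0 := by
  have h := eq_norm_mul_one_iff (-w)
  rw [norm_neg, Circle.coe_one, mul_one] at h
  rw [Circle.coe_neg, Circle.coe_one, mul_neg_one, ← neg_eq_iff_eq_neg, h]
  simp

lemma snd_ne_zero_of_level (hg : 0 < mass μ k) (hz : z ∈ level μ k c) :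
    z.2 ≠ 0 ∧ f μ k c z ≠ 0 := by
  obtain ⟨-, -, hQ⟩ := hz
  rw [Q] at hQ
  have : 0 < mass μ k ^ 2 := by positivity
  constructor <;> intro h <;> simp [h] at hQ <;> linarith

lemma collision_of_position_eq (hg : 0 < mass μ k) (hz : z ∈ level μ k c)
    (h : position μ k z = pos μ k) : z.1 0 = 1 := by
  have h1 := norm_relPos hz.1
  rw [← position_sub_pos μ k, h, sub_self, norm_zero] at h1
  have h2 := norm_ne_zero_iff.2 (snd_ne_zero_of_level hg hz).1
  have := (mul_eq_zero.1 h1.symm).resolve_right h2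
  linarith

lemma isCompact_preimage_core {P : Set Phase} (hP : sheet μ c k ⊆ P) {R w₀ : ℝ} (hg : 0 < mass μ k)
    (hg' : 0 ≤ mass μ k.other) (hw₀ : 0 < w₀) (hR : 0 < R) :
    IsCompact ((↑) ⁻¹' core μ c k R w₀ : Set P) :=
  (IsInducing.subtypeVal.isCompact_preimage_iff (by
    rw [Subtype.range_coe]; exact fun z hz => hP hz.1)).2 (isCompact_core hg hg' hw₀ hR)

lemma chartChange_singlyRegularized (X : Unit → Phase → Phase) :
    ChartChange (singlyRegularized μ k c) X := by
  intro i j w ζ t h hd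
  refine ⟨ζ, Eventually.of_forall fun _ => rfl, ?_⟩
  have h' : ζ t = w := h
  rw [← h']
  exact hd

end Pages

/-! ### The component through a collision, regularized at one primary -/

section Single

variable {μ : ℝ} {k : Primary} {c : ℝ}

/-- On the level set `f` has no zeros, and `f = 1` at the collision point `z₀`. -/
lemma component_subset_sheet (hg : 0 < mass μ k) {z₀ : level μ k c}
    (hz₀ : position μ k z₀ = pos μ k) {z : level μ k c} (hz : z ∈ connectedComponent z₀) :
    (z : Phase) ∈ sheet μ c k := by
  refine ⟨z.2, ?_⟩
  have hcf : Continuous fun z : level μ k c => -f μ k c z := by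
    rw [continuous_iff_continuousAt]
    intro z
    exact ((contDiffAt_f (c := c) z.2.2.1).continuousAt.comp continuous_subtype_val.continuousAt).neg
  have := lt_of_ne_of_isPreconnected isPreconnected_connectedComponent hcf.continuousOn (v := 0)
    (fun x _ => neg_ne_zero.2 (snd_ne_zero_of_level hg x.2).2) mem_connectedComponent
    (by rw [f_collision z₀.2.1 (collision_of_position_eq hg z₀.2 hz₀)]; norm_num) z hz
  exact neg_neg_iff_pos.1 this

lemma component_subset_core (hg : 0 < mass μ k) (hg' : 0 ≤ mass μ k.other) {r : ℝ} (h0 : 0 < r)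
    (h1 : r < 1) (h : hill μ k r (1 - r) < -c) {z₀ : level μ k c}
    (hz₀ : position μ k z₀ = pos μ k) {z : level μ k c} (hz : z ∈ connectedComponent z₀) :
    (z : Phase) ∈ core μ c k r (1 - r) := by
  have hlt : ‖relPos (z : Phase)‖ < r := by
    refine lt_of_ne_of_isPreconnected isPreconnected_connectedComponent
      (g := fun z : level μ k c => ‖relPos (z : Phase)‖)
      (contDiff_relPos.continuous.comp continuous_subtype_val).norm.continuousOn (fun x hx => ?_)
      mem_connectedComponent ?_ z hz
    · by_cases hx0 : (x : Phase).1 0 = 1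
      · rw [relPos_collision x.2.1 hx0, norm_zero]; exact h0.ne
      · have := norm_ne_of_sphere_barrier hg' h0 h1 h
          (H_eq_energy hg (component_subset_sheet hg hz₀ hx) hx0)
        rwa [position_sub_pos] at this
    · rw [relPos_collision z₀.2.1 (collision_of_position_eq hg z₀.2 hz₀), norm_zero]; exact h0
  refine ⟨component_subset_sheet hg hz₀ hz, hlt.le, ?_⟩
  have := (triangle_le (μ := μ) k (position μ k z)).1
  rw [position_sub_pos] at this
  have e : offset μ k (z : Phase) = position μ k z - pos μ k.other := rfl
  rw [e]
  linarith

theorem singlyRegularized_circleFamily {L₁ : E3 × E3} (hL₁ : IsFirstLagrangePoint μ L₁)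
    (hc : c < H μ L₁) (hg : 0 < mass μ k) (hg' : 0 ≤ mass μ k.other) {z₀ : level μ k c}
    (hz₀ : position μ k z₀ = pos μ k) :
    ∃ Θ : level μ k c → ℂ,
      IsCircleFamily (singlyRegularized μ k c) (fun _ => hamVec (Q μ k c)) (connectedComponent z₀)
        (planar (singlyRegularized μ k c) (connectedComponent z₀)) Θ ∧
      page (connectedComponent z₀) Θ 1
        = {z | z ∈ connectedComponent z₀ ∧ (z : Phase).1 3 = 0 ∧ 0 ≤ (z : Phase).2 3} ∧
      page (connectedComponent z₀) Θ (-1)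
        = {z | z ∈ connectedComponent z₀ ∧ (z : Phase).1 3 = 0 ∧ (z : Phase).2 3 ≤ 0} := by
  obtain ⟨r, h0, h1, hr⟩ := exists_sphere_barrier hL₁ hc k hg hg'
  have hcl := c_lt_of_hill hg.le hg' h0 (sub_pos.2 h1) hr
  have hc' : c + mass μ k.other < 1 / 2 := by have := mass_add μ k; linarith
  obtain ⟨ε, hε, hest⟩ := exists_bookMap_estimates hg hg' hc' (sub_pos.2 h1) h0
  obtain ⟨C, δ, hC, hδ, hest⟩ := hest ε hε le_rfl
  have hcrit : ∀ y, IsLagrangePoint μ y → H μ y ≠ c := fun y hy =>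
    (hc.trans_le (hL₁.2 y hy)).ne'
  have hopen : ∀ z ∈ level μ k c, ∃ U ∈ 𝓝 z, U ∩ level μ k c ⊆ level μ k c := fun z _ =>
    ⟨univ, univ_mem, inter_subset_right⟩
  have hham : ∀ z ∈ level μ k c, hamVec (Q μ k c) z = field μ k c z := fun z hz => hamVec_Q c hz.2.1
  have hσ : ∀ z ∈ level μ k c, 0 < (1 - z.1 0) ^ 2 + ε * weight μ k z := fun z hz => by
    have := weight_pos hz.2.1
    positivity
  refine ⟨fun z => bookMap μ k ε z, ?_, ?_, ?_⟩
  · have : Finite (singlyRegularized μ k c).index := inferInstanceAs (Finite Unit)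
    refine isCircleFamily_of_cores (F := singlyRegularized μ k c) (fun _ => continuous_id)
      (fun _ => Function.injective_id) (chartChange_singlyRegularized _)
      (fun _ => (↑) ⁻¹' core μ c k r (1 - r))
      (fun _ => isCompact_preimage_core (fun z hz => hz.1) hg hg' (sub_pos.2 h1) h0)
      (fun z hz => mem_iUnion.2 ⟨(), z, component_subset_core hg hg' h0 h1 hr hz₀ hz, rfl⟩)
      (fun _ => exists_flow_of_isOpen_level (l := fun _ => 1) subset_rfl hopen
        (fun _ _ => contDiffAt_const) fun z hz => by rw [one_smul, hham z hz])
      (Ψ := fun _ => bookMap μ k ε)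
      ((contDiff_bookMap μ k ε).continuous.comp continuous_subtype_val) (fun _ _ => rfl)
      (fun _ => contDiff_bookMap μ k ε) ?_ ?_ (fun x hx => hx.1) ?_ ?_ (fun _ => ⟨C, δ, hC, hδ, ?_⟩)
    · intro _ z hz
      exact eventually_mem_connectedComponent (φ := id) subset_rfl hopen continuous_id
        (field_ne_zero hg (component_subset_sheet hg hz₀ hz) hcrit) hz
    · intro z hz
      refine (bookMap_eq_zero_iff hε z.2.2.1).trans ⟨fun h => ⟨hz, (), z, rfl, h⟩, ?_⟩
      rintro ⟨-, _, w, rfl, h⟩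
      exact h
    · intro _ z _ h
      obtain ⟨a, b⟩ := (bookMap_eq_zero_iff hε z.2.2.1).1 h
      exact exists_tangent_fderiv_bookMap hε z.2 a b
    · intro _ z hz
      have : field μ k c (z : Phase) ≠ 0 :=
        field_ne_zero hg (component_subset_sheet hg hz₀ hz) hcrit
      rwa [← hham z z.2] at this
    · intro z hz
      have := hest z hz
      rwa [← hham z z.2] at this
  · ext z
    refine and_congr_right fun _ => ?_
    rw [eq_norm_mul_one_iff, bookMap_im]
    refine and_congr_right fun h => ?_
    -- On `ξ₃ = 0` the real part of `bookMap` is a positive multiple of `η₃`, so the sign of `η₃`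
    -- selects the page.
    rw [bookMap_re h, mul_nonneg_iff_of_pos_left (hσ z z.2)]
  · ext z
    refine and_congr_right fun _ => ?_
    rw [eq_norm_mul_neg_one_iff, bookMap_im]
    refine and_congr_right fun h => ?_
    rw [bookMap_re h, mul_nonpos_iff_pos_imp_nonpos]
    have := hσ z z.2
    constructor
    · intro h'; exact h'.1 this
    · intro h'; exact ⟨fun _ => h', fun _ => this.le⟩

end Single

/-! ### Regularization at both primaries -/

instance : Finite Primary :=
  Finite.of_surjective (fun b : Bool => if b then Primary.moon else Primary.earth) (by
    rintro (_ | _)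
    · exact ⟨true, rfl⟩
    · exact ⟨false, rfl⟩)

lemma eq_or_eq_other (k j : Primary) : j = k ∨ j = k.other := by
  cases k <;> cases j <;> simp [Primary.other]

section Glue

variable {μ : ℝ} {k : Primary} {c : ℝ}

lemma glue_injective (k : Primary) : Function.Injective ((doublyRegularized μ c).incl k) := by
  intro z w h
  obtain ⟨h1, h2, h3⟩ : gluing μ c ⟨k, z⟩ ⟨k, w⟩ := Quotient.exact h
  by_cases h0 : (z : Phase).1 0 = 1
  · exact Subtype.ext (Prod.ext h1 (h3 h0))
  · exact Subtype.ext (eq_of_position_eq z.2.1.1 w.2.1.1 h0 h1 (add_left_cancel h2))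

/-- A collision at `k` lies over a position excluded from the other patch, so only noncollision
points are glued. -/
lemma switch_of_glue {z : sheet μ c k} {w : sheet μ c k.other}
    (h : gluing μ c ⟨k, z⟩ ⟨k.other, w⟩) : (z : Phase).1 0 ≠ 1 ∧ (w : Phase) = switch μ k z := by
  obtain ⟨h1, h2, -⟩ := h
  have h0 : (z : Phase).1 0 ≠ 1 := by
    intro h0
    have h3 : position μ k (z : Phase) = pos μ k := by
      rw [← sub_eq_zero, position_sub_pos, relPos_collision z.2.1.1 h0]
    have h4 := w.2.1.2.1
    rw [other_other] at h4
    exact h4 (h2.symm.trans h3)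
  refine ⟨h0, (eq_of_position_eq (switch_mem_TstarS3 z.2.1.1 h0) w.2.1.1 h0 h1 ?_).symm⟩
  exact add_left_cancel ((position_switch h0).trans h2)

lemma glue_switch (hg : 0 < mass μ k) (hg' : 0 < mass μ k.other) {z : Phase} (hz : z ∈ sheet μ c k)
    (h0 : z.1 0 ≠ 1) :
    (doublyRegularized μ c).incl k ⟨z, hz⟩
      = (doublyRegularized μ c).incl k.other ⟨switch μ k z, switch_mem_sheet hg hg' hz h0⟩ :=
  Quotient.sound ⟨rfl, (position_switch h0).symm, fun h => absurd h h0⟩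

lemma continuous_incl (k : Primary) : Continuous ((doublyRegularized μ c).incl k) :=
  continuous_quotient_mk'.comp (continuous_sigmaMk (σ := fun k => sheet μ c k))

lemma sheet_isOpen_level {z : Phase} (hz : z ∈ sheet μ c k) :
    ∃ U ∈ 𝓝 z, U ∩ level μ k c ⊆ sheet μ c k :=
  ⟨{w | 0 < f μ k c w}, (contDiffAt_f hz.1.2.1).continuousAt.eventually_const_lt hz.2,
    fun _ h => ⟨h.2, h.1⟩⟩

/-- The function `bookMap` on the glued space. -/
def gluedBookMap (μ c ε : ℝ) : (doublyRegularized μ c).carrier → ℂ :=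
  Quotient.lift (fun a : Σ k : Primary, sheet μ c k => bookMap μ a.1 ε a.2) (by
    rintro ⟨k, z⟩ ⟨j, w⟩ h
    rcases eq_or_eq_other k j with rfl | rfl
    · rw [glue_injective j (Quotient.sound h)]
    · obtain ⟨h0, hw⟩ := switch_of_glue h
      simp only [hw, bookMap_switch ε z.2.1.1 h0])

lemma continuous_gluedBookMap (μ c ε : ℝ) : Continuous (gluedBookMap μ c ε) :=
  Continuous.quotient_lift (continuous_sigma fun k =>
    (contDiff_bookMap μ k ε).continuous.comp continuous_subtype_val) _

/-- The function `barrier` on the glued space. -/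
def gluedBarrier (μ c x y : ℝ) : (doublyRegularized μ c).carrier → ℝ :=
  Quotient.lift (fun a : Σ k : Primary, sheet μ c k => barrier μ .moon x y (position μ a.1 a.2))
    fun _ _ h => congrArg (barrier μ .moon x y) h.2.1

lemma continuous_gluedBarrier (μ c x y : ℝ) : Continuous (gluedBarrier μ c x y) := by
  refine Continuous.quotient_lift (continuous_sigma fun k => ?_) _
  have h : Continuous fun z : sheet μ c k => position μ k z :=
    (contDiff_position μ k).continuous.comp continuous_subtype_val
  exact (continuous_const.mul (h.sub continuous_const).norm).add
    (continuous_const.mul (h.sub continuous_const).norm)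

lemma barrier_pos {x y : ℝ} (hx : 0 < x) (hy : 0 < y) (k : Primary) :
    barrier μ .moon x y (pos μ k) < 1 + x + y := by
  have h := norm_pos_sub μ .moon
  have h' := norm_pos_sub μ .earth
  simp only [Primary.other] at h h'
  cases k <;> simp only [barrier, Primary.other, sub_self, norm_zero, h, h'] <;> linarith

lemma gluedBarrier_ne (hm : ∀ k, 0 < mass μ k) {x y : ℝ} (hx : 0 < x) (hy : 0 < y)
    (h1 : hill μ .moon (1 + x) x < -c) (h2 : hill μ .moon y (1 + y) < -c) (p) :
    gluedBarrier μ c x y p ≠ 1 + x + y := by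
  obtain ⟨⟨k, z⟩, rfl⟩ := Quotient.exists_rep p
  change barrier μ .moon x y (position μ k z) ≠ _
  by_cases h0 : (z : Phase).1 0 = 1
  · have h3 : position μ k (z : Phase) = pos μ k := by
      rw [← sub_eq_zero, position_sub_pos, relPos_collision z.2.1.1 h0]
    rw [h3]
    exact (barrier_pos hx hy k).ne
  · exact barrier_ne (hm _).le (hm _).le hx hy h1 h2 (H_eq_energy (hm k) z.2 h0)

lemma norm_le_of_barrier {x y : ℝ} (hx : 0 < x) (hy : 0 < y) (hx1 : x < 1) (hy1 : y < 1) {q : E3}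
    (h : barrier μ .moon x y q < 1 + x + y) (k : Primary) :
    ‖q - pos μ k‖ ≤ (1 + x + y) / (1 + y - x) + (1 + x + y) / (1 + x - y) := by
  have hα : 0 < 1 + y - x := by linarith
  have hβ : 0 < 1 + x - y := by linarith
  have n1 := mul_nonneg hα.le (norm_nonneg (q - pos μ .moon))
  have n2 := mul_nonneg hβ.le (norm_nonneg (q - pos μ .earth))
  have p1 : 0 < (1 + x + y) / (1 + y - x) := by positivity
  have p2 : 0 < (1 + x + y) / (1 + x - y) := by positivity
  simp only [barrier, Primary.other] at h
  cases k
  · have : ‖q - pos μ .moon‖ ≤ (1 + x + y) / (1 + y - x) := by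
      rw [le_div_iff₀ hα]; linarith
    linarith
  · have : ‖q - pos μ .earth‖ ≤ (1 + x + y) / (1 + x - y) := by
      rw [le_div_iff₀ hβ]; linarith
    linarith

/-- The primaries are at distance `1`, so every position is at distance at least `1/2` from one of
them. If it is too close to the other primary for the core at `k`, the switched point lies in the
other core. -/
lemma exists_core_of_norm_le (hm : ∀ k, 0 < mass μ k) {R : ℝ} {z : sheet μ c k}
    (hR : ∀ j, ‖position μ k (z : Phase) - pos μ j‖ ≤ R) :
    ∃ (j : Primary) (w : sheet μ c j), (w : Phase) ∈ core μ c j R (1 / 2) ∧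
      (doublyRegularized μ c).incl j w = (doublyRegularized μ c).incl k z := by
  have hr := hR k
  rw [position_sub_pos] at hr
  rcases le_or_gt (1 / 2) ‖offset μ k (z : Phase)‖ with hW | hW
  · exact ⟨k, z, ⟨z.2, hr, hW⟩, rfl⟩
  · have ht := (triangle_le (μ := μ) k (position μ k z)).1
    rw [position_sub_pos] at ht
    change 1 ≤ ‖relPos (z : Phase)‖ + ‖offset μ k (z : Phase)‖ at ht
    have h0 : (z : Phase).1 0 ≠ 1 := by
      intro h0
      rw [relPos_collision z.2.1.1 h0, norm_zero] at ht
      linarith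
    have hs := switch_mem_sheet (hm k) (hm k.other) z.2 h0
    refine ⟨k.other, ⟨switch μ k z, hs⟩, ⟨hs, ?_, ?_⟩,
      (glue_switch (hm k) (hm k.other) z.2 h0).symm⟩
    · rw [relPos_switch h0]; exact hR k.other
    · rw [offset_switch h0]; linarith

end Glue

/-! ### Vector fields and estimates on the doubly regularized level set -/

section Double

variable {μ : ℝ} {c : ℝ}

lemma SmoothNear.contDiffAt {u : Phase → ℝ} {z : Phase} (h : SmoothNear u z) :
    ContDiffAt ℝ 1 u z := by
  obtain ⟨U, hU, hu⟩ := h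
  exact (hu.contDiffAt hU).of_le (by simp)

lemma chartChange_doublyRegularized (hm : ∀ k, 0 < mass μ k) {X : Primary → Phase → Phase}
    {l : Primary → Phase → ℝ} (hX : ∀ k, ∀ z ∈ sheet μ c k, X k z = l k z • field μ k c z)
    (hl : ∀ (z : sheet μ c .moon) (w : sheet μ c .earth), gluing μ c ⟨.moon, z⟩ ⟨.earth, w⟩ →
      l .moon z * (mass μ .moon * ‖position μ .moon z - pos μ .moon‖)
        = l .earth w * (mass μ .earth * ‖position μ .earth w - pos μ .earth‖)) :
    ChartChange (doublyRegularized μ c) X := by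
  have hl' : ∀ (k : Primary) (z : sheet μ c k) (w : sheet μ c k.other),
      gluing μ c ⟨k, z⟩ ⟨k.other, w⟩ → l k z * (mass μ k * ‖relPos (z : Phase)‖)
        = l k.other w * (mass μ k.other * ‖offset μ k (z : Phase)‖) := by
    intro k z w h
    have e : offset μ k (z : Phase) = relPos (w : Phase) := by
      obtain ⟨h0, hw⟩ := switch_of_glue h
      rw [hw, relPos_switch h0]
    rw [e, ← position_sub_pos μ k, ← position_sub_pos μ k.other]
    cases k
    · exact hl z w h
    · exact (hl w z ((gluing μ c).symm h)).symm
  intro i j w ζ t h hd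
  rcases eq_or_eq_other i j with rfl | rfl
  · refine ⟨ζ, Eventually.of_forall fun _ => rfl, ?_⟩
    rw [← glue_injective j h]
    exact hd
  · have hglue : gluing μ c ⟨i, ζ t⟩ ⟨i.other, w⟩ := Quotient.exact h
    obtain ⟨h0, hw⟩ := switch_of_glue hglue
    have hev : ∀ᶠ s in 𝓝 t, (ζ s : Phase).1 0 ≠ 1 := by
      have : ContinuousAt (fun s => (ζ s : Phase).1 0) t :=
        (contDiff_coord₁ 0).continuous.continuousAt.comp hd.continuousAt
      exact this.eventually_ne h0
    classical
    let ζ' : ℝ → sheet μ c i.other := fun s => if hs : (ζ s : Phase).1 0 ≠ 1 then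
      ⟨switch μ i (ζ s), switch_mem_sheet (hm i) (hm _) (ζ s).2 hs⟩ else w
    have hζ' : ∀ s (hs : (ζ s : Phase).1 0 ≠ 1),
        ζ' s = ⟨switch μ i (ζ s), switch_mem_sheet (hm i) (hm _) (ζ s).2 hs⟩ := fun s hs => dif_pos hs
    refine ⟨ζ', ?_, ?_⟩
    · filter_upwards [hev] with s hs
      rw [hζ' s hs]
      exact glue_switch (hm i) (hm _) (ζ s).2 hs
    · have hd' : HasDerivAt (fun s => (ζ s : Phase)) (l i (ζ t) • field μ i c (ζ t)) t := by
        rw [← hX i _ (ζ t).2]; exact hd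
      have := hasDerivAt_switch (hm i) (hm _) (ζ := fun s => (ζ s : Phase)) (fun s => (ζ s).2) h0 hd'
        (hl' i (ζ t) w hglue)
      rw [hX _ _ w.2, hw]
      rw [hw] at this
      refine this.congr_of_eventuallyEq ?_
      filter_upwards [hev] with s hs
      rw [hζ' s hs]

/-- Rescaling the field by `l` changes the constants by at most the extrema of `l` on the compact
core, and leaves the function `Ψ` alone. This is why one `Θ` serves for all regularized fields. -/
lemma estimates_smul {K : Set Phase} (hK : IsCompact K) {Ψ : Phase → ℂ} {V Y : Phase → Phase}
    {l : Phase → ℝ} (hl : ContinuousOn l K) (hpos : ∀ z ∈ K, 0 < l z) (hY : ∀ z ∈ K, Y z = l z • V z)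
    {C δ : ℝ} (hC : 0 < C) (hδ : 0 < δ)
    (h : ∀ z ∈ K, ‖fderiv ℝ Ψ z (V z)‖ ≤ C * ‖Ψ z‖ ∧
      δ * ‖Ψ z‖ ^ 2 ≤ (star (Ψ z) * fderiv ℝ Ψ z (V z)).im) :
    ∃ C δ : ℝ, 0 < C ∧ 0 < δ ∧ ∀ z ∈ K, ‖fderiv ℝ Ψ z (Y z)‖ ≤ C * ‖Ψ z‖ ∧
      δ * ‖Ψ z‖ ^ 2 ≤ (star (Ψ z) * fderiv ℝ Ψ z (Y z)).im := by
  rcases K.eq_empty_or_nonempty with rfl | hne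
  · exact ⟨1, 1, one_pos, one_pos, by simp⟩
  obtain ⟨a, ha, hmax⟩ := hK.exists_isMaxOn hne hl
  obtain ⟨b, hb, hmin⟩ := hK.exists_isMinOn hne hl
  refine ⟨l a * C, l b * δ, mul_pos (hpos a ha) hC, mul_pos (hpos b hb) hδ, fun z hz => ?_⟩
  obtain ⟨h1, h2⟩ := h z hz
  have e1 : l z ≤ l a := hmax hz
  have e2 : l b ≤ l z := hmin hz
  have p := hpos z hz
  have p' := hpos a ha
  rw [hY z hz, map_smul]
  constructor
  · rw [norm_smul, Real.norm_of_nonneg p.le, mul_assoc]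
    gcongr
  · rw [mul_smul_comm, Complex.smul_im, smul_eq_mul, mul_assoc]
    have n : 0 ≤ δ * ‖Ψ z‖ ^ 2 := by positivity
    gcongr

theorem doublyRegularized_circleFamily (h0 : 0 < μ) (h1 : μ < 1) {L₁ L₂ : E3 × E3}
    (hL₁ : IsFirstLagrangePoint μ L₁) (hL₂ : IsSecondLagrangePoint μ L₁ L₂) (hc₁ : H μ L₁ < c)
    (hc₂ : c < H μ L₂) (k : Primary) (z₀ : sheet μ c k) (hz₀ : position μ k z₀ = pos μ k) :
    ∃ Θ : (doublyRegularized μ c).carrier → ℂ, ∀ X : Primary → Phase → Phase,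
      IsRegularizedField μ c X →
        IsCircleFamily (doublyRegularized μ c) X
          (connectedComponent ((doublyRegularized μ c).incl k z₀))
          (planar (doublyRegularized μ c) (connectedComponent ((doublyRegularized μ c).incl k z₀)))
          Θ := by
  have hm : ∀ k, 0 < mass μ k := by rintro (_ | _) <;> simp [mass, h0, h1]
  obtain ⟨x, hx, hx1, hbx⟩ := exists_outer_barrier hL₁ hL₂ hc₂ .moon (hm _) (hm _)
  obtain ⟨y, hy, hy1, hby⟩ := exists_outer_barrier hL₁ hL₂ hc₂ .earth (hm _) (hm _)
  have hby' : hill μ .moon y (1 + y) < -c := by rw [← hill_other]; exact hby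
  set R := (1 + x + y) / (1 + y - x) + (1 + x + y) / (1 + x - y) with hR
  have hR0 : 0 < R := by
    have hα : 0 < 1 + y - x := by linarith
    have hβ : 0 < 1 + x - y := by linarith
    positivity
  have hcl := c_lt_of_hill (hm _).le (hm _).le (by linarith) hx hbx
  have hc' : ∀ k : Primary, c + mass μ k.other < 1 / 2 := fun k => by
    have := mass_add μ k
    have := hm k
    linarith
  have hw₀ : (0 : ℝ) < 1 / 2 := by norm_num
  choose ε₀ hε₀ hest using fun k => exists_bookMap_estimates (hm k) (hm k.other).le (hc' k) hw₀ hR0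
  have : Nonempty Primary := ⟨.moon⟩
  -- The two local expressions are glued only for equal `ε`, so the smaller of the two thresholds is
  -- used at both primaries; it is fixed before the field `X` is given.
  obtain ⟨k₀, hk₀⟩ := Finite.exists_min ε₀
  have hε : 0 < ε₀ k₀ := hε₀ k₀
  set ε := ε₀ k₀
  have hcrit : ∀ y, IsLagrangePoint μ y → H μ y ≠ c := by
    rintro y hy rfl
    exact absurd (hL₂.2.2 y hy hc₁) (not_le.2 hc₂)
  refine ⟨gluedBookMap μ c ε, fun X ⟨l, hl, hcompat⟩ => ?_⟩
  have hX : ∀ k, ∀ z ∈ sheet μ c k, X k z = l k z • field μ k c z := fun k z hz => by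
    rw [(hl k z hz).2.2, hamVec_Q c hz.1.2.1]
  have hlt := lt_of_ne_of_isPreconnected
    (isPreconnected_connectedComponent (x := (doublyRegularized μ c).incl k z₀))
    (continuous_gluedBarrier μ c x y).continuousOn
    (fun p _ => gluedBarrier_ne hm hx hy hbx hby' p) mem_connectedComponent
    (show barrier μ .moon x y (position μ k z₀) < _ by rw [hz₀]; exact barrier_pos hx hy k)
  have hcover : connectedComponent ((doublyRegularized μ c).incl k z₀)
      ⊆ ⋃ i, (doublyRegularized μ c).incl i '' ((↑) ⁻¹' core μ c i R (1 / 2)) := by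
    intro p hp
    obtain ⟨⟨j, z⟩, rfl⟩ := Quotient.exists_rep p
    obtain ⟨i, w, hw, he⟩ := exists_core_of_norm_le hm (norm_le_of_barrier hx hy hx1 hy1 (hlt _ hp))
    exact mem_iUnion.2 ⟨i, w, hw, he⟩
  have : Finite (doublyRegularized μ c).index := inferInstanceAs (Finite Primary)
  refine isCircleFamily_of_cores (F := doublyRegularized μ c) continuous_incl glue_injective
    (chartChange_doublyRegularized hm hX hcompat)
    (fun i => (↑) ⁻¹' core μ c i R (1 / 2))
    (fun i => isCompact_preimage_core subset_rfl (hm i) (hm i.other).le hw₀ hR0) hcover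
    (fun i => exists_flow_of_isOpen_level (P := sheet μ c i) (l := l i) (fun z hz => hz.1)
      (fun z hz => sheet_isOpen_level hz) (fun z hz => (hl i z hz).1.contDiffAt) (hX i))
    (Ψ := fun i => bookMap μ i ε) (continuous_gluedBookMap μ c ε) (fun _ _ => rfl)
    (fun i => contDiff_bookMap μ i ε) ?_ ?_ (fun x hx => hx.1) ?_ ?_ (fun i => ?_)
  · intro i z hz
    exact eventually_mem_connectedComponent (P := sheet μ c i) (fun z hz => hz.1)
      (fun z hz => sheet_isOpen_level hz) (continuous_incl i) (field_ne_zero (hm i) z.2 hcrit) hz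
  · intro p hp
    constructor
    · intro h
      obtain ⟨⟨j, z⟩, rfl⟩ := Quotient.exists_rep p
      exact ⟨hp, j, z, rfl, (bookMap_eq_zero_iff hε z.2.1.2.1).1 h⟩
    · rintro ⟨-, j, z, rfl, h⟩
      exact (bookMap_eq_zero_iff hε z.2.1.2.1).2 h
  · intro i z _ h
    obtain ⟨a, b⟩ := (bookMap_eq_zero_iff hε z.2.1.2.1).1 h
    exact exists_tangent_fderiv_bookMap hε z.2.1 a b
  · intro i z _
    rw [hX i z z.2]
    exact smul_ne_zero (hl i z z.2).2.1.ne' (field_ne_zero (hm i) z.2 hcrit)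
  · obtain ⟨C, δ, hC, hδ, he⟩ := hest i ε hε (hk₀ i)
    obtain ⟨C', δ', hC', hδ', he'⟩ := estimates_smul (isCompact_core (hm i) (hm i.other).le hw₀ hR0)
      (fun z hz => (hl i z hz.1).1.contDiffAt.continuousAt.continuousWithinAt)
      (fun z hz => (hl i z hz.1).2.1) (fun z hz => hX i z hz.1) hC hδ he
    exact ⟨C', δ', hC', hδ', fun z hz => he' z hz⟩

end Double

end CR3BP

end

theorem theorem1p2 (μ : ℝ) (hμ0 : 0 ≤ μ) (hμ1 : μ ≤ 1) (c : ℝ)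
    (L₁ : E3 × E3) (hL₁ : IsFirstLagrangePoint μ L₁) :
    (c < H μ L₁ →
      ∀ (k : Primary), 0 < mass μ k →
      ∀ z₀ : level μ k c, position μ k z₀ = pos μ k →
        let F : PatchedSpace := singlyRegularized μ k c
        let X : F.index → Phase → Phase := fun _ => hamVec (Q μ k c)
        let S : Set (level μ k c) := connectedComponent z₀
        let Pplus : Set (level μ k c) := {z | z ∈ S ∧ (z : Phase).1 3 = 0 ∧ 0 ≤ (z : Phase).2 3}
        let Pminus : Set (level μ k c) := {z | z ∈ S ∧ (z : Phase).1 3 = 0 ∧ (z : Phase).2 3 ≤ 0}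
        IsGlobalHypersurfaceOfSection F X S Pplus (planar F S) ∧
        IsGlobalHypersurfaceOfSection F X S Pminus (planar F S) ∧
        ∃ Θ : F.carrier → ℂ, IsCircleFamily F X S (planar F S) Θ ∧
          page S Θ 1 = Pplus ∧ page S Θ (-1) = Pminus) ∧
    (0 < μ → μ < 1 →
      ∀ L₂ : E3 × E3, IsSecondLagrangePoint μ L₁ L₂ → H μ L₁ < c → c < H μ L₂ →
      ∀ (k : Primary) (z₀ : sheet μ c k), position μ k z₀ = pos μ k →
        let F : PatchedSpace := doublyRegularized μ c
        let S : Set F.carrier := connectedComponent (F.incl k z₀)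
        ∃ Θ : F.carrier → ℂ, ∀ X : Primary → Phase → Phase, IsRegularizedField μ c X →
          IsCircleFamily F X S (planar F S) Θ) := by
  refine ⟨fun hc k hg z₀ hz₀ => ?_, fun h0 h1 L₂ hL₂ hc₁ hc₂ k z₀ hz₀ =>
    doublyRegularized_circleFamily h0 h1 hL₁ hL₂ hc₁ hc₂ k z₀ hz₀⟩
  have hg' : 0 ≤ mass μ k.other := by cases k <;> simp [mass, Primary.other, hμ0, hμ1]
  obtain ⟨Θ, hΘ, h1, h2⟩ := singlyRegularized_circleFamily hL₁ hc hg hg' hz₀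
  exact ⟨h1 ▸ hΘ.pages 1, h2 ▸ hΘ.pages (-1), Θ, hΘ, h1, h2⟩
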